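/- Let $\{\Phi_e\}_{e\in\mathbb{N}}$ be an effective enumeration of all Turing functionals on Baire space $\mathbb{N}^{\mathbb{N}}$. A partial function $\Gamma:\subseteq\mathbb{N}^{\mathbb{N}}\to\mathbb{N}^{\mathbb{N}}$ is *team-learnable* (i.e. $(<\omega,\omega)$-computable) if there are finitely many computable learners $\Psi_0,\dots,\Psi_{b-1}:\mathbb{N}^{<\mathbb{N}}\to\mathbb{N}$ such that for every $g\in\mathrm{dom}(\Gamma)$ there is $i<b$ for which $e=\lim_n\Psi_i(g\upharpoonright n)$ exists and $\Phi_e(g)=\Gamma(g)$. For $P,Q\subseteq\mathbb{N}^{\mathbb{N}}$ write $P\leq^{<\omega}_{\omega}Q$ if some team-learnable partial function is defined on $Q$ and maps $Q$ into $P$. Let $\Sigma^0_2\text{-}\mathsf{LEM}$ be the multi-valued function on $\mathbb{N}^{\mathbb{N}}$ that sends $x$ (viewed as a function of two variables) to an answer to $\exists s\forall t\,x(s,t)=0\;\vee\;\forall s\exists t\,x(s,t)\neq 0$, that is, either to $0$ together with an $s$ such that $\forall t\,x(s,t)=0$, or to $1$ together with a function $s\mapsto t_s$ such that $\forall s\,x(s,t_s)\neq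 0$. Write $P\leq_{\Sigma^0_2\text{-}\mathsf{LEM}}Q$ if, for some $k\in\mathbb{N}$, there is a partial multi-valued function that is Weihrauch reducible to the $k$-fold compositional product of $\Sigma^0_2\text{-}\mathsf{LEM}$ with itself (the identity, if $k=0$), whose domain includes $Q$ and all of whose values on points of $Q$ lie in $P$. Both relations are preorders on the power set of $\mathbb{N}^{\mathbb{N}}$. Let $\mathcal{D}^{<\omega}_{\omega}$ and $\mathcal{P}^{<\omega}_{\omega}$ be the partial orders induced by $\leq^{<\omega}_{\omega}$ on the set of all subsets of $\mathbb{N}^{\mathbb{N}}$ and on the set of all nonempty $\Pi^0_1$ subsets of Cantor space $2^{\mathbb{N}}$, respectively. Call a partial order *Brouwerian* if for all $p,q$ there is a least $r$ with $p\leq q\vee r$ (where $p\leq q\vee s$ means that every common upper bound of $q$ and $s$ is above $p$). **Theorem.** $\mathcal{D}^{<\omega}_{\omega}$ and $\mathcal{P}^{<\omega}_{\omega}$ are not Brouwerian. Moreover, the partial orders induced by $\leq_{\Sigma^0_2\text{-}\mathsf{LEM}}$ on the set of all subsets of $\mathbb{N}^{\mathbb{N}}$ and on the set of all nonempty $\Pi^0_1$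 subsets of $2^{\mathbb{N}}$ are not Brouwerian. -/

import Mathlib

open Filter

namespace MassProblems

/-! ## Turing functionals on Baire space -/

/-- The initial segment `f ↾ n` of length `n` of a point `f` of Baire space. -/
def initSeg (f : ℕ → ℕ) (n : ℕ) : List ℕ := (List.range n).map f

/-- The join `f ⊕ g`: `(f ⊕ g)(2n) = f(n)` and `(f ⊕ g)(2n+1) = g(n)`. -/
def join (f g : ℕ → ℕ) : ℕ → ℕ := fun n => if n % 2 = 0 then f (n / 2) else g (n / 2)

/-- Step `s = ⟨k, l⟩` of the computation of the `e`-th Turing functional with oracle `f` and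
input `n`: run the `e`-th program for `k` steps on the finite oracle `f ↾ l` and the input `n`. -/
def step (e : ℕ) (f : ℕ → ℕ) (n s : ℕ) : Option ℕ :=
  Nat.Partrec.Code.evaln s.unpair.1 (Denumerable.ofNat Nat.Partrec.Code e)
    (Nat.pair (Encodable.encode (initSeg f s.unpair.2)) n)

/-- The effective enumeration `Φ_e` of all Turing functionals: `Φ_e(f; n)` is the result of the
first successful step, and it is undefined if there is none. -/
def Phi (e : ℕ) (f : ℕ → ℕ) (n : ℕ) : Part ℕ := Nat.rfindOpt (step e f n)

/-- `Φ_e(f)` is total and equal to `g`. -/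
def PhiEq (e : ℕ) (f g : ℕ → ℕ) : Prop := ∀ n, g n ∈ Phi e f n

/-! ## Team learnability -/

/-- A partial function with value `h` at `g` is identified by the learner `Ψ` on `g`: the guesses
`Ψ(g ↾ n)` converge to some index `e`, and `Φ_e(g) = h`. -/
def IdentifiedOn (Ψ : List ℕ → ℕ) (g h : ℕ → ℕ) : Prop :=
  ∃ e, (∀ᶠ n in atTop, Ψ (initSeg g n) = e) ∧ PhiEq e g h

/-- `(<ω, ω)`-computability of a partial function on Baire space: there is a finite team of
computable learners such that, on every point of the domain, the function is identified by some
member of the team. -/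
def TeamLearnable (Γ : (ℕ → ℕ) →. (ℕ → ℕ)) : Prop :=
  ∃ (b : ℕ) (Ψ : Fin b → List ℕ → ℕ), (∀ i, Computable (Ψ i)) ∧
    ∀ g h, h ∈ Γ g → ∃ i, IdentifiedOn (Ψ i) g h

/-- `P ≤^{<ω}_ω Q`: some team-learnable partial function is defined on `Q` and maps `Q` into
`P`. -/
def TeamLE (P Q : Set (ℕ → ℕ)) : Prop :=
  ∃ Γ : (ℕ → ℕ) →. (ℕ → ℕ), TeamLearnable Γ ∧ ∀ g ∈ Q, ∃ h ∈ Γ g, h ∈ P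

/-! ## Multi-valued functions and the law of excluded middle for `Σ⁰₂` formulas -/

/-- Partial multi-valued functions on Baire space; the domain is where the value is nonempty. -/
abbrev Multi : Type := (ℕ → ℕ) → Set (ℕ → ℕ)

/-- Weihrauch reducibility `F ≤_W G`. -/
def WeihrauchLE (F G : Multi) : Prop :=
  ∃ h k : ℕ, ∀ x, (F x).Nonempty → ∃ y, PhiEq h x y ∧ (G y).Nonempty ∧
    ∀ z ∈ G y, ∃ w ∈ F x, PhiEq k (join x z) w

/-- Composition `F ∘ G` of partial multi-valued functions; its domain consists of the `x` in the
domain of `G` with `G(x)` contained in the domain of `F`. -/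
def Multi.comp (F G : Multi) : Multi :=
  fun x => {z | (∀ y ∈ G x, (F y).Nonempty) ∧ ∃ y ∈ G x, z ∈ F y}

/-- `IterLE F k G`: `G` is Weihrauch reducible to the `k`-fold compositional product
`F ⋆ ⋯ ⋆ F`, where `F ⋆ G = max {F* ∘ G* : F* ≤_W F, G* ≤_W G}` and the empty product is the
identity. In words: `G` can be solved with `k` successive applications of `F`. -/
def IterLE (F : Multi) : ℕ → Multi → Prop
  | 0, G => WeihrauchLE G fun x => {x}
  | k + 1, G => ∃ A B : Multi, WeihrauchLE A F ∧ IterLE F k B ∧ WeihrauchLE G (A.comp B)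

/-- The `Σ⁰₂` law of excluded middle `∃ s ∀ t, x(s,t) = 0 ∨ ∀ s ∃ t, x(s,t) ≠ 0` as a (total)
multi-valued function: given `x`, it says which of the two alternatives holds and gives witnesses
for it. -/
def sigma2LEM : Multi := fun x =>
  {y | (y 0 = 0 ∧ ∀ t, x (Nat.pair (y 1) t) = 0) ∨
       (y 0 = 1 ∧ ∀ s, x (Nat.pair s (y (s + 1))) ≠ 0)}

/-- `P ≤_{Σ⁰₂-LEM} Q`: there is a multi-valued function, obtained from a finite iteration of
`Σ⁰₂-LEM`, that is defined on `Q` and maps `Q` into `P`. -/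
def LemLE (P Q : Set (ℕ → ℕ)) : Prop :=
  ∃ (k : ℕ) (G : Multi), IterLE sigma2LEM k G ∧ ∀ x ∈ Q, (G x).Nonempty ∧ G x ⊆ P

/-! ## Facts showing that the two reducibilities are preorders -/

theorem initSeg_length (f : ℕ → ℕ) (n : ℕ) : (initSeg f n).length = n := by
  simp [initSeg]

theorem initSeg_take (f : ℕ → ℕ) {m n : ℕ} (h : m ≤ n) : (initSeg f n).take m = initSeg f m := by
  simp [initSeg, ← List.map_take, List.take_range, h]

theorem initSeg_getElem? (f : ℕ → ℕ) {m n : ℕ} (h : m < n) : (initSeg f n)[m]? = some (f m) := by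
  simp [initSeg, h]

theorem PhiEq.unique {e : ℕ} {f g h : ℕ → ℕ} (hg : PhiEq e f g) (hh : PhiEq e f h) : g = h :=
  funext fun n => Part.mem_unique (hg n) (hh n)

/-- Computable families of approximations on finite strings have computable indices. -/
theorem exists_index {H : ℕ → List ℕ → ℕ → Option ℕ}
    (hH : Computable fun p : ℕ × List ℕ × ℕ => H p.1 p.2.1 p.2.2) :
    ∃ c : ℕ → ℕ, Computable c ∧ ∀ (a : ℕ) (f g : ℕ → ℕ),
      (∀ n, ∃ l, H a (initSeg f l) n = some (g n)) →
      (∀ n l v, H a (initSeg f l) n = some v → v = g n) → PhiEq (c a) f g := by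
  have hp : Partrec fun p : ℕ × List ℕ × ℕ => (H p.1 p.2.1 p.2.2 : Part ℕ) := hH.ofOption
  have hdec : Computable fun m : ℕ =>
      ((m.unpair.1, ((Encodable.decode (α := List ℕ) m.unpair.2.unpair.1).getD [],
        m.unpair.2.unpair.2)) : ℕ × List ℕ × ℕ) := by
    have h1 : Computable fun m : ℕ => m.unpair.1 := (Primrec.fst.comp Primrec.unpair).to_comp
    have h2 : Computable fun m : ℕ => m.unpair.2 := (Primrec.snd.comp Primrec.unpair).to_comp
    have h3 : Computable fun m : ℕ => (Encodable.decode (α := List ℕ) m).getD [] :=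
      Computable.option_getD Computable.decode (Computable.const [])
    exact h1.pair ((h3.comp (h1.comp h2)).pair (h2.comp h2))
  obtain ⟨U, hU⟩ := Nat.Partrec.Code.exists_code.1 (Partrec.nat_iff.1 (hp.comp hdec))
  refine ⟨fun a => Encodable.encode (U.curry a),
    Computable.encode.comp (Nat.Partrec.Code.primrec₂_curry.comp (Primrec.const U)
      Primrec.id).to_comp, ?_⟩
  intro a f g h1 h2 n
  have key : ∀ l, Nat.Partrec.Code.eval (U.curry a)
      (Nat.pair (Encodable.encode (initSeg f l)) n) = (H a (initSeg f l) n : Part ℕ) := by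
    intro l
    rw [Nat.Partrec.Code.eval_curry, hU]
    simp
  have hdom : (Phi (Encodable.encode (U.curry a)) f n).Dom := by
    rw [Phi, Nat.rfindOpt_dom]
    obtain ⟨l, hl⟩ := h1 n
    have hm : g n ∈ Nat.Partrec.Code.eval (U.curry a)
        (Nat.pair (Encodable.encode (initSeg f l)) n) := by
      rw [key, hl]; exact Part.mem_some _
    obtain ⟨k, hk⟩ := Nat.Partrec.Code.evaln_complete.1 hm
    exact ⟨Nat.pair k l, g n, by simpa [step] using hk⟩
  obtain ⟨v, hv⟩ := Part.dom_iff_mem.1 hdom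
  obtain ⟨s, hs⟩ := Nat.rfindOpt_spec hv
  have hs' := Nat.Partrec.Code.evaln_sound hs
  rw [Denumerable.ofNat_encode, key, Part.mem_ofOption] at hs'
  rw [← h2 n _ v hs']
  exact hv

/-- The first value of the computation of `Φ_e(σ; n)` found within `m` steps. -/
def phiStr (e : ℕ) (σ : List ℕ) (n : ℕ) : ℕ → Option ℕ
  | 0 => none
  | s + 1 => (phiStr e σ n s).orElse fun _ =>
      Nat.Partrec.Code.evaln s.unpair.1 (Denumerable.ofNat Nat.Partrec.Code e)
        (Nat.pair (Encodable.encode (σ.take s.unpair.2)) n)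

/-- The part of the output `Φ_e(σ)` found within `|σ|` steps. -/
def outStr (e : ℕ) (σ : List ℕ) : List ℕ :=
  (((List.range σ.length).map fun n => phiStr e σ n σ.length).takeWhile Option.isSome).map
    fun o => o.getD 0

theorem phiStr_primrec :
    Primrec fun p : (ℕ × List ℕ) × ℕ => phiStr p.1.1 p.1.2 p.2 p.1.2.length := by
  have hstep : Primrec₂ fun (p : (ℕ × List ℕ) × ℕ) (q : ℕ × Option ℕ) =>
      (q.2.orElse fun _ => Nat.Partrec.Code.evaln q.1.unpair.1
        (Denumerable.ofNat Nat.Partrec.Code p.1.1)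
        (Nat.pair (Encodable.encode (p.1.2.take q.1.unpair.2)) p.2)) := by
    have hs : Primrec fun x : ((ℕ × List ℕ) × ℕ) × (ℕ × Option ℕ) => x.2.1 :=
      Primrec.fst.comp Primrec.snd
    have he : Primrec fun x : ((ℕ × List ℕ) × ℕ) × (ℕ × Option ℕ) => x.1.1.1 :=
      Primrec.fst.comp (Primrec.fst.comp Primrec.fst)
    have hσ : Primrec fun x : ((ℕ × List ℕ) × ℕ) × (ℕ × Option ℕ) => x.1.1.2 :=
      Primrec.snd.comp (Primrec.fst.comp Primrec.fst)
    have hn : Primrec fun x : ((ℕ × List ℕ) × ℕ) × (ℕ × Option ℕ) => x.1.2 :=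
      Primrec.snd.comp Primrec.fst
    have hk := (Primrec.fst.comp Primrec.unpair).comp hs
    have hl := (Primrec.snd.comp Primrec.unpair).comp hs
    have hin := Primrec₂.natPair.comp (Primrec.encode.comp (Primrec.list_take.comp hl hσ)) hn
    have hev := Nat.Partrec.Code.primrec_evaln.comp
      ((hk.pair ((Primrec.ofNat Nat.Partrec.Code).comp he)).pair hin)
    exact (Primrec.option_orElse.comp (Primrec.snd.comp Primrec.snd) hev).to₂
  refine (Primrec.nat_rec' (Primrec.list_length.comp (Primrec.snd.comp Primrec.fst))
    (Primrec.const none) hstep).of_eq fun p => ?_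
  generalize p.1.2.length = m
  induction m with
  | zero => rfl
  | succ m ih => simp only [phiStr, ← ih]

theorem outStr_primrec : Primrec fun p : ℕ × List ℕ => outStr p.1 p.2 := by
  have h1 : Primrec fun p : ℕ × List ℕ =>
      (List.range p.2.length).map fun n => phiStr p.1 p.2 n p.2.length :=
    Primrec.list_map (Primrec.list_range.comp (Primrec.list_length.comp Primrec.snd))
      phiStr_primrec.to₂
  exact Primrec.list_map ((Primrec.list_takeWhile Primrec.option_isSome).comp h1)
    ((Primrec.option_getD.comp Primrec.snd (Primrec.const 0)).to₂)

theorem mem_Phi_iff {e : ℕ} {f : ℕ → ℕ} {n v : ℕ} :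
    v ∈ Phi e f n ↔ ∃ s, step e f n s = some v ∧ ∀ s' < s, step e f n s' = none := by
  have hr : ∀ s, s ∈ Nat.rfind (fun m => ((step e f n m).isSome : Part Bool)) ↔
      (step e f n s).isSome = true ∧ ∀ s' < s, step e f n s' = none := by
    intro s
    refine Nat.mem_rfind.trans (and_congr ?_ (forall₂_congr fun m _ => ?_))
    · cases step e f n s <;> simp
    · cases step e f n m <;> simp
  simp only [Phi, Nat.rfindOpt, Part.mem_bind_iff, Part.mem_ofOption, Option.mem_def]
  constructor
  · rintro ⟨s, hs, hv⟩
    exact ⟨s, hv, ((hr s).1 hs).2⟩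
  · rintro ⟨s, hv, hs⟩
    exact ⟨s, (hr s).2 ⟨by simp [hv], hs⟩, hv⟩

theorem phiStr_succ {e : ℕ} {f : ℕ → ℕ} {l n m : ℕ} (hm : m ≤ l) :
    phiStr e (initSeg f l) n (m + 1) =
      (phiStr e (initSeg f l) n m).orElse fun _ => step e f n m := by
  rw [phiStr, initSeg_take f ((Nat.unpair_right_le m).trans hm)]
  rfl

theorem phiStr_eq_none {e : ℕ} {f : ℕ → ℕ} {l n m : ℕ} (hm : m ≤ l) :
    phiStr e (initSeg f l) n m = none ↔ ∀ s < m, step e f n s = none := by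
  induction m with
  | zero => simp [phiStr]
  | succ m ih =>
    rw [phiStr_succ (by omega), Nat.forall_lt_succ_right, ← ih (by omega)]
    cases phiStr e (initSeg f l) n m <;> simp

theorem phiStr_sound_aux {e : ℕ} {f : ℕ → ℕ} {l n m v : ℕ} (hm : m ≤ l)
    (h : phiStr e (initSeg f l) n m = some v) : v ∈ Phi e f n := by
  induction m with
  | zero => simp [phiStr] at h
  | succ m ih =>
    rw [phiStr_succ (by omega)] at h
    rcases hp : phiStr e (initSeg f l) n m with _ | w
    · rw [hp] at h
      exact mem_Phi_iff.2 ⟨m, h, (phiStr_eq_none (by omega)).1 hp⟩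
    · rw [hp] at h ih
      exact ih (by omega) h

theorem phiStr_sound {e : ℕ} {f : ℕ → ℕ} {l n v : ℕ} (h : phiStr e (initSeg f l) n l = some v) :
    v ∈ Phi e f n :=
  phiStr_sound_aux le_rfl h

theorem phiStr_complete {e : ℕ} {f : ℕ → ℕ} {n v : ℕ} (h : v ∈ Phi e f n) :
    ∃ N, ∀ l ≥ N, phiStr e (initSeg f l) n l = some v := by
  obtain ⟨s, hs, -⟩ := mem_Phi_iff.1 h
  refine ⟨s + 1, fun l hl => ?_⟩
  rcases hp : phiStr e (initSeg f l) n l with _ | w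
  · rw [(phiStr_eq_none le_rfl).1 hp s (by omega)] at hs
    cases hs
  · rw [Part.mem_unique (phiStr_sound hp) h]

theorem outStr_spec {e : ℕ} {f g : ℕ → ℕ} (h : PhiEq e f g) :
    ∃ t : ℕ → ℕ, Tendsto t atTop atTop ∧ ∀ l, outStr e (initSeg f l) = initSeg g (t l) := by
  have key : ∀ l, ∃ t, outStr e (initSeg f l) = initSeg g t ∧
      ∀ m ≤ l, (∀ n < m, (phiStr e (initSeg f l) n l).isSome) → m ≤ t := by
    intro l
    set F : ℕ → Option ℕ := fun n => phiStr e (initSeg f l) n l with hF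
    have hout : outStr e (initSeg f l) =
        (((List.range l).map F).takeWhile Option.isSome).map fun o => o.getD 0 := by
      simp only [outStr, initSeg_length, hF]
    obtain ⟨t, htl, ht⟩ : ∃ t ≤ l,
        ((List.range l).map F).takeWhile Option.isSome = (List.range t).map F := by
      have hpre := List.takeWhile_prefix (l := (List.range l).map F) Option.isSome
      have hle := hpre.length_le
      rw [List.prefix_iff_eq_take] at hpre
      refine ⟨_, by simpa using hle, ?_⟩
      rw [← List.map_take, List.take_range, min_eq_left (by simpa using hle)] at hpre
      exact hpre
    refine ⟨t, ?_, ?_⟩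
    · rw [hout, ht, initSeg, List.map_map]
      refine List.map_congr_left fun n hn => ?_
      have hsome : (F n).isSome = true := by
        refine List.mem_takeWhile_imp (l := (List.range l).map F) (p := Option.isSome) ?_
        rw [ht]
        exact List.mem_map_of_mem hn
      obtain ⟨v, hv⟩ := Option.isSome_iff_exists.1 hsome
      simp [hv, Part.mem_unique (phiStr_sound hv) (h n)]
    · intro m hm hall
      have hsplit : (List.range l).map F =
          (List.range m).map F ++ ((List.range l).map F).drop m := by
        conv_lhs => rw [← List.take_append_drop m ((List.range l).map F)]
        rw [← List.map_take, List.take_range, min_eq_left hm]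
      rw [hsplit, List.takeWhile_append_of_pos (by
        intro o ho
        obtain ⟨n, hn, rfl⟩ := List.mem_map.1 ho
        exact hall n (List.mem_range.1 hn))] at ht
      have := congrArg List.length ht
      simp at this
      omega
  choose t ht1 ht2 using key
  refine ⟨t, tendsto_atTop.2 fun m => ?_, ht1⟩
  have hN : ∀ n, ∃ N, ∀ l ≥ N, phiStr e (initSeg f l) n l = some (g n) :=
    fun n => phiStr_complete (h n)
  choose N hN using hN
  filter_upwards [eventually_ge_atTop m, eventually_ge_atTop ((Finset.range m).sup N)] with l h1 h2
  refine ht2 l m h1 fun n hn => ?_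
  rw [hN n l ((Finset.le_sup (Finset.mem_range.2 hn)).trans h2)]
  rfl

/-- Indices of compositions can be computed. -/
theorem exists_index_comp : ∃ c : ℕ → ℕ → ℕ, Computable₂ c ∧ ∀ (d e : ℕ) (f g h : ℕ → ℕ),
    PhiEq d f g → PhiEq e g h → PhiEq (c d e) f h := by
  obtain ⟨c, hc, hspec⟩ := exists_index (H := fun a σ n =>
    phiStr a.unpair.2 (outStr a.unpair.1 σ) n (outStr a.unpair.1 σ).length) (by
      have h1 : Primrec fun p : ℕ × List ℕ × ℕ => p.1.unpair.1 :=
        (Primrec.fst.comp Primrec.unpair).comp Primrec.fst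
      have h2 : Primrec fun p : ℕ × List ℕ × ℕ => p.1.unpair.2 :=
        (Primrec.snd.comp Primrec.unpair).comp Primrec.fst
      have h3 : Primrec fun p : ℕ × List ℕ × ℕ => outStr p.1.unpair.1 p.2.1 :=
        outStr_primrec.comp (h1.pair (Primrec.fst.comp Primrec.snd))
      exact (phiStr_primrec.comp
        ((h2.pair h3).pair (Primrec.snd.comp Primrec.snd))).to_comp)
  refine ⟨fun d e => c (Nat.pair d e), hc.comp Primrec₂.natPair.to_comp, ?_⟩
  intro d e f g h hd he
  obtain ⟨t, ht, hout⟩ := outStr_spec hd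
  refine hspec _ _ _ (fun n => ?_) (fun n l v hv => ?_)
  · obtain ⟨N, hN⟩ := phiStr_complete (he n)
    obtain ⟨l, hl⟩ := (ht.eventually_ge_atTop N).exists
    exact ⟨l, by simpa [hout, initSeg_length] using hN _ hl⟩
  · simp only [Nat.unpair_pair, hout, initSeg_length] at hv
    exact Part.mem_unique (phiStr_sound hv) (he n)

theorem exists_index_query {q : ℕ → ℕ} (hq : Primrec q) :
    ∃ e, ∀ f, PhiEq e f fun n => f (q n) := by
  obtain ⟨c, -, hspec⟩ := exists_index (H := fun _ σ n => σ[q n]?)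
    ((Primrec.list_getElem?.comp (Primrec.fst.comp Primrec.snd)
      (hq.comp (Primrec.snd.comp Primrec.snd))).to_comp)
  refine ⟨c 0, fun f => hspec 0 f _
    (fun n => ⟨q n + 1, initSeg_getElem? f (Nat.lt_succ_self _)⟩) (fun n l v hv => ?_)⟩
  have hl : q n < l := by
    by_contra hl
    rw [List.getElem?_eq_none (by rw [initSeg_length]; omega)] at hv
    cases hv
  rw [initSeg_getElem? f hl] at hv
  exact (Option.some.inj hv).symm

theorem exists_index_id : ∃ e, ∀ f, PhiEq e f f :=
  exists_index_query Primrec.id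

theorem exists_index_left : ∃ e, ∀ f g, PhiEq e (join f g) f := by
  obtain ⟨e, he⟩ := exists_index_query (q := fun n => 2 * n) Primrec.nat_double
  refine ⟨e, fun f g => ?_⟩
  have : (fun n => join f g (2 * n)) = f := by funext n; simp [join]
  simpa only [this] using he (join f g)

theorem exists_index_right : ∃ e, ∀ f g, PhiEq e (join f g) g := by
  obtain ⟨e, he⟩ := exists_index_query (q := fun n => 2 * n + 1) Primrec.nat_double_succ
  refine ⟨e, fun f g => ?_⟩
  have : (fun n => join f g (2 * n + 1)) = g := by
    funext n
    have : (2 * n + 1) / 2 = n := by omega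
    simp [join, this]
  simpa only [this] using he (join f g)

theorem exists_index_pair (d e : ℕ) : ∃ c, ∀ f g h,
    PhiEq d f g → PhiEq e f h → PhiEq c f (join g h) := by
  obtain ⟨c, -, hspec⟩ := exists_index (H := fun _ σ n =>
    if n % 2 = 0 then phiStr d σ (n / 2) σ.length else phiStr e σ (n / 2) σ.length) (by
      have hn : Primrec fun p : ℕ × List ℕ × ℕ => p.2.2 := Primrec.snd.comp Primrec.snd
      have hσ : Primrec fun p : ℕ × List ℕ × ℕ => p.2.1 := Primrec.fst.comp Primrec.snd
      have hh : Primrec fun p : ℕ × List ℕ × ℕ => p.2.2 / 2 :=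
        Primrec.nat_div.comp hn (Primrec.const 2)
      exact (Primrec.ite (Primrec.eq.comp (Primrec.nat_mod.comp hn (Primrec.const 2))
        (Primrec.const 0))
        (phiStr_primrec.comp (((Primrec.const d).pair hσ).pair hh))
        (phiStr_primrec.comp (((Primrec.const e).pair hσ).pair hh))).to_comp)
  refine ⟨c 0, fun f g h hd he => hspec 0 f _ (fun n => ?_) (fun n l v hv => ?_)⟩
  · by_cases hn : n % 2 = 0
    · obtain ⟨N, hN⟩ := phiStr_complete (hd (n / 2))
      exact ⟨N, by simpa [hn, join, initSeg_length] using hN N le_rfl⟩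
    · obtain ⟨N, hN⟩ := phiStr_complete (he (n / 2))
      exact ⟨N, by simpa [hn, join, initSeg_length] using hN N le_rfl⟩
  · by_cases hn : n % 2 = 0
    · simp only [hn, if_true, initSeg_length] at hv
      simpa [join, hn] using Part.mem_unique (phiStr_sound hv) (hd (n / 2))
    · simp only [hn, if_false, initSeg_length] at hv
      simpa [join, hn] using Part.mem_unique (phiStr_sound hv) (he (n / 2))

theorem exists_index_trans (d e : ℕ) : ∃ c, ∀ f g h,
    PhiEq d f g → PhiEq e g h → PhiEq c f h := by
  obtain ⟨c, -, hc⟩ := exists_index_comp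
  exact ⟨c d e, hc d e⟩

theorem join_inj {f g f' g' : ℕ → ℕ} (h : join f g = join f' g') : f = f' ∧ g = g' := by
  constructor <;> funext n
  · simpa [join] using congrFun h (2 * n)
  · have h2 : (2 * n + 1) / 2 = n := by omega
    simpa [join, h2] using congrFun h (2 * n + 1)

theorem TeamLE.refl (P : Set (ℕ → ℕ)) : TeamLE P P := by
  obtain ⟨e, he⟩ := exists_index_id
  exact ⟨fun f => Part.some f, ⟨1, fun _ _ => e, fun _ => Computable.const e,
    fun g h hh => ⟨0, e, by simp, (Part.mem_some_iff.1 hh) ▸ he g⟩⟩,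
    fun g hg => ⟨g, Part.mem_some g, hg⟩⟩

theorem TeamLE.trans {P Q R : Set (ℕ → ℕ)} (h1 : TeamLE P Q) (h2 : TeamLE Q R) : TeamLE P R := by
  obtain ⟨Γ, ⟨b, Ψ, hΨ, hΓ⟩, hPQ⟩ := h1
  obtain ⟨Δ, ⟨b', Θ, hΘ, hΔ⟩, hQR⟩ := h2
  obtain ⟨c, hc, hcomp⟩ := exists_index_comp
  refine ⟨fun f => (Δ f).bind Γ, ⟨b * b', fun p σ =>
    c (Θ (finProdFinEquiv.symm p).2 σ)
      (Ψ (finProdFinEquiv.symm p).1 (outStr (Θ (finProdFinEquiv.symm p).2 σ) σ)),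
    fun p => ?_, ?_⟩, ?_⟩
  · exact hc.comp (hΘ _) ((hΨ _).comp (outStr_primrec.to_comp.comp ((hΘ _).pair Computable.id)))
  · intro g h hh
    obtain ⟨k, hk, hh⟩ := Part.mem_bind_iff.1 hh
    obtain ⟨j, d, hd, hdk⟩ := hΔ g k hk
    obtain ⟨i, e, he, heh⟩ := hΓ k h hh
    refine ⟨finProdFinEquiv (i, j), c d e, ?_, hcomp d e g k h hdk heh⟩
    obtain ⟨t, ht, hout⟩ := outStr_spec hdk
    filter_upwards [hd, ht.eventually he] with l hl hl'
    simp [hl, hout, hl']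
  · intro f hf
    obtain ⟨g, hg, hgQ⟩ := hQR f hf
    obtain ⟨h, hh, hhP⟩ := hPQ g hgQ
    exact ⟨h, Part.mem_bind_iff.2 ⟨g, hg, hh⟩, hhP⟩

theorem WeihrauchLE.refl (F : Multi) : WeihrauchLE F F := by
  obtain ⟨e, he⟩ := exists_index_id
  obtain ⟨r, hr⟩ := exists_index_right
  exact ⟨e, r, fun x hx => ⟨x, he x, hx, fun z hz => ⟨z, hz, hr x z⟩⟩⟩

theorem WeihrauchLE.trans {F G H : Multi} (h1 : WeihrauchLE F G) (h2 : WeihrauchLE G H) :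
    WeihrauchLE F H := by
  obtain ⟨h, k, hk⟩ := h1
  obtain ⟨h', k', hk'⟩ := h2
  obtain ⟨l, hl⟩ := exists_index_left
  obtain ⟨c, hc⟩ := exists_index_trans h h'
  -- from `x ⊕ z` compute `h(x) ⊕ z`, then `k'` of it, then `k` of `x ⊕ k'(h(x) ⊕ z)`
  obtain ⟨r, hr⟩ := exists_index_right
  obtain ⟨c1, hc1⟩ := exists_index_trans l h
  obtain ⟨c2, hc2⟩ := exists_index_pair c1 r
  obtain ⟨c3, hc3⟩ := exists_index_trans c2 k'
  obtain ⟨c4, hc4⟩ := exists_index_pair l c3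
  obtain ⟨c5, hc5⟩ := exists_index_trans c4 k
  refine ⟨c, c5, fun x hx => ?_⟩
  obtain ⟨y, hxy, hy, hback⟩ := hk x hx
  obtain ⟨y', hyy', hy', hback'⟩ := hk' y hy
  refine ⟨y', hc x y y' hxy hyy', hy', fun z hz => ?_⟩
  obtain ⟨w, hw, hzw⟩ := hback' z hz
  obtain ⟨w', hw', hww'⟩ := hback w hw
  exact ⟨w', hw', hc5 _ _ _ (hc4 _ _ _ (hl x z) (hc3 _ _ _ (hc2 _ _ _
    (hc1 _ _ _ (hl x z) hxy) (hr x z)) hzw)) hww'⟩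

theorem IterLE.mono {F G H : Multi} {k : ℕ} (h1 : WeihrauchLE G H) (h2 : IterLE F k H) :
    IterLE F k G := by
  cases k with
  | zero => exact h1.trans h2
  | succ k =>
    obtain ⟨A, B, hA, hB, h⟩ := h2
    exact ⟨A, B, hA, hB, h1.trans h⟩

/-- `F` applied to the second component of a pair, the first component being kept. -/
def Multi.keep (F : Multi) : Multi :=
  fun p => {q | ∃ z u v, p = join z u ∧ v ∈ F u ∧ q = join z v}

theorem WeihrauchLE.keep {F G : Multi} (h : WeihrauchLE F G) : WeihrauchLE F.keep G := by
  obtain ⟨h, k, hk⟩ := h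
  obtain ⟨l, hl⟩ := exists_index_left
  obtain ⟨r, hr⟩ := exists_index_right
  obtain ⟨a, ha⟩ := exists_index_trans r h
  -- from `(z ⊕ u) ⊕ y` compute `z ⊕ k(u ⊕ y)`
  obtain ⟨c1, hc1⟩ := exists_index_trans l l
  obtain ⟨c2, hc2⟩ := exists_index_trans l r
  obtain ⟨c3, hc3⟩ := exists_index_pair c2 r
  obtain ⟨c4, hc4⟩ := exists_index_trans c3 k
  obtain ⟨c5, hc5⟩ := exists_index_pair c1 c4
  refine ⟨a, c5, ?_⟩
  rintro p ⟨q, z, u, v, rfl, hv, rfl⟩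
  obtain ⟨y, huy, hy, hback⟩ := hk u ⟨v, hv⟩
  refine ⟨y, ha _ _ _ (hr z u) huy, hy, fun s hs => ?_⟩
  obtain ⟨w, hw, hsw⟩ := hback s hs
  exact ⟨join z w, ⟨z, u, w, rfl, hw, rfl⟩, hc5 _ _ _ (hc1 _ _ _ (hl _ s) (hl z u))
    (hc4 _ _ _ (hc3 _ _ _ (hc2 _ _ _ (hl _ s) (hr z u)) (hr _ s)) hsw)⟩

theorem Multi.mem_keep {F : Multi} {z u q : ℕ → ℕ} :
    q ∈ F.keep (join z u) ↔ ∃ v ∈ F u, q = join z v := by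
  constructor
  · rintro ⟨z', u', v, h, hv, rfl⟩
    obtain ⟨rfl, rfl⟩ := join_inj h
    exact ⟨v, hv, rfl⟩
  · rintro ⟨v, hv, rfl⟩
    exact ⟨z, u, v, rfl, hv, rfl⟩

theorem Multi.keep_nonempty {F : Multi} {z u : ℕ → ℕ} :
    (F.keep (join z u)).Nonempty ↔ (F u).Nonempty := by
  constructor
  · rintro ⟨q, hq⟩
    obtain ⟨v, hv, -⟩ := Multi.mem_keep.1 hq
    exact ⟨v, hv⟩
  · rintro ⟨v, hv⟩
    exact ⟨_, Multi.mem_keep.2 ⟨v, hv, rfl⟩⟩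

theorem IterLE.comp {F G H : Multi} {k l : ℕ} (hG : IterLE F k G) (hH : IterLE F l H) :
    IterLE F (k + l) (G.comp H) := by
  obtain ⟨i, hi⟩ := exists_index_id
  obtain ⟨r, hr⟩ := exists_index_right
  induction k generalizing G H l with
  | zero =>
    rw [Nat.zero_add]
    refine IterLE.mono ?_ hH
    obtain ⟨h, k, hk⟩ := hG
    obtain ⟨c1, hc1⟩ := exists_index_trans r h
    obtain ⟨c2, hc2⟩ := exists_index_pair r c1
    obtain ⟨c3, hc3⟩ := exists_index_trans c2 k
    refine ⟨i, c3, ?_⟩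
    rintro x ⟨w, hdom, z, hz, -⟩
    refine ⟨x, hi x, ⟨z, hz⟩, fun z' hz' => ?_⟩
    obtain ⟨y, hy, -, hback⟩ := hk z' (hdom z' hz')
    obtain ⟨w', hw', hyw⟩ := hback y rfl
    exact ⟨w', ⟨hdom, z', hz', hw'⟩, hc3 _ _ _ (hc2 _ _ _ (hr x z')
      (hc1 _ _ _ (hr x z') hy)) hyw⟩
  | succ k ih =>
    obtain ⟨A, B, hA, hB, h, c, hc⟩ := hG
    -- after `H`, keep its output `z` and prepare the input `h(z)` of `B`
    let K : Multi := fun x => {q | (∀ z ∈ H x, (G z).Nonempty) ∧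
      ∃ z y, z ∈ H x ∧ (G z).Nonempty ∧ PhiEq h z y ∧ q = join z y}
    have hK : WeihrauchLE K H := by
      obtain ⟨c1, hc1⟩ := exists_index_trans r h
      obtain ⟨c2, hc2⟩ := exists_index_pair r c1
      refine ⟨i, c2, ?_⟩
      rintro x ⟨q, hdom, z, y, hz, -, -, -⟩
      refine ⟨x, hi x, ⟨z, hz⟩, fun z' hz' => ?_⟩
      obtain ⟨y', hy', -⟩ := hc z' (hdom z' hz')
      exact ⟨join z' y', ⟨hdom, z', y', hz', hdom z' hz', hy', rfl⟩,
        hc2 _ _ _ (hr x z') (hc1 _ _ _ (hr x z') hy')⟩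
    have hBK := ih (IterLE.mono ((WeihrauchLE.refl B).keep) hB) (IterLE.mono hK hH)
    rw [show k + 1 + l = k + l + 1 by omega]
    refine ⟨A.keep, B.keep.comp K, hA.keep, hBK, ?_⟩
    obtain ⟨c1, hc1⟩ := exists_index_trans r c
    refine ⟨i, c1, ?_⟩
    rintro x ⟨w, hdom, z, hz, -⟩
    have hBdom : ∀ q ∈ K x, (B.keep q).Nonempty := by
      rintro q ⟨-, z, y, hz, hGz, hzy, rfl⟩
      obtain ⟨y', hzy', ⟨v, -, u, hu, -⟩, -⟩ := hc z hGz
      obtain rfl := hzy.unique hzy'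
      exact Multi.keep_nonempty.2 ⟨u, hu⟩
    have hAdom : ∀ p ∈ (B.keep.comp K) x, (A.keep p).Nonempty := by
      rintro p ⟨-, q, ⟨-, z, y, hz, hGz, hzy, rfl⟩, hp⟩
      obtain ⟨u, hu, rfl⟩ := Multi.mem_keep.1 hp
      obtain ⟨y', hzy', ⟨v, hv, -⟩, -⟩ := hc z hGz
      obtain rfl := hzy.unique hzy'
      exact Multi.keep_nonempty.2 (hv u hu)
    refine ⟨x, hi x, ?_, ?_⟩
    · obtain ⟨y, hzy, ⟨v, hv, u, hu, hvu⟩, -⟩ := hc z (hdom z hz)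
      exact ⟨join z v, hAdom, join z u, ⟨hBdom, join z y,
        ⟨hdom, z, y, hz, hdom z hz, hzy, rfl⟩, Multi.mem_keep.2 ⟨u, hu, rfl⟩⟩,
        Multi.mem_keep.2 ⟨v, hvu, rfl⟩⟩
    · rintro s ⟨-, p, ⟨-, q, ⟨-, z, y, hz, hGz, hzy, rfl⟩, hp⟩, hs⟩
      obtain ⟨u, hu, rfl⟩ := Multi.mem_keep.1 hp
      obtain ⟨v, hv, rfl⟩ := Multi.mem_keep.1 hs
      obtain ⟨y', hzy', ⟨v', hv', -⟩, hback⟩ := hc z hGz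
      obtain rfl := hzy.unique hzy'
      obtain ⟨w', hw', hcw⟩ := hback v ⟨hv', u, hu, hv⟩
      exact ⟨w', ⟨hdom, z, hz, hw'⟩, hc1 _ _ _ (hr _ _) hcw⟩

theorem LemLE.refl (P : Set (ℕ → ℕ)) : LemLE P P :=
  ⟨0, fun x => {x}, WeihrauchLE.refl _, fun x hx => by simpa using hx⟩

theorem LemLE.trans {P Q R : Set (ℕ → ℕ)} (h1 : LemLE P Q) (h2 : LemLE Q R) : LemLE P R := by
  obtain ⟨k, G, hG, hPQ⟩ := h1
  obtain ⟨l, H, hH, hQR⟩ := h2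
  refine ⟨k + l, G.comp H, hG.comp hH, fun x hx => ⟨?_, ?_⟩⟩
  · obtain ⟨y, hy⟩ := (hQR x hx).1
    obtain ⟨z, hz⟩ := (hPQ y ((hQR x hx).2 hy)).1
    exact ⟨z, fun y' hy' => (hPQ y' ((hQR x hx).2 hy')).1, y, hy, hz⟩
  · rintro z ⟨-, y, hy, hz⟩
    exact (hPQ y ((hQR x hx).2 hy)).2 hz

instance : IsPreorder (Set (ℕ → ℕ)) TeamLE where
  refl := TeamLE.refl
  trans _ _ _ := TeamLE.trans

instance : IsPreorder (Set (ℕ → ℕ)) LemLE where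
  refl := LemLE.refl
  trans _ _ _ := LemLE.trans

/-! ## Degree structures -/

/-- Subsets of Baire space, preordered by the reducibility `r`. -/
def MassProblem (_r : Set (ℕ → ℕ) → Set (ℕ → ℕ) → Prop) : Type := Set (ℕ → ℕ)

instance (r : Set (ℕ → ℕ) → Set (ℕ → ℕ) → Prop) [IsPreorder (Set (ℕ → ℕ)) r] :
    Preorder (MassProblem r) where
  le := r
  le_refl := refl_of r
  le_trans _ _ _ := trans_of r

/-- `P` is a `Π⁰₁` subset of Cantor space `2^ℕ`: the set of all infinite binary paths through a
computable tree. -/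
def IsPi01Cantor (P : Set (ℕ → ℕ)) : Prop :=
  ∃ T : Set (List ℕ), ComputablePred (fun σ => σ ∈ T) ∧ (∀ σ τ, σ <+: τ → τ ∈ T → σ ∈ T) ∧
    P = {f | (∀ n, f n < 2) ∧ ∀ n, initSeg f n ∈ T}

/-- Nonempty `Π⁰₁` subsets of Cantor space, preordered by the reducibility `r`. -/
abbrev LocalMassProblem (r : Set (ℕ → ℕ) → Set (ℕ → ℕ) → Prop) : Type :=
  {P : MassProblem r // IsPi01Cantor P ∧ Set.Nonempty (α := ℕ → ℕ) P}

/-- The partial order of `r`-degrees of all subsets of Baire space. -/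
abbrev Degree (r : Set (ℕ → ℕ) → Set (ℕ → ℕ) → Prop) [IsPreorder (Set (ℕ → ℕ)) r] : Type :=
  Antisymmetrization (MassProblem r) (· ≤ ·)

/-- The partial order of `r`-degrees of nonempty `Π⁰₁` subsets of Cantor space. -/
abbrev LocalDegree (r : Set (ℕ → ℕ) → Set (ℕ → ℕ) → Prop) [IsPreorder (Set (ℕ → ℕ)) r] : Type :=
  Antisymmetrization (LocalMassProblem r) (· ≤ ·)

/-- A partial order is Brouwerian if for all `p`, `q` there is a least `r` with `p ≤ q ∨ r`. The
supremum is written out in the language of partial orders: `p ≤ q ∨ s` means that `p` lies below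
every common upper bound of `q` and `s`. -/
def IsBrouwerian (α : Type) [PartialOrder α] : Prop :=
  ∀ p q : α, ∃ r, IsLeast {s | ∀ u, q ≤ u → s ≤ u → p ≤ u} r

theorem isBrouwerian_iff (α : Type) [SemilatticeSup α] :
    IsBrouwerian α ↔ ∀ p q : α, ∃ r, IsLeast {s | p ≤ q ⊔ s} r := by
  have : ∀ p q s : α, (∀ u, q ≤ u → s ≤ u → p ≤ u) ↔ p ≤ q ⊔ s := fun p q s =>
    ⟨fun h => h _ le_sup_left le_sup_right, fun h u hq hs => h.trans (sup_le hq hs)⟩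
  simp only [IsBrouwerian, this]

end MassProblems

namespace MassProblems

/-! ## Two recursively inseparable sequences of c.e. sets, independently of each other -/

/-! One use of `sigma2LEM` is solved by two learners, and composition multiplies the sizes of teams,
so `LemLE` implies `TeamLE` (`LemLE.teamLE`). Hence one family of examples serves both
reducibilities: the positive facts are proved for `LemLE` and the negative one for `TeamLE`.

The examples are `teamSource`, `teamTarget` and the problems `helper t`. For every `t`, `t` uses of
`sigma2LEM` solve `teamTarget` from `teamSource` and `helper t` (`lemLE_teamTarget`), while fewer
than `t` learners cannot do so, even at one fixed point of `helper t` (`exists_unidentified`). A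
least `R` with `teamTarget` below the join of `teamSource` and `R` would lie below every `helper t`.
The reduction to this join uses some number `b` of learners. At the fixed point of `helper (b + 1)`,
one index computes a point of `R`, so the same `b` learners would succeed with `helper (b + 1)`, a
contradiction (`not_teamLE_of_forall_helper`).

All classes are built from disjoint c.e. sets `setA` and `setB`, obtained by finite injury, such
that no functional separates their `i`-th columns even when given all other columns of `setA`
(`exists_wrong`). A point of the source or of the target names a limit `t`, the first one of its
section 0, and certifies it by separating column `2t + 1`; naming no limit at all costs a separation
of column 0. Moreover it selects numbers `j < t`, and selecting `j` obliges it to separate column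
`2j + 2`. In the source every row selects anew, and row `r` has only `r` bits to fill; in the target
the single row `t` counts and is infinite.

Upper bound: once it is known which `j < t` are selected in infinitely many rows of the source,
whole columns can be pieced together from longer and longer rows. If the limit exceeds the `t` of
the helper, select `t` and copy the helper.

Lower bound: feed in source points with limit `t` and one selection per row. A functional that
succeeds has to name a limit, has to name the true one, and then commits itself to some `j < t`. If
`j` is never selected again, only finitely many bits of column `2j + 2` have been given away, and
the functional can be made to err. Thus a functional is defeated at the price of one selection
(`exists_noSolution`). A learner can either be made to change its guess forever, or is locked on one
guess and defeated at that price; so `t` selections outlast fewer than `t` learners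
(`exists_fails`). -/

/-- The column of a number. -/
def col (m : ℕ) : ℕ := m.unpair.1.unpair.1

/-- The action history of the construction is a list of triples `(m, v, s)`: at stage `s`, the
number `m` was put into the first set if `v = 0` and into the second one if `v ≠ 0`. -/
abbrev History : Type := List (ℕ × ℕ × ℕ)

/-- A strict upper bound of the stages at which a requirement of priority above `k` has acted. -/
def injuryBound (k : ℕ) (H : History) : ℕ :=
  H.foldr (fun ev b => if ev.1.unpair.1 < k then max (ev.2.2 + 1) b else b) 0

/-- The current witness of the `k`-th requirement. -/
def witness (k : ℕ) (H : History) : ℕ := Nat.pair k (injuryBound k H)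

/-- The numbers put into the first set. -/
def InFst (H : History) (m : ℕ) : Prop := ∃ ev ∈ H, ev.1 = m ∧ ev.2.1 = 0

/-- The numbers put into the second set. -/
def InSnd (H : History) (m : ℕ) : Prop := ∃ ev ∈ H, ev.1 = m ∧ ev.2.1 ≠ 0

instance (H : History) (m : ℕ) : Decidable (InFst H m) := by unfold InFst; infer_instance

/-- The first set without its `i`-th column. -/
def omitCol (H : History) (i m : ℕ) : ℕ := if col m ≠ i ∧ InFst H m then 1 else 0

/-- The computation that the requirement `k` looks at, where `c` codes the length of the oracle,
a parameter and a number of steps. -/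
def attempt (k c : ℕ) (H : History) : Option ℕ :=
  Nat.Partrec.Code.evaln c.unpair.2.unpair.2 (Denumerable.ofNat Nat.Partrec.Code k.unpair.2)
    (Nat.pair (Nat.pair (Encodable.encode (initSeg (omitCol H k.unpair.1) c.unpair.1))
      c.unpair.2.unpair.1) (witness k H))

/-- One stage of the construction: the requirement `s.unpair.1.unpair.1` acts if its witness is
unused and its computation converges. -/
def stage (s : ℕ) (H : History) : History :=
  if witness s.unpair.1.unpair.1 H ∈ H.map Prod.fst then H else
    match attempt s.unpair.1.unpair.1 s.unpair.1.unpair.2 H with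
    | none => H
    | some v => (witness s.unpair.1.unpair.1 H, v, s) :: H

/-- The history at stage `s`. -/
def hist (s : ℕ) : History := Nat.rec [] stage s

theorem hist_succ (s : ℕ) : hist (s + 1) = stage s (hist s) := rfl

/-! ### Primitive recursiveness of the construction -/

theorem primrecPred_inFst : PrimrecPred fun p : History × ℕ => InFst p.1 p.2 := by
  have h : PrimrecRel fun (ev : ℕ × ℕ × ℕ) (m : ℕ) => ev.1 = m ∧ ev.2.1 = 0 :=
    PrimrecPred.and (Primrec.eq.comp (Primrec.fst.comp Primrec.fst) Primrec.snd)
      (Primrec.eq.comp (Primrec.fst.comp (Primrec.snd.comp Primrec.fst)) (Primrec.const 0))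
  exact h.exists_mem_list

theorem primrecPred_inSnd : PrimrecPred fun p : History × ℕ => InSnd p.1 p.2 := by
  have h : PrimrecRel fun (ev : ℕ × ℕ × ℕ) (m : ℕ) => ev.1 = m ∧ ev.2.1 ≠ 0 :=
    PrimrecPred.and (Primrec.eq.comp (Primrec.fst.comp Primrec.fst) Primrec.snd)
      (PrimrecPred.not
        (Primrec.eq.comp (Primrec.fst.comp (Primrec.snd.comp Primrec.fst)) (Primrec.const 0)))
  exact h.exists_mem_list

theorem primrec_unpair_fst : Primrec fun n : ℕ => n.unpair.1 := Primrec.fst.comp Primrec.unpair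
theorem primrec_unpair_snd : Primrec fun n : ℕ => n.unpair.2 := Primrec.snd.comp Primrec.unpair

theorem primrec_col : Primrec col := primrec_unpair_fst.comp primrec_unpair_fst

theorem primrec_injuryBound : Primrec fun p : ℕ × History => injuryBound p.1 p.2 := by
  have hev : Primrec fun x : (ℕ × History) × ((ℕ × ℕ × ℕ) × ℕ) => x.2.1 :=
    Primrec.fst.comp Primrec.snd
  have hb : Primrec fun x : (ℕ × History) × ((ℕ × ℕ × ℕ) × ℕ) => x.2.2 :=
    Primrec.snd.comp Primrec.snd
  have h := Primrec.ite (Primrec.nat_lt.comp (primrec_unpair_fst.comp (Primrec.fst.comp hev))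
    (Primrec.fst.comp Primrec.fst))
    (Primrec.nat_max.comp (Primrec.succ.comp (Primrec.snd.comp (Primrec.snd.comp hev))) hb) hb
  exact Primrec.list_foldr Primrec.snd (Primrec.const 0) h.to₂

theorem primrec_witness : Primrec fun p : ℕ × History => witness p.1 p.2 :=
  Primrec₂.natPair.comp Primrec.fst primrec_injuryBound

theorem primrec_omitCol : Primrec fun p : (History × ℕ) × ℕ => omitCol p.1.1 p.1.2 p.2 :=
  Primrec.ite (PrimrecPred.and
    (PrimrecPred.not (Primrec.eq.comp (primrec_col.comp Primrec.snd)
      (Primrec.snd.comp Primrec.fst)))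
    (primrecPred_inFst.comp ((Primrec.fst.comp Primrec.fst).pair Primrec.snd)))
    (Primrec.const 1) (Primrec.const 0)

theorem primrec_initSeg {α : Type} [Primcodable α] {F : α → ℕ → ℕ} {l : α → ℕ}
    (hF : Primrec fun p : α × ℕ => F p.1 p.2) (hl : Primrec l) :
    Primrec fun a => initSeg (F a) (l a) :=
  Primrec.list_map (Primrec.list_range.comp hl) hF.to₂

theorem primrec_attempt : Primrec fun p : (ℕ × ℕ) × History => attempt p.1.1 p.1.2 p.2 := by
  have hk : Primrec fun p : (ℕ × ℕ) × History => p.1.1 := Primrec.fst.comp Primrec.fst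
  have hc : Primrec fun p : (ℕ × ℕ) × History => p.1.2 := Primrec.snd.comp Primrec.fst
  have hc2 := primrec_unpair_snd.comp hc
  have homit : Primrec fun q : ((ℕ × ℕ) × History) × ℕ => omitCol q.1.2 q.1.1.1.unpair.1 q.2 := by
    have h1 : Primrec fun q : ((ℕ × ℕ) × History) × ℕ => q.1.2 := Primrec.snd.comp Primrec.fst
    have h2 : Primrec fun q : ((ℕ × ℕ) × History) × ℕ => q.1.1.1 := hk.comp Primrec.fst
    have h3 : Primrec fun q : ((ℕ × ℕ) × History) × ℕ => q.1.1.1.unpair.1 :=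
      primrec_unpair_fst.comp h2
    have h4 : Primrec fun q : ((ℕ × ℕ) × History) × ℕ => ((q.1.2, q.1.1.1.unpair.1), q.2) :=
      (h1.pair h3).pair Primrec.snd
    have h5 := primrec_omitCol.comp h4
    exact h5
  have hseg : Primrec fun p : (ℕ × ℕ) × History =>
      initSeg (omitCol p.2 p.1.1.unpair.1) p.1.2.unpair.1 :=
    primrec_initSeg homit (primrec_unpair_fst.comp hc)
  have hw : Primrec fun p : (ℕ × ℕ) × History => witness p.1.1 p.2 :=
    primrec_witness.comp (hk.pair Primrec.snd)
  have hin := Primrec₂.natPair.comp (Primrec₂.natPair.comp (Primrec.encode.comp hseg)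
    (primrec_unpair_fst.comp hc2)) hw
  have hcode := (Primrec.ofNat Nat.Partrec.Code).comp (primrec_unpair_snd.comp hk)
  have hev := Nat.Partrec.Code.primrec_evaln.comp
    (((primrec_unpair_snd.comp hc2).pair hcode).pair hin)
  exact hev.of_eq fun p => by rw [attempt]

theorem primrec_stage : Primrec₂ stage := by
  have hk : Primrec fun p : ℕ × History => p.1.unpair.1.unpair.1 :=
    primrec_unpair_fst.comp (primrec_unpair_fst.comp Primrec.fst)
  have hc : Primrec fun p : ℕ × History => p.1.unpair.1.unpair.2 :=
    primrec_unpair_snd.comp (primrec_unpair_fst.comp Primrec.fst)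
  have hw : Primrec fun p : ℕ × History => witness p.1.unpair.1.unpair.1 p.2 :=
    primrec_witness.comp (hk.pair Primrec.snd)
  have hmem : PrimrecPred fun p : ℕ × History =>
      ∃ ev ∈ p.2, ev.1 = witness p.1.unpair.1.unpair.1 p.2 := by
    have h : PrimrecRel fun (ev : ℕ × ℕ × ℕ) (m : ℕ) => ev.1 = m :=
      Primrec.eq.comp (Primrec.fst.comp Primrec.fst) Primrec.snd
    exact h.exists_mem_list.comp Primrec.snd hw
  have hmatch := Primrec.option_casesOn
    (primrec_attempt.comp ((hk.pair hc).pair Primrec.snd)) Primrec.snd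
    (Primrec.list_cons.comp ((hw.comp Primrec.fst).pair (Primrec.snd.pair
      (Primrec.fst.comp Primrec.fst))) (Primrec.snd.comp Primrec.fst)).to₂
  classical
  refine (Primrec.ite hmem Primrec.snd hmatch).of_eq ?_
  rintro ⟨s, H⟩
  simp only [stage, List.mem_map]
  congr 1
  cases attempt s.unpair.1.unpair.1 s.unpair.1.unpair.2 H <;> rfl

theorem primrec_hist : Primrec hist := Primrec.nat_rec₁ [] primrec_stage

/-! ### Finite injury -/

theorem stage_cases (s : ℕ) (H : History) :
    stage s H = H ∨ ∃ v, witness s.unpair.1.unpair.1 H ∉ H.map Prod.fst ∧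
      attempt s.unpair.1.unpair.1 s.unpair.1.unpair.2 H = some v ∧
      stage s H = (witness s.unpair.1.unpair.1 H, v, s) :: H := by
  unfold stage
  split_ifs with h
  · exact Or.inl rfl
  · cases ha : attempt s.unpair.1.unpair.1 s.unpair.1.unpair.2 H with
    | none => exact Or.inl rfl
    | some v => exact Or.inr ⟨v, h, rfl, rfl⟩

theorem hist_subset_succ (s : ℕ) : hist s ⊆ hist (s + 1) := by
  rw [hist_succ]
  rcases stage_cases s (hist s) with h | ⟨v, -, -, h⟩ <;> rw [h]
  · exact List.Subset.refl _
  · exact List.subset_cons_self _ _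

theorem hist_mono {s s' : ℕ} (h : s ≤ s') : hist s ⊆ hist s' := by
  induction h with
  | refl => exact List.Subset.refl _
  | step _ ih => exact List.Subset.trans ih (hist_subset_succ _)

/-- An event happens at its stage, by the requirement and with the witness it belongs to. -/
theorem mem_hist {s : ℕ} {ev : ℕ × ℕ × ℕ} (h : ev ∈ hist s) :
    ev.2.2 < s ∧ ev ∈ hist (ev.2.2 + 1) ∧ ev.1 ∉ (hist ev.2.2).map Prod.fst ∧
      ev.2.2.unpair.1.unpair.1 = ev.1.unpair.1 ∧ ev.1 = witness ev.1.unpair.1 (hist ev.2.2) ∧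
      attempt ev.1.unpair.1 ev.2.2.unpair.1.unpair.2 (hist ev.2.2) = some ev.2.1 := by
  induction s with
  | zero => simp [hist] at h
  | succ s ih =>
    have h0 := h
    rw [hist_succ] at h
    rcases stage_cases s (hist s) with h' | ⟨v, hn, ha, h'⟩
    · rw [h'] at h
      obtain ⟨h1, h2⟩ := ih h
      exact ⟨h1.trans (Nat.lt_succ_self s), h2⟩
    · rw [h', List.mem_cons] at h
      rcases h with rfl | h
      · refine ⟨Nat.lt_succ_self s, h0, hn, ?_, ?_, ?_⟩ <;> simp [witness, ha]
      · obtain ⟨h1, h2⟩ := ih h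
        exact ⟨h1.trans (Nat.lt_succ_self s), h2⟩

/-- A requirement acts only with an unused witness, so a number cannot enter at two different
stages, and the stage determines the value. This is what makes the two sets disjoint. -/
theorem hist_unique {s s' : ℕ} {ev ev' : ℕ × ℕ × ℕ} (h : ev ∈ hist s) (h' : ev' ∈ hist s')
    (he : ev.1 = ev'.1) : ev = ev' := by
  have key : ∀ {s s' : ℕ} {ev ev' : ℕ × ℕ × ℕ}, ev ∈ hist s → ev' ∈ hist s' → ev.1 = ev'.1 →
      ev'.2.2 ≤ ev.2.2 := by
    intro s s' ev ev' h h' he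
    by_contra hlt
    refine (mem_hist h').2.2.1 ?_
    rw [← he]
    exact List.mem_map_of_mem (hist_mono (by omega) (mem_hist h).2.1)
  have hs : ev.2.2 = ev'.2.2 := le_antisymm (key h' h he.symm) (key h h' he)
  have h1 := (mem_hist h).2.2.2.2.2
  have h2 := (mem_hist h').2.2.2.2.2
  rw [← he, ← hs, h1] at h2
  exact Prod.ext he (Prod.ext (Option.some.inj h2) hs)

theorem injuryBound_le {k b : ℕ} {H : History} :
    injuryBound k H ≤ b ↔ ∀ ev ∈ H, ev.1.unpair.1 < k → ev.2.2 < b := by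
  induction H with
  | nil => simp [injuryBound]
  | cons ev H ih =>
    have : injuryBound k (ev :: H) =
        if ev.1.unpair.1 < k then max (ev.2.2 + 1) (injuryBound k H) else injuryBound k H := rfl
    rw [this]
    split_ifs with h <;> simp [h, ih]

/-- The requirements of priority above `k` act finitely often. -/
theorem exists_stable (k : ℕ) : ∃ s0, ∀ s, ∀ ev ∈ hist s, ev.1.unpair.1 < k → ev.2.2 < s0 := by
  induction k with
  | zero => exact ⟨0, by simp⟩
  | succ k ih =>
    obtain ⟨s0, h0⟩ := ih
    by_cases hex : ∃ s, ∃ ev ∈ hist s, ev.1.unpair.1 = k ∧ s0 ≤ ev.2.2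
    · obtain ⟨s, ev, hev, hk, hs⟩ := hex
      refine ⟨ev.2.2 + 1, fun s' ev' hev' hk' => ?_⟩
      rcases Nat.lt_succ_iff_lt_or_eq.1 hk' with hlt | heq
      · have := h0 s' ev' hev' hlt
        omega
      · by_contra hcon
        -- After `s0` no higher priority acts, so the witness of `k` no longer moves. Two actions of
        -- `k` from then on would enumerate the same number, which happens only once.
        have hb : ∀ t, s0 ≤ t → injuryBound k (hist t) = injuryBound k (hist s0) := by
          intro t ht
          apply le_antisymm
          · refine injuryBound_le.2 fun e he hek => ?_
            have he' := hist_mono (h0 t e he hek) (mem_hist he).2.1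
            exact injuryBound_le.1 le_rfl e he' hek
          · refine injuryBound_le.2 fun e he hek => ?_
            exact injuryBound_le.1 le_rfl e (hist_mono ht he) hek
        have h1 := (mem_hist hev).2.2.2.2.1
        have h2 := (mem_hist hev').2.2.2.2.1
        rw [hk, witness, hb _ hs] at h1
        rw [heq, witness, hb _ (by omega)] at h2
        have := hist_unique hev hev' (h1.trans h2.symm)
        rw [this] at hcon
        omega
    · refine ⟨s0, fun s ev hev hk => ?_⟩
      rcases Nat.lt_succ_iff_lt_or_eq.1 hk with hlt | heq
      · exact h0 s ev hev hlt
      · by_contra hcon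
        exact hex ⟨s, ev, hev, heq, by omega⟩

/-- The first set. -/
def setA : Set ℕ := {m | ∃ s, InFst (hist s) m}

/-- The second set. -/
def setB : Set ℕ := {m | ∃ s, InSnd (hist s) m}

theorem disjoint_AB {m : ℕ} (hA : m ∈ setA) (hB : m ∈ setB) : False := by
  obtain ⟨s, ev, h, rfl, h0⟩ := hA
  obtain ⟨s', ev', h', he, h0'⟩ := hB
  rw [hist_unique h h' he.symm] at h0
  exact h0' h0

open Classical in
/-- The characteristic function of the first set. -/
noncomputable def charA (m : ℕ) : ℕ := if m ∈ setA then 1 else 0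

/-- The characteristic function of the first set without its `i`-th column. -/
noncomputable def charAOmit (i m : ℕ) : ℕ := if col m = i then 0 else charA m

/-- A value `v` at `m` which is wrong for a separating function of the first and the second set. -/
def Wrong (s m v : ℕ) : Prop := (v = 0 ∧ InFst (hist s) m) ∨ (v = 1 ∧ InSnd (hist s) m)

/-- Each entry of the approximation changes at most once, from `0` to `1`, so a finite segment
settles. -/
theorem exists_agree (i l : ℕ) :
    ∃ s0, ∀ s ≥ s0, initSeg (omitCol (hist s) i) l = initSeg (charAOmit i) l := by
  have h : ∀ m, ∃ s0, ∀ s ≥ s0, omitCol (hist s) i m = charAOmit i m := by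
    intro m
    by_cases hm : m ∈ setA
    · obtain ⟨s0, h0⟩ := hm
      refine ⟨s0, fun s hs => ?_⟩
      have h1 : InFst (hist s) m := by
        obtain ⟨ev, hev, h⟩ := h0
        exact ⟨ev, hist_mono hs hev, h⟩
      have hm : m ∈ setA := ⟨s0, h0⟩
      by_cases hc : col m = i <;> simp [omitCol, charAOmit, charA, hc, h1, hm]
    · refine ⟨0, fun s _ => ?_⟩
      have h1 : ¬ InFst (hist s) m := fun h => hm ⟨s, h⟩
      simp [omitCol, charAOmit, charA, h1, hm]
  choose s0 hs0 using h
  refine ⟨(Finset.range l).sup s0, fun s hs => ?_⟩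
  refine List.map_congr_left fun m hm => hs0 m s (le_trans ?_ hs)
  exact Finset.le_sup (f := s0) (Finset.mem_range.2 (List.mem_range.1 hm))

/-- No functional separates the `i`-th columns of the two sets relative to the other columns of
the first one. Here a functional is given by possibly inconsistent axioms. -/
theorem exists_wrong (i : ℕ) {G : ℕ → List ℕ → ℕ → Option ℕ}
    (hG : Computable fun p : ℕ × List ℕ × ℕ => G p.1 p.2.1 p.2.2) :
    ∃ m, col m = i ∧ ((∀ w l, G w (initSeg (charAOmit i) l) m = none) ∨
      ∃ w l v, G w (initSeg (charAOmit i) l) m = some v ∧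
        ((v = 0 ∧ m ∈ setA) ∨ (v ≠ 0 ∧ m ∈ setB))) := by
  obtain ⟨U, hU⟩ : ∃ U : Nat.Partrec.Code, ∀ w τ m,
      U.eval (Nat.pair (Nat.pair (Encodable.encode τ) w) m) = (G w τ m : Part ℕ) := by
    have hp : Partrec fun p : ℕ × List ℕ × ℕ => (G p.1 p.2.1 p.2.2 : Part ℕ) := hG.ofOption
    have hdec : Computable fun n : ℕ =>
        ((n.unpair.1.unpair.2, (Encodable.decode (α := List ℕ) n.unpair.1.unpair.1).getD [],
          n.unpair.2) : ℕ × List ℕ × ℕ) := by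
      have h1 := primrec_unpair_fst.to_comp
      have h2 := primrec_unpair_snd.to_comp
      exact (h2.comp h1).pair (((Computable.option_getD Computable.decode
        (Computable.const [])).comp (h1.comp h1)).pair h2)
    obtain ⟨U, hU⟩ := Nat.Partrec.Code.exists_code.1 (Partrec.nat_iff.1 (hp.comp hdec))
    exact ⟨U, fun w τ m => by rw [hU]; simp⟩
  -- The requirement against `G` on column `i`; its witnesses lie in column `i` because `k` has
  -- first component `i`.
  set k := Nat.pair i (Encodable.encode U) with hk
  obtain ⟨s0, h0⟩ := exists_stable k
  set m := witness k (hist s0) with hm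
  have hmk : m.unpair.1 = k := by simp [hm, witness]
  have hb : ∀ t, s0 ≤ t → witness k (hist t) = m := by
    intro t ht
    rw [hm, witness, witness]
    congr 1
    apply le_antisymm
    · refine injuryBound_le.2 fun e he hek => ?_
      exact injuryBound_le.1 le_rfl e (hist_mono (h0 t e he hek) (mem_hist he).2.1) hek
    · refine injuryBound_le.2 fun e he hek => ?_
      exact injuryBound_le.1 le_rfl e (hist_mono ht he) hek
  have hcol : col m = i := by simp [col, hmk, hk]
  refine ⟨m, hcol, ?_⟩
  by_cases hex : ∃ s, ∃ ev ∈ hist s, ev.1 = m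
  · right
    obtain ⟨s, ⟨m', v, t⟩, hev, hm'⟩ := hex
    obtain rfl : m' = m := hm'
    obtain ⟨-, ht, -, htk, hw, hatt⟩ := mem_hist hev
    simp only [hmk] at ht htk hw hatt
    set l := t.unpair.1.unpair.2.unpair.1 with hl
    have hlt : l ≤ t := (Nat.unpair_left_le _).trans
      ((Nat.unpair_right_le _).trans (Nat.unpair_left_le _))
    -- The oracle segment read at stage `t` is never spoiled later. Higher priorities have stopped
    -- acting, because the witness at stage `t` is already the final one. Priority `k` itself
    -- enumerates only into the omitted column. Lower priorities acting later use witnesses above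
    -- `t`, and `l ≤ t` because the stage number codes `l`.
    have hseg : initSeg (omitCol (hist t) i) l = initSeg (charAOmit i) l := by
      refine List.map_congr_left fun n hn => ?_
      have hn := List.mem_range.1 hn
      by_cases hc : col n = i
      · simp [omitCol, charAOmit, hc]
      by_cases hin : InFst (hist t) n
      · have : n ∈ setA := ⟨t, hin⟩
        simp [omitCol, charAOmit, charA, hc, hin, this]
      suffices n ∉ setA by simp [omitCol, charAOmit, charA, hin, this]
      rintro ⟨s', ⟨n', v', t'⟩, hev', hn', hv'⟩
      obtain rfl : n' = n := hn'
      obtain ⟨-, ht', -, -, hw', -⟩ := mem_hist hev'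
      simp only at ht' hw' hv'
      have htt : t ≤ t' := by
        by_contra hcon
        exact hin ⟨_, hist_mono (by omega) ht', rfl, hv'⟩
      rcases lt_trichotomy n'.unpair.1 k with hlt' | heq | hgt
      · have h1 := h0 _ _ ht' hlt'
        have h2 : injuryBound k (hist s0) ≤ t := by
          have : injuryBound k (hist s0) = injuryBound k (hist t) := by
            have := hm.symm.trans hw
            simpa [witness] using this
          rw [this]
          exact injuryBound_le.2 fun e he _ => (mem_hist he).1
        have h3 := injuryBound_le.1 h2 _ (hist_mono h1 ht') hlt'
        simp only at h3
        omega
      · exact hc (by rw [col, heq, hk]; simp)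
      · have hne : t ≠ t' := by
          rintro rfl
          have h1 : t.unpair.1.unpair.1 = n'.unpair.1 := (mem_hist hev').2.2.2.1
          omega
        have h1 := injuryBound_le.1 (le_refl (injuryBound n'.unpair.1 (hist t'))) _
          (hist_mono (show t + 1 ≤ t' by omega) ht) (by simpa only [hmk] using hgt)
        have h2 : injuryBound n'.unpair.1 (hist t') ≤ n' := by
          conv_rhs => rw [hw']
          exact Nat.right_le_pair _ _
        simp only at h1
        omega
    refine ⟨t.unpair.1.unpair.2.unpair.2.unpair.1, l, v, ?_, ?_⟩
    · rw [attempt, ← hw] at hatt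
      have := Nat.Partrec.Code.evaln_sound hatt
      simp only [hk, Nat.unpair_pair, Denumerable.ofNat_encode] at this
      rw [← hl, hseg, hU, Part.mem_ofOption] at this
      exact this
    · by_cases hv : v = 0
      · exact Or.inl ⟨hv, s, _, hev, rfl, hv⟩
      · exact Or.inr ⟨hv, s, _, hev, rfl, hv⟩
  · left
    intro w l
    by_contra hne
    obtain ⟨v, hv⟩ := Option.ne_none_iff_exists'.1 hne
    have hmem : v ∈ U.eval
        (Nat.pair (Nat.pair (Encodable.encode (initSeg (charAOmit i) l)) w) m) := by
      rw [hU, hv]; exact Part.mem_some v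
    obtain ⟨n, hn⟩ := Nat.Partrec.Code.evaln_complete.1 hmem
    obtain ⟨s1, h1⟩ := exists_agree i l
    -- A stage that examines exactly this computation. The second component is padding: it makes the
    -- stage late enough for the witness and the oracle segment to be final.
    set s := Nat.pair (Nat.pair k (Nat.pair l (Nat.pair w n))) (max s0 s1) with hs
    have hsle : max s0 s1 ≤ s := Nat.right_le_pair _ _
    have hw := hb s ((le_max_left _ _).trans hsle)
    have hatt : attempt k (Nat.pair l (Nat.pair w n)) (hist s) = some v := by
      rw [attempt, hw]
      simp only [hk, Nat.unpair_pair, Denumerable.ofNat_encode]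
      rw [h1 s ((le_max_right _ _).trans hsle)]
      exact hn
    have hstage : hist (s + 1) = (m, v, s) :: hist s := by
      have hnot : m ∉ (hist s).map Prod.fst := by
        intro h
        obtain ⟨ev, hev, he⟩ := List.mem_map.1 h
        exact hex ⟨s, ev, hev, he⟩
      rw [hist_succ, stage]
      have e1 : s.unpair.1.unpair.1 = k := by simp [hs]
      have e2 : s.unpair.1.unpair.2 = Nat.pair l (Nat.pair w n) := by simp [hs]
      rw [e1, e2, hw, if_neg hnot, hatt]
    exact hex ⟨s + 1, (m, v, s), by simp [hstage], rfl⟩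


/-! ## `Π⁰₁` classes -/

/-- A finite string as a partial binary sequence, the value `2` meaning undefined. -/
def bits (σ : List ℕ) (n : ℕ) : ℕ := σ.getD n 2

theorem primrec_bits {α : Type} [Primcodable α] {g : α → List ℕ} {i : α → ℕ} (hg : Primrec g)
    (hi : Primrec i) : Primrec fun a => bits (g a) (i a) :=
  (Primrec.list_getD 2).comp hg hi

theorem bits_initSeg {f : ℕ → ℕ} {n l : ℕ} (h : n < l) : bits (initSeg f l) n = f n := by
  simp [bits, List.getD_eq_getElem?_getD, initSeg_getElem? f h]

theorem eventually_bits (f : ℕ → ℕ) (n : ℕ) : ∀ᶠ l in atTop, bits (initSeg f l) n = f n := by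
  filter_upwards [eventually_gt_atTop n] with l hl using bits_initSeg hl

theorem bits_of_prefix {σ τ : List ℕ} (h : σ <+: τ) {n : ℕ} (hn : bits σ n < 2) :
    bits τ n = bits σ n := by
  have hlt : n < σ.length := by
    by_contra hcon
    rw [bits, List.getD_eq_default _ _ (by omega)] at hn
    omega
  obtain ⟨ρ, rfl⟩ := h
  simp [bits, List.getD_eq_getElem?_getD, List.getElem?_append_left hlt]

/-- `V` is a computable open condition on binary sequences; `V x` means that the `x`-th
constraint is seen to be violated. -/
structure IsViolation {κ : Type} [Primcodable κ] (V : κ → (ℕ → ℕ) → Prop) : Prop where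
  primrec : PrimrecRel fun x (σ : List ℕ) => V x (bits σ)
  mono : ∀ x f g, (∀ n, f n < 2 → g n = f n) → V x f → V x g
  cont : ∀ x f, V x f → ∀ᶠ l in atTop, V x (bits (initSeg f l))

/-- The tree consists of the strings that violate no constraint with code below their length.
Decidability comes from `primrec`, closure under prefixes from `mono`, and `cont` ensures that every
violation along a path is eventually noticed. -/
theorem IsViolation.isPi01Cantor {κ : Type} [Primcodable κ] {V : κ → (ℕ → ℕ) → Prop}
    (hV : IsViolation V) : IsPi01Cantor {f | (∀ n, f n < 2) ∧ ∀ x, ¬ V x f} := by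
  refine ⟨{σ | ∀ x ∈ (List.range σ.length).filterMap (Encodable.decode (α := κ)),
    ¬ V x (bits σ)}, ?_, ?_, ?_⟩
  · have hlist : Primrec fun σ : List ℕ =>
        (List.range σ.length).filterMap (Encodable.decode (α := κ)) :=
      Primrec.listFilterMap (Primrec.list_range.comp Primrec.list_length)
        (Primrec.decode.comp Primrec.snd).to₂
    have hnot : PrimrecRel fun x (σ : List ℕ) => ¬ V x (bits σ) := PrimrecPred.not hV.primrec
    exact (hnot.forall_mem_list.comp hlist Primrec.id).computablePred
  · intro σ τ h hτ x hx hσ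
    refine hτ x ?_ (hV.mono x _ _ (fun n hn => bits_of_prefix h hn) hσ)
    obtain ⟨k, hk, hd⟩ := List.mem_filterMap.1 hx
    exact List.mem_filterMap.2 ⟨k, List.mem_range.2
      ((List.mem_range.1 hk).trans_le h.length_le), hd⟩
  · ext f
    refine and_congr_right fun hf => ⟨fun h n x _ hx => h x (hV.mono x _ _ ?_ hx), fun h x hx => ?_⟩
    · intro k hk
      by_cases hkn : k < n
      · exact (bits_initSeg hkn).symm
      · rw [bits, List.getD_eq_default _ _ (by rw [initSeg_length]; omega)] at hk
        omega
    · obtain ⟨l, hl, hlx⟩ :=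
        ((hV.cont x f hx).and (eventually_gt_atTop (Encodable.encode x))).exists
      refine h l x (List.mem_filterMap.2 ⟨Encodable.encode x, ?_, by simp⟩) hl
      rw [initSeg_length]
      exact List.mem_range.2 hlx

theorem _root_.ComputablePred.and' {α : Type} [Primcodable α] {p q : α → Prop}
    (hp : ComputablePred p) (hq : ComputablePred q) : ComputablePred fun a => p a ∧ q a := by
  obtain ⟨f, hf, rfl⟩ := ComputablePred.computable_iff.1 hp
  obtain ⟨g, hg, rfl⟩ := ComputablePred.computable_iff.1 hq
  refine ComputablePred.computable_iff.2 ⟨fun a => f a && g a, ?_, ?_⟩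
  · exact (Primrec.and.to_comp).comp hf hg
  · funext a; simp

theorem IsPi01Cantor.inter {P Q : Set (ℕ → ℕ)} (hP : IsPi01Cantor P) (hQ : IsPi01Cantor Q) :
    IsPi01Cantor (P ∩ Q) := by
  obtain ⟨T, hT, hT', rfl⟩ := hP
  obtain ⟨U, hU, hU', rfl⟩ := hQ
  refine ⟨T ∩ U, hT.and' hU, fun σ τ h hτ => ⟨hT' σ τ h hτ.1, hU' σ τ h hτ.2⟩, ?_⟩
  ext f
  constructor
  · rintro ⟨⟨h1, h2⟩, -, h3⟩
    exact ⟨h1, fun n => ⟨h2 n, h3 n⟩⟩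
  · rintro ⟨h1, h2⟩
    exact ⟨⟨h1, fun n => (h2 n).1⟩, h1, fun n => (h2 n).2⟩

/-- The join of two mass problems. -/
def joinSet (P Q : Set (ℕ → ℕ)) : Set (ℕ → ℕ) := {y | ∃ f ∈ P, ∃ g ∈ Q, y = join f g}

theorem join_even (f g : ℕ → ℕ) (n : ℕ) : join f g (2 * n) = f n := by simp [join]

theorem join_odd (f g : ℕ → ℕ) (n : ℕ) : join f g (2 * n + 1) = g n := by
  have : (2 * n + 1) / 2 = n := by omega
  simp [join, this]

/-- The entries of a string `σ` at the places `2n + d`. -/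
def every2 (d : ℕ) (σ : List ℕ) : List ℕ :=
  (List.range ((σ.length + 1 - d) / 2)).map fun n => σ.getD (2 * n + d) 0

theorem primrec_every2 (d : ℕ) : Primrec (every2 d) := by
  have h1 : Primrec fun σ : List ℕ => List.range ((σ.length + 1 - d) / 2) :=
    Primrec.list_range.comp (Primrec.nat_div.comp
      (Primrec.nat_sub.comp (Primrec.succ.comp Primrec.list_length) (Primrec.const d))
      (Primrec.const 2))
  have h2 : Primrec₂ fun (σ : List ℕ) (n : ℕ) => σ.getD (2 * n + d) 0 :=
    (Primrec.list_getD 0).comp Primrec.fst (Primrec.nat_add.comp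
      (Primrec.nat_double.comp Primrec.snd) (Primrec.const d))
  exact Primrec.list_map h1 h2

theorem every2_initSeg (d : ℕ) (f : ℕ → ℕ) (l : ℕ) :
    every2 d (initSeg f l) = initSeg (fun n => f (2 * n + d)) ((l + 1 - d) / 2) := by
  simp only [every2, initSeg_length]
  refine List.map_congr_left fun n hn => ?_
  have hn := List.mem_range.1 hn
  rw [List.getD_eq_getElem?_getD, initSeg_getElem? f (by omega)]
  rfl

theorem every2_prefix {d : ℕ} {σ τ : List ℕ} (h : σ <+: τ) :
    every2 d σ <+: every2 d τ := by
  have hl := h.length_le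
  obtain ⟨ρ, rfl⟩ := h
  have h1 : every2 d σ = (every2 d (σ ++ ρ)).take ((σ.length + 1 - d) / 2) := by
    rw [every2, every2, ← List.map_take, List.take_range, min_eq_left (by
      rw [List.length_append]; omega)]
    refine List.map_congr_left fun n hn => ?_
    have hn := List.mem_range.1 hn
    rw [List.getD_append _ _ _ _ (by omega)]
  rw [h1]
  exact List.take_prefix _ _

theorem IsPi01Cantor.join {P Q : Set (ℕ → ℕ)} (hP : IsPi01Cantor P) (hQ : IsPi01Cantor Q) :
    IsPi01Cantor (joinSet P Q) := by
  obtain ⟨T, hT, hT', rfl⟩ := hP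
  obtain ⟨U, hU, hU', rfl⟩ := hQ
  refine ⟨{σ | every2 0 σ ∈ T ∧ every2 1 σ ∈ U}, ?_, ?_, ?_⟩
  · refine ComputablePred.and' ?_ ?_
    · obtain ⟨f, hf, h⟩ := ComputablePred.computable_iff.1 hT
      refine ComputablePred.computable_iff.2 ⟨fun σ => f (every2 0 σ),
        hf.comp (primrec_every2 0).to_comp, ?_⟩
      funext σ
      exact congrFun h (every2 0 σ)
    · obtain ⟨f, hf, h⟩ := ComputablePred.computable_iff.1 hU
      refine ComputablePred.computable_iff.2 ⟨fun σ => f (every2 1 σ),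
        hf.comp (primrec_every2 1).to_comp, ?_⟩
      funext σ
      exact congrFun h (every2 1 σ)
  · exact fun σ τ h hτ => ⟨hT' _ _ (every2_prefix h) hτ.1,
      hU' _ _ (every2_prefix h) hτ.2⟩
  · ext y
    constructor
    · rintro ⟨f, ⟨hf, hf'⟩, g, ⟨hg, hg'⟩, rfl⟩
      refine ⟨fun n => ?_, fun n => ⟨?_, ?_⟩⟩
      · unfold MassProblems.join
        split_ifs
        exacts [hf _, hg _]
      · rw [every2_initSeg]
        simpa only [add_zero, join_even] using hf' _
      · rw [every2_initSeg]
        simpa only [join_odd] using hg' _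
    · rintro ⟨hy, hy'⟩
      refine ⟨fun n => y (2 * n), ⟨fun n => hy _, fun n => ?_⟩, fun n => y (2 * n + 1),
        ⟨fun n => hy _, fun n => ?_⟩, ?_⟩
      -- A segment of length `2n` contains exactly `n` entries of either parity.
      · have := (hy' (2 * n)).1
        rw [every2_initSeg] at this
        simpa [show (2 * n + 1) / 2 = n by omega] using this
      · have := (hy' (2 * n)).2
        rw [every2_initSeg] at this
        simpa [show (2 * n + 1 - 1) / 2 = n by omega] using this
      · funext n
        unfold MassProblems.join
        split_ifs with h
        · congr 1; omega
        · congr 1; omega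

/-! ## The mass problems -/

/-- `t` is the first place at which the first section of `f` has a `1`. -/
def IsFirst (f : ℕ → ℕ) (t : ℕ) : Prop :=
  f (Nat.pair 0 t) = 1 ∧ ∀ t' < t, f (Nat.pair 0 t') = 0

/-- As long as the first section of `f` is zero, its second one separates column `0`. -/
def LimitViolation (x : ℕ × ℕ) (f : ℕ → ℕ) : Prop :=
  col x.2 = 0 ∧ (∀ t < x.1 + 1, f (Nat.pair 0 t) = 0) ∧ Wrong x.1 x.2 (f (Nat.pair 1 x.2))

/-- If `t` is the first one of `f`, then the third section of `f` separates column `2t + 1`. -/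
def NameViolation (x : ℕ × ℕ × ℕ) (f : ℕ → ℕ) : Prop :=
  IsFirst f x.1 ∧ col x.2.2 = 2 * x.1 + 1 ∧ Wrong x.2.1 x.2.2 (f (Nat.pair 2 x.2.2))

/-- If `t` is the first one of `f`, then some `j < t` is selected in each relevant row `r` of the
fourth section of `f`. -/
def SelectViolation (row : ℕ → ℕ → Prop) (x : ℕ × ℕ) (f : ℕ → ℕ) : Prop :=
  (IsFirst f x.1 ∧ row x.1 x.2) ∧ ∀ j < x.1, f (Nat.pair 3 (Nat.pair x.2 j)) = 0

/-- If `t` is the first one of `f`, and `j < t` is selected in the row `r`, then the relevant part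
of the row `r` of the fifth section of `f` separates column `2j + 2`. -/
def ValueViolation (row cell : ℕ → ℕ → Prop) (x : ((ℕ × ℕ) × ℕ) × ℕ × ℕ) (f : ℕ → ℕ) : Prop :=
  ((IsFirst f x.1.1.1 ∧ row x.1.1.1 x.1.1.2) ∧ (x.1.2 < x.1.1.1 ∧ cell x.1.1.2 x.2.2)) ∧
    (col x.2.2 = 2 * x.1.2 + 2 ∧ f (Nat.pair 3 (Nat.pair x.1.1.2 x.1.2)) = 1) ∧
      Wrong x.2.1 x.2.2 (f (Nat.pair 4 (Nat.pair x.1.1.2 x.2.2)))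

/-- Binary sequences satisfying the above constraints. -/
def tableClass (row cell : ℕ → ℕ → Prop) : Set (ℕ → ℕ) :=
  ({f | (∀ n, f n < 2) ∧ ∀ x, ¬ LimitViolation x f} ∩
    {f | (∀ n, f n < 2) ∧ ∀ x, ¬ NameViolation x f}) ∩
  ({f | (∀ n, f n < 2) ∧ ∀ x, ¬ SelectViolation row x f} ∩
    {f | (∀ n, f n < 2) ∧ ∀ x, ¬ ValueViolation row cell x f})

/-- All rows count, and the row `r` consists of `r` bits. -/
def teamSource : Set (ℕ → ℕ) := tableClass (fun _ _ => True) fun r m => m < r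

/-- Only the row `t` counts, and it is infinite. -/
def teamTarget : Set (ℕ → ℕ) := tableClass (fun t r => r = t) fun _ _ => True

/-- Separating functions of column `2t + 2`. -/
def helper (t : ℕ) : Set (ℕ → ℕ) :=
  {h | (∀ n, h n < 2) ∧ ∀ x : ℕ × ℕ, ¬ (col x.2 = 2 * t + 2 ∧ Wrong x.1 x.2 (h x.2))}

/-! ### The constraints are effectively open -/

theorem primrecPred_wrong {α : Type} [Primcodable α] {s m v : α → ℕ} (hs : Primrec s)
    (hm : Primrec m) (hv : Primrec v) : PrimrecPred fun a => Wrong (s a) (m a) (v a) := by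
  have h1 := primrecPred_inFst.comp ((primrec_hist.comp hs).pair hm)
  have h2 := primrecPred_inSnd.comp ((primrec_hist.comp hs).pair hm)
  exact ((Primrec.eq.comp hv (Primrec.const 0)).and h1).or
    ((Primrec.eq.comp hv (Primrec.const 1)).and h2)

theorem Wrong.congr {s m v w : ℕ} (h : v < 2 → w = v) (hv : Wrong s m v) : Wrong s m w := by
  rcases hv with ⟨rfl, h1⟩ | ⟨rfl, h1⟩
  · exact Or.inl ⟨h (by omega), h1⟩
  · exact Or.inr ⟨h (by omega), h1⟩

theorem primrecRel_forall_lt {α : Type} [Primcodable α] {R : ℕ → α → Prop} (hR : PrimrecRel R) :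
    PrimrecRel fun n a => ∀ k < n, R k a :=
  (hR.forall_mem_list.comp (Primrec.list_range.comp Primrec.fst) Primrec.snd).of_eq fun _ => by
    simp

theorem primrecRel_isFirst : PrimrecRel fun (t : ℕ) (σ : List ℕ) => IsFirst (bits σ) t := by
  have h1 : PrimrecRel fun (t : ℕ) (σ : List ℕ) => bits σ (Nat.pair 0 t) = 0 :=
    Primrec.eq.comp (primrec_bits Primrec.snd
      (Primrec₂.natPair.comp (Primrec.const 0) Primrec.fst)) (Primrec.const 0)
  exact (Primrec.eq.comp (primrec_bits Primrec.snd
      (Primrec₂.natPair.comp (Primrec.const 0) Primrec.fst)) (Primrec.const 1)).and (primrecRel_forall_lt h1)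

theorem IsFirst.mono {f g : ℕ → ℕ} (h : ∀ n, f n < 2 → g n = f n) {t : ℕ} (hf : IsFirst f t) :
    IsFirst g t :=
  ⟨by rw [h _ (by rw [hf.1]; omega), hf.1],
    fun t' ht' => by rw [h _ (by rw [hf.2 t' ht']; omega), hf.2 t' ht']⟩

theorem eventually_forall_bits {f q : ℕ → ℕ} (b : ℕ) :
    ∀ᶠ l in atTop, ∀ j < b, bits (initSeg f l) (q j) = f (q j) :=
  (Set.finite_lt_nat b).eventually_all.2 fun j _ => eventually_bits f (q j)

theorem IsFirst.eventually {f : ℕ → ℕ} {t : ℕ} (h : IsFirst f t) :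
    ∀ᶠ l in atTop, IsFirst (bits (initSeg f l)) t := by
  filter_upwards [eventually_bits f (Nat.pair 0 t), eventually_forall_bits (f := f)
    (q := Nat.pair 0) t] with l h1 h2
  exact ⟨h1.trans h.1, fun t' ht' => (h2 t' ht').trans (h.2 t' ht')⟩

theorem limitViolation : IsViolation LimitViolation where
  primrec := by
    have h1 : PrimrecRel fun (t : ℕ) (σ : List ℕ) => bits σ (Nat.pair 0 t) = 0 :=
      Primrec.eq.comp (primrec_bits Primrec.snd
        (Primrec₂.natPair.comp (Primrec.const 0) Primrec.fst)) (Primrec.const 0)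
    have hs : Primrec fun p : (ℕ × ℕ) × List ℕ => p.1.1 := Primrec.fst.comp Primrec.fst
    have hm : Primrec fun p : (ℕ × ℕ) × List ℕ => p.1.2 := Primrec.snd.comp Primrec.fst
    have h2 := (primrecRel_forall_lt h1).comp (Primrec.succ.comp hs) Primrec.snd
    exact (Primrec.eq.comp (primrec_col.comp hm) (Primrec.const 0)).and (h2.and
      (primrecPred_wrong hs hm (primrec_bits Primrec.snd
        (Primrec₂.natPair.comp (Primrec.const 1) hm))))
  mono := fun x f g h ⟨h1, h2, h3⟩ =>
    ⟨h1, fun t ht => by rw [h _ (by rw [h2 t ht]; omega), h2 t ht], h3.congr (h _)⟩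
  cont := fun x f ⟨h1, h2, h3⟩ => by
    filter_upwards [eventually_forall_bits (f := f) (q := Nat.pair 0) (x.1 + 1),
      eventually_bits f (Nat.pair 1 x.2)] with l h4 h5
    exact ⟨h1, fun t ht => (h4 t ht).trans (h2 t ht), h3.congr fun _ => h5⟩

theorem nameViolation : IsViolation NameViolation where
  primrec := by
    have ht : Primrec fun p : (ℕ × ℕ × ℕ) × List ℕ => p.1.1 := Primrec.fst.comp Primrec.fst
    have hs : Primrec fun p : (ℕ × ℕ × ℕ) × List ℕ => p.1.2.1 :=
      Primrec.fst.comp (Primrec.snd.comp Primrec.fst)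
    have hm : Primrec fun p : (ℕ × ℕ × ℕ) × List ℕ => p.1.2.2 :=
      Primrec.snd.comp (Primrec.snd.comp Primrec.fst)
    have h1 := primrecRel_isFirst.comp ht Primrec.snd
    exact h1.and ((Primrec.eq.comp (primrec_col.comp hm)
      (Primrec.nat_double_succ.comp ht)).and
      (primrecPred_wrong hs hm (primrec_bits Primrec.snd
        (Primrec₂.natPair.comp (Primrec.const 2) hm))))
  mono := fun x f g h ⟨h1, h2, h3⟩ => ⟨h1.mono h, h2, h3.congr (h _)⟩
  cont := fun x f ⟨h1, h2, h3⟩ => by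
    filter_upwards [h1.eventually, eventually_bits f (Nat.pair 2 x.2.2)] with l h4 h5
    exact ⟨h4, h2, h3.congr fun _ => h5⟩

theorem selectViolation {row : ℕ → ℕ → Prop} (hrow : PrimrecRel row) :
    IsViolation (SelectViolation row) where
  primrec := by
    have ht : Primrec fun p : (ℕ × ℕ) × List ℕ => p.1.1 := Primrec.fst.comp Primrec.fst
    have hr : Primrec fun p : (ℕ × ℕ) × List ℕ => p.1.2 := Primrec.snd.comp Primrec.fst
    have h1 : PrimrecRel fun (j : ℕ) (p : ℕ × List ℕ) =>
        bits p.2 (Nat.pair 3 (Nat.pair p.1 j)) = 0 :=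
      Primrec.eq.comp (primrec_bits (Primrec.snd.comp Primrec.snd)
        (Primrec₂.natPair.comp (Primrec.const 3)
          (Primrec₂.natPair.comp (Primrec.fst.comp Primrec.snd) Primrec.fst))) (Primrec.const 0)
    have h2 := (primrecRel_forall_lt h1).comp ht (hr.pair Primrec.snd)
    exact ((primrecRel_isFirst.comp ht Primrec.snd).and (hrow.comp ht hr)).and h2
  mono := fun x f g h ⟨⟨h1, h2⟩, h3⟩ =>
    ⟨⟨h1.mono h, h2⟩, fun j hj => by rw [h _ (by rw [h3 j hj]; omega), h3 j hj]⟩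
  cont := fun x f ⟨⟨h1, h2⟩, h3⟩ => by
    filter_upwards [h1.eventually, eventually_forall_bits (f := f)
      (q := fun j => Nat.pair 3 (Nat.pair x.2 j)) x.1] with l h4 h5
    exact ⟨⟨h4, h2⟩, fun j hj => (h5 j hj).trans (h3 j hj)⟩

theorem valueViolation {row cell : ℕ → ℕ → Prop} (hrow : PrimrecRel row)
    (hcell : PrimrecRel cell) : IsViolation (ValueViolation row cell) where
  primrec := by
    have hx : Primrec fun p : (((ℕ × ℕ) × ℕ) × ℕ × ℕ) × List ℕ => p.1 := Primrec.fst
    have ht : Primrec fun p : (((ℕ × ℕ) × ℕ) × ℕ × ℕ) × List ℕ => p.1.1.1.1 :=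
      Primrec.fst.comp (Primrec.fst.comp (Primrec.fst.comp hx))
    have hr : Primrec fun p : (((ℕ × ℕ) × ℕ) × ℕ × ℕ) × List ℕ => p.1.1.1.2 :=
      Primrec.snd.comp (Primrec.fst.comp (Primrec.fst.comp hx))
    have hj : Primrec fun p : (((ℕ × ℕ) × ℕ) × ℕ × ℕ) × List ℕ => p.1.1.2 :=
      Primrec.snd.comp (Primrec.fst.comp hx)
    have hs : Primrec fun p : (((ℕ × ℕ) × ℕ) × ℕ × ℕ) × List ℕ => p.1.2.1 :=
      Primrec.fst.comp (Primrec.snd.comp hx)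
    have hm : Primrec fun p : (((ℕ × ℕ) × ℕ) × ℕ × ℕ) × List ℕ => p.1.2.2 :=
      Primrec.snd.comp (Primrec.snd.comp hx)
    have h1 := (primrecRel_isFirst.comp ht Primrec.snd).and (hrow.comp ht hr)
    have h2 := (Primrec.nat_lt.comp hj ht).and (hcell.comp hr hm)
    have h3 := (Primrec.eq.comp (primrec_col.comp hm)
      (Primrec.succ.comp (Primrec.nat_double_succ.comp hj))).and
      (Primrec.eq.comp (primrec_bits Primrec.snd (Primrec₂.natPair.comp (Primrec.const 3)
        (Primrec₂.natPair.comp hr hj))) (Primrec.const 1))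
    have h4 := primrecPred_wrong hs hm (primrec_bits Primrec.snd
      (Primrec₂.natPair.comp (Primrec.const 4) (Primrec₂.natPair.comp hr hm)))
    have h5 := (h1.and h2).and (h3.and h4)
    exact h5
  mono := fun x f g h ⟨⟨⟨h1, h2⟩, h3⟩, ⟨h4, h5⟩, h6⟩ =>
    ⟨⟨⟨h1.mono h, h2⟩, h3⟩, ⟨h4, by rw [h _ (by rw [h5]; omega), h5]⟩, h6.congr (h _)⟩
  cont := fun x f ⟨⟨⟨h1, h2⟩, h3⟩, ⟨h4, h5⟩, h6⟩ => by
    filter_upwards [h1.eventually, eventually_bits f (Nat.pair 3 (Nat.pair x.1.1.2 x.1.2)),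
      eventually_bits f (Nat.pair 4 (Nat.pair x.1.1.2 x.2.2))] with l h7 h8 h9
    exact ⟨⟨⟨h7, h2⟩, h3⟩, ⟨h4, h8.trans h5⟩, h6.congr fun _ => h9⟩

theorem isPi01Cantor_tableClass {row cell : ℕ → ℕ → Prop} (hrow : PrimrecRel row)
    (hcell : PrimrecRel cell) : IsPi01Cantor (tableClass row cell) :=
  (limitViolation.isPi01Cantor.inter nameViolation.isPi01Cantor).inter
    ((selectViolation hrow).isPi01Cantor.inter (valueViolation hrow hcell).isPi01Cantor)

theorem primrecRel_true : PrimrecRel fun _ _ : ℕ => True :=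
  (Primrec.eq.comp Primrec.id Primrec.id : PrimrecPred fun p : ℕ × ℕ => p = p).of_eq
    fun _ => by simp

theorem isPi01Cantor_teamSource : IsPi01Cantor teamSource :=
  isPi01Cantor_tableClass primrecRel_true (Primrec.nat_lt.comp Primrec.snd Primrec.fst)

theorem isPi01Cantor_teamTarget : IsPi01Cantor teamTarget :=
  isPi01Cantor_tableClass (Primrec.eq.comp Primrec.snd Primrec.fst) primrecRel_true

theorem isPi01Cantor_helper (t : ℕ) : IsPi01Cantor (helper t) := by
  refine IsViolation.isPi01Cantor (V := fun (x : ℕ × ℕ) h =>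
    col x.2 = 2 * t + 2 ∧ Wrong x.1 x.2 (h x.2)) ⟨?_, ?_, ?_⟩
  · have hm : Primrec fun p : (ℕ × ℕ) × List ℕ => p.1.2 := Primrec.snd.comp Primrec.fst
    have h1 := Primrec.eq.comp (primrec_col.comp hm) (Primrec.const (2 * t + 2))
    have h2 := primrecPred_wrong (Primrec.fst.comp Primrec.fst) hm (primrec_bits Primrec.snd hm)
    have h3 := h1.and h2
    exact h3
  · exact fun x f g h ⟨h1, h2⟩ => ⟨h1, h2.congr (h _)⟩
  · rintro x f ⟨h1, h2⟩
    filter_upwards [eventually_bits f x.2] with l h3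
    exact ⟨h1, h2.congr fun _ => h3⟩


/-! ## The lower bound -/

/-- The point of `teamSource` with first one `t` and with a single selection `w r` in row `r`. -/
def sourcePoint (t : ℕ) (w Z : ℕ → ℕ) (n : ℕ) : ℕ :=
  if n.unpair.1 = 0 then if n.unpair.2 = t then 1 else 0
  else if n.unpair.1 = 1 then if InFst (hist t) n.unpair.2 then 1 else 0
  else if n.unpair.1 = 2 then if col n.unpair.2 = 2 * t + 1 then Z n.unpair.2 else 0
  else if n.unpair.1 = 3 then
    if w n.unpair.2.unpair.1 = n.unpair.2.unpair.2 then 1 else 0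
  else if n.unpair.1 = 4 ∧ n.unpair.2.unpair.2 < n.unpair.2.unpair.1 ∧
    col n.unpair.2.unpair.2 = 2 * w n.unpair.2.unpair.1 + 2 then Z n.unpair.2.unpair.2 else 0

/-- The point of `helper t` which vanishes outside of the column `2t + 2`. -/
def helperPoint (t : ℕ) (Z : ℕ → ℕ) (m : ℕ) : ℕ := if col m = 2 * t + 2 then Z m else 0

/-- The two points together. -/
def fullPoint (t : ℕ) (w Z : ℕ → ℕ) : ℕ → ℕ := join (sourcePoint t w Z) (helperPoint t Z)

/-- Locality of the information in the point: row `s` reveals only bits below `s` of the column it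
selects, and section 1 uses only the finite history at stage `t`. Hence a column that is neither
certified, nor helped, nor selected stays hidden. -/
theorem fullPoint_congr {t n : ℕ} {w w' Z Z' : ℕ → ℕ} (hw : ∀ s ≤ n, w s = w' s)
    (hZ : ∀ m ≤ n, (col m = 2 * t + 1 ∨ col m = 2 * t + 2 ∨
      ∃ s ≤ n, m < s ∧ col m = 2 * w s + 2) → Z m = Z' m) :
    fullPoint t w Z n = fullPoint t w' Z' n := by
  have hh : n / 2 ≤ n := Nat.div_le_self _ _
  unfold fullPoint join
  split_ifs with hpar
  · generalize hk : n / 2 = k at hh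
    have h1 : k.unpair.2 ≤ n := (Nat.unpair_right_le k).trans hh
    have h2 : k.unpair.2.unpair.1 ≤ n := (Nat.unpair_left_le _).trans h1
    have h3 : k.unpair.2.unpair.2 ≤ n := (Nat.unpair_right_le _).trans h1
    unfold sourcePoint
    rw [← hw _ h2]
    have e1 : col k.unpair.2 = 2 * t + 1 → Z k.unpair.2 = Z' k.unpair.2 :=
      fun h => hZ _ h1 (Or.inl h)
    have e2 : k.unpair.2.unpair.2 < k.unpair.2.unpair.1 →
        col k.unpair.2.unpair.2 = 2 * w k.unpair.2.unpair.1 + 2 →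
        Z k.unpair.2.unpair.2 = Z' k.unpair.2.unpair.2 :=
      fun h h' => hZ _ h3 (Or.inr (Or.inr ⟨_, h2, h, h'⟩))
    have e3 : (if col k.unpair.2 = 2 * t + 1 then Z k.unpair.2 else 0) =
        if col k.unpair.2 = 2 * t + 1 then Z' k.unpair.2 else 0 := by
      split_ifs with h
      exacts [e1 h, rfl]
    have e4 : (if k.unpair.1 = 4 ∧ k.unpair.2.unpair.2 < k.unpair.2.unpair.1 ∧
        col k.unpair.2.unpair.2 = 2 * w k.unpair.2.unpair.1 + 2 then Z k.unpair.2.unpair.2 else 0) =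
        if k.unpair.1 = 4 ∧ k.unpair.2.unpair.2 < k.unpair.2.unpair.1 ∧
        col k.unpair.2.unpair.2 = 2 * w k.unpair.2.unpair.1 + 2 then Z' k.unpair.2.unpair.2
        else 0 := by
      split_ifs with h
      exacts [e2 h.2.1 h.2.2, rfl]
    rw [e3, e4]
  · unfold helperPoint
    split_ifs with h
    · exact hZ _ hh (Or.inr (Or.inl h))
    · rfl

theorem primrec_fullPoint (t : ℕ) {α : Type} [Primcodable α] {σ : α → List ℕ} {Z : α → ℕ → ℕ}
    (hσ : Primrec σ) (hZ : Primrec fun p : α × ℕ => Z p.1 p.2) :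
    Primrec fun p : α × ℕ => fullPoint t (fun s => (σ p.1).getD s 0) (Z p.1) p.2 := by
  have hZ' : ∀ {q : α × ℕ → ℕ}, Primrec q → Primrec fun p : α × ℕ => Z p.1 (q p) :=
    fun hq => hZ.comp (Primrec.fst.pair hq)
  have hn : Primrec fun p : α × ℕ => p.2 / 2 :=
    Primrec.nat_div.comp Primrec.snd (Primrec.const 2)
  have h1 : Primrec fun p : α × ℕ => (p.2 / 2).unpair.1 := primrec_unpair_fst.comp hn
  have h2 : Primrec fun p : α × ℕ => (p.2 / 2).unpair.2 := primrec_unpair_snd.comp hn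
  have h21 : Primrec fun p : α × ℕ => (p.2 / 2).unpair.2.unpair.1 := primrec_unpair_fst.comp h2
  have h22 : Primrec fun p : α × ℕ => (p.2 / 2).unpair.2.unpair.2 := primrec_unpair_snd.comp h2
  have hw : Primrec fun p : α × ℕ => (σ p.1).getD (p.2 / 2).unpair.2.unpair.1 0 :=
    (Primrec.list_getD 0).comp (hσ.comp Primrec.fst) h21
  have c0 := Primrec.ite (Primrec.eq.comp h2 (Primrec.const t)) (Primrec.const 1)
    (Primrec.const (α := α × ℕ) 0)
  have c1 := Primrec.ite (primrecPred_inFst.comp ((Primrec.const (hist t)).pair h2))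
    (Primrec.const 1) (Primrec.const 0)
  have c2 := Primrec.ite (Primrec.eq.comp (primrec_col.comp h2) (Primrec.const (2 * t + 1)))
    (hZ' h2) (Primrec.const 0)
  have c3 := Primrec.ite (Primrec.eq.comp hw h22) (Primrec.const 1)
    (Primrec.const (α := α × ℕ) 0)
  have c4 := Primrec.ite ((Primrec.eq.comp h1 (Primrec.const 4)).and
    ((Primrec.nat_lt.comp h22 h21).and (Primrec.eq.comp (primrec_col.comp h22)
      (Primrec.succ.comp (Primrec.nat_double_succ.comp hw))))) (hZ' h22) (Primrec.const 0)
  have s3 := Primrec.ite (Primrec.eq.comp h1 (Primrec.const 3)) c3 c4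
  have s2 := Primrec.ite (Primrec.eq.comp h1 (Primrec.const 2)) c2 s3
  have s1 := Primrec.ite (Primrec.eq.comp h1 (Primrec.const 1)) c1 s2
  have s0 := Primrec.ite (Primrec.eq.comp h1 (Primrec.const 0)) c0 s1
  have hh := Primrec.ite (Primrec.eq.comp (primrec_col.comp hn) (Primrec.const (2 * t + 2)))
    (hZ' hn) (Primrec.const 0)
  have hpar : PrimrecPred fun p : α × ℕ => p.2 % 2 = 0 :=
    Primrec.eq.comp (Primrec.nat_mod.comp Primrec.snd (Primrec.const 2)) (Primrec.const 0)
  have := Primrec.ite hpar s0 hh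
  exact this

/-- The oracle seen by the learners after the finite sequence `σ` of selections. -/
noncomputable def fullStr (t : ℕ) (σ : List ℕ) : List ℕ :=
  initSeg (fullPoint t (fun s => σ.getD s 0) charA) σ.length

/-- Entry `n` depends on selections up to `n` only, so the default selection `0` beyond the end of
the string is never consulted. -/
theorem fullStr_initSeg (t : ℕ) (w : ℕ → ℕ) (l : ℕ) :
    fullStr t (initSeg w l) = initSeg (fullPoint t w charA) l := by
  rw [fullStr, initSeg_length]
  refine List.map_congr_left fun n hn => fullPoint_congr (fun s hs => ?_) fun _ _ _ => rfl
  have hn := List.mem_range.1 hn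
  rw [List.getD_eq_getElem?_getD, initSeg_getElem? w (by omega)]
  rfl

/-- The value at `n` computed by the `e`-th functional after the selections `σ`. -/
noncomputable def out (t e : ℕ) (σ : List ℕ) (n : ℕ) : Option ℕ :=
  phiStr e (fullStr t σ) n σ.length

/-- `w` extends `σ`, and all later values are in `J`. -/
def Follows (J : Finset ℕ) (σ : List ℕ) (w : ℕ → ℕ) : Prop :=
  initSeg w σ.length = σ ∧ ∀ s ≥ σ.length, w s ∈ J

theorem initSeg_append (w : ℕ → ℕ) {k l : ℕ} (h : k ≤ l) :
    initSeg w l = initSeg w k ++ (List.range (l - k)).map fun s => w (k + s) := by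
  obtain ⟨d, rfl⟩ := Nat.exists_eq_add_of_le h
  simp [initSeg, List.range_add]

theorem Follows.exists_append {J : Finset ℕ} {σ : List ℕ} {w : ℕ → ℕ} (h : Follows J σ w) {l : ℕ}
    (hl : σ.length ≤ l) : ∃ ρ : List ℕ, (∀ x ∈ ρ, x ∈ J) ∧ initSeg w l = σ ++ ρ := by
  refine ⟨_, ?_, by rw [initSeg_append w hl, h.1]⟩
  intro x hx
  obtain ⟨s, -, rfl⟩ := List.mem_map.1 hx
  exact h.2 _ (by omega)

theorem Follows.mono {J J' : Finset ℕ} (hJ : J ⊆ J') {σ ρ : List ℕ} (hρ : ∀ x ∈ ρ, x ∈ J')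
    {w : ℕ → ℕ} (h : Follows J (σ ++ ρ) w) : Follows J' σ w := by
  have hσ : initSeg w σ.length = σ := by
    rw [← initSeg_take w (show σ.length ≤ (σ ++ ρ).length by simp), h.1, List.take_left]
  refine ⟨hσ, fun s hs => ?_⟩
  by_cases hlt : s < (σ ++ ρ).length
  · have h1 : (σ ++ ρ)[s]? = some (w s) := by rw [← h.1, initSeg_getElem? w hlt]
    rw [List.getElem?_append_right hs] at h1
    exact hρ _ (List.mem_of_getElem? h1)
  · exact hJ (h.2 s (by omega))

theorem out_sound {t e n v : ℕ} {σ : List ℕ} {J : Finset ℕ} {w g : ℕ → ℕ} (hw : Follows J σ w)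
    (hg : PhiEq e (fullPoint t w charA) g) (h : out t e σ n = some v) : g n = v := by
  rw [out, ← hw.1, fullStr_initSeg, initSeg_length] at h
  exact Part.mem_unique (hg n) (phiStr_sound h)

theorem out_complete {t e : ℕ} {w g : ℕ → ℕ} (hg : PhiEq e (fullPoint t w charA) g) (n : ℕ) :
    ∀ᶠ l in atTop, out t e (initSeg w l) n = some (g n) := by
  obtain ⟨N, hN⟩ := phiStr_complete (hg n)
  filter_upwards [eventually_ge_atTop N] with l hl
  rw [out, fullStr_initSeg, initSeg_length]
  exact hN l hl

/-- If the column `i` is not used by the selections in `J`, then the outputs are not always correct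
separations of the column `i`. -/
theorem exists_wrong_out (t e i : ℕ) (σ : List ℕ) (J : Finset ℕ) {pos : ℕ → ℕ}
    (hpos : Primrec pos) (hi1 : i ≠ 2 * t + 1) (hi2 : i ≠ 2 * t + 2) (hJ : ∀ j ∈ J, i ≠ 2 * j + 2) :
    ∃ m, col m = i ∧ ((∀ ρ : List ℕ, (∀ x ∈ ρ, x ∈ J) → out t e (σ ++ ρ) (pos m) = none) ∨
      ∃ ρ : List ℕ, (∀ x ∈ ρ, x ∈ J) ∧ ∃ v, out t e (σ ++ ρ) (pos m) = some v ∧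
        ((v = 0 ∧ m ∈ setA) ∨ (v ≠ 0 ∧ m ∈ setB))) := by
  -- The rows of `σ` may have selected column `i`, but those rows are short: the finitely many bits
  -- they reveal are stored in `K`.
  set K : List ℕ := initSeg charA σ.length with hK
  let Z : List ℕ → ℕ → ℕ := fun τ m => if m < K.length then K.getD m 0 else τ.getD m 0
  let S : ℕ → List ℕ := fun c => (Encodable.decode (α := List ℕ) c).getD []
  -- One axiom for each way `S c` of continuing with selections from `J`, provided the oracle
  -- segment is long enough. Different continuations may give different answers, which is why
  -- `exists_wrong` admits inconsistent axioms.
  let G : ℕ → List ℕ → ℕ → Option ℕ := fun c τ m =>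
    if (∀ x ∈ S c, ∃ y ∈ J.toList, y = x) ∧ (σ ++ S c).length ≤ τ.length then
      phiStr e (initSeg (fullPoint t (fun s => (σ ++ S c).getD s 0) (Z τ)) (σ ++ S c).length)
        (pos m) (σ ++ S c).length
    else none
  have hG : Computable fun p : ℕ × List ℕ × ℕ => G p.1 p.2.1 p.2.2 := by
    have hS : Primrec fun p : ℕ × List ℕ × ℕ => S p.1 :=
      Primrec.option_getD.comp (Primrec.decode.comp Primrec.fst) (Primrec.const [])
    have hτ : Primrec fun p : ℕ × List ℕ × ℕ => p.2.1 := Primrec.fst.comp Primrec.snd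
    have hσ : Primrec fun p : ℕ × List ℕ × ℕ => σ ++ S p.1 :=
      Primrec.list_append.comp (Primrec.const σ) hS
    have hZ : Primrec fun q : (ℕ × List ℕ × ℕ) × ℕ => Z q.1.2.1 q.2 :=
      Primrec.ite (Primrec.nat_lt.comp Primrec.snd (Primrec.const K.length))
        ((Primrec.list_getD 0).comp (Primrec.const K) Primrec.snd)
        ((Primrec.list_getD 0).comp (hτ.comp Primrec.fst) Primrec.snd)
    have hlen := Primrec.list_length.comp hσ
    have hY0 := primrec_fullPoint t (Z := fun p : ℕ × List ℕ × ℕ => Z p.2.1) hσ hZ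
    have hY := primrec_initSeg (F := fun p : ℕ × List ℕ × ℕ =>
      fullPoint t (fun s => (σ ++ S p.1).getD s 0) (Z p.2.1)) hY0 hlen
    have hmem : PrimrecPred fun x : ℕ => ∃ y ∈ J.toList, y = x := by
      have h : PrimrecRel fun y x : ℕ => y = x := Primrec.eq
      exact h.exists_mem_list.comp (Primrec.const J.toList) Primrec.id
    have h1 := (hmem.forall_mem_list.comp hS).and
      (Primrec.nat_le.comp hlen (Primrec.list_length.comp hτ))
    have h2 := phiStr_primrec.comp (((Primrec.const e).pair hY).pair
      (hpos.comp (Primrec.snd.comp Primrec.snd)))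
    have h3 := Primrec.ite h1 h2 (Primrec.const none)
    refine (h3.of_eq fun p => ?_).to_comp
    simp only [initSeg_length, G]
  have hstr : ∀ (ρ : List ℕ) (l : ℕ), (∀ x ∈ ρ, x ∈ J) → (σ ++ ρ).length ≤ l →
      initSeg (fullPoint t (fun s => (σ ++ ρ).getD s 0) (Z (initSeg (charAOmit i) l)))
        (σ ++ ρ).length = fullStr t (σ ++ ρ) := by
    intro ρ l hρ hl
    refine List.map_congr_left fun n hn => fullPoint_congr (fun _ _ => rfl) fun m hm hrel => ?_
    have hn := List.mem_range.1 hn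
    simp only [Z, hK, initSeg_length]
    split_ifs with hlt
    · rw [List.getD_eq_getElem?_getD, initSeg_getElem? _ hlt]; rfl
    rw [List.getD_eq_getElem?_getD, initSeg_getElem? _ (by omega), Option.getD_some, charAOmit,
      if_neg]
    -- Beyond `K`, a relevant bit is never in column `i`: a row `s > m ≥ |σ|` makes its selection
    -- from `J`.
    rcases hrel with h | h | ⟨s, hs, hms, h⟩
    · omega
    · omega
    · have hs' : s < (σ ++ ρ).length := by omega
      have hsJ : (σ ++ ρ).getD s 0 ∈ J := by
        have hget : (σ ++ ρ)[s]? = some ((σ ++ ρ)[s]) := List.getElem?_eq_getElem hs'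
        rw [List.getD_eq_getElem?_getD, hget, Option.getD_some]
        rw [List.getElem?_append_right (by omega)] at hget
        exact hρ _ (List.mem_of_getElem? hget)
      have := hJ _ hsJ
      omega
  obtain ⟨m, hm, h⟩ := exists_wrong i hG
  refine ⟨m, hm, ?_⟩
  have hSdec : ∀ ρ : List ℕ, S (Encodable.encode ρ) = ρ := fun ρ => by simp [S]
  rcases h with h | ⟨c, l, v, hv, hwrong⟩
  · left
    intro ρ hρ
    have := h (Encodable.encode ρ) (σ ++ ρ).length
    simp only [G, hSdec, initSeg_length] at this
    rw [if_pos ⟨fun x hx => ⟨x, by simpa using hρ x hx, rfl⟩, le_rfl⟩, hstr ρ _ hρ le_rfl] at this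
    exact this
  · right
    simp only [G, initSeg_length] at hv
    split_ifs at hv with hc
    have hρ : ∀ x ∈ S c, x ∈ J := fun x hx => by simpa using hc.1 x hx
    rw [hstr _ _ hρ hc.2] at hv
    exact ⟨S c, hρ, v, hv, hwrong⟩

/-- The `e`-th functional does not solve `teamTarget` on any point given by a sequence of
selections that follows `σ` and `J`. -/
def NoSolution (t e : ℕ) (J : Finset ℕ) (σ : List ℕ) : Prop :=
  ∀ w, Follows J σ w → ∀ g ∈ teamTarget, ¬ PhiEq e (fullPoint t w charA) g

theorem NoSolution.mono {t e : ℕ} {J J' : Finset ℕ} {σ ρ : List ℕ} (h : NoSolution t e J' σ)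
    (hJ : J ⊆ J') (hρ : ∀ x ∈ ρ, x ∈ J') : NoSolution t e J (σ ++ ρ) :=
  fun w hw => h w (hw.mono hJ hρ)

/-- A total output has a value at `n` after finitely many selections, all of which extend `σ` by
elements of `J`. -/
theorem noSolution_of_none {t e n : ℕ} {J : Finset ℕ} {σ : List ℕ}
    (h : ∀ ρ : List ℕ, (∀ x ∈ ρ, x ∈ J) → out t e (σ ++ ρ) n = none) : NoSolution t e J σ := by
  intro w hw g _ hPhi
  obtain ⟨l, hl, hσl⟩ := ((out_complete hPhi n).and (eventually_ge_atTop σ.length)).exists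
  obtain ⟨ρ, hρ, he⟩ := hw.exists_append hσl
  rw [he, h ρ hρ] at hl
  cases hl

theorem exists_Wrong {m v : ℕ} (h : (v = 0 ∧ m ∈ setA) ∨ (v ≠ 0 ∧ m ∈ setB)) (hv : v < 2) :
    ∃ s, Wrong s m v := by
  rcases h with ⟨rfl, s, hs⟩ | ⟨h, s, hs⟩
  · exact ⟨s, Or.inl ⟨rfl, hs⟩⟩
  · exact ⟨s, Or.inr ⟨by omega, hs⟩⟩

/-- A functional is defeated by giving up at most one selection. -/
theorem exists_noSolution (t e : ℕ) (σ : List ℕ) (J : Finset ℕ) (hJ : ∀ j ∈ J, j < t) :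
    ∃ ρ : List ℕ, (∀ x ∈ ρ, x ∈ J) ∧ ∃ j, NoSolution t e (J.erase j) (σ ++ ρ) := by
  by_contra hcon
  -- The standing assumption: after any continuation, and with any one selection banned, there is
  -- still a point on which the functional succeeds.
  have hcon' : ∀ ρ : List ℕ, (∀ x ∈ ρ, x ∈ J) → ∀ j, ¬ NoSolution t e (J.erase j) (σ ++ ρ) :=
    fun ρ hρ j h => hcon ⟨ρ, hρ, j, h⟩
  clear hcon
  have hfull : ∀ ρ : List ℕ, (∀ x ∈ ρ, x ∈ J) → ¬ NoSolution t e J (σ ++ ρ) := by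
    intro ρ hρ h
    -- Any index would do in place of `0`: banning a selection only removes points.
    have := h.mono (J.erase_subset 0) (ρ := []) (by simp)
    rw [List.append_nil] at this
    exact hcon' ρ hρ 0 this
  have happ : ∀ {ρ ρ' : List ℕ}, (∀ x ∈ ρ, x ∈ J) → (∀ x ∈ ρ', x ∈ J) →
      ∀ x ∈ ρ ++ ρ', x ∈ J := fun h h' x hx => (List.mem_append.1 hx).elim (h x) (h' x)
  -- Forcing an error: where success is still possible the functional cannot stay silent, so on a
  -- column not supplied by `J'` some further selections make it answer wrongly.
  have key : ∀ (i : ℕ) (ρ : List ℕ) (J' : Finset ℕ) (pos : ℕ → ℕ), (∀ x ∈ ρ, x ∈ J) → J' ⊆ J →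
      Primrec pos → i ≠ 2 * t + 1 → i ≠ 2 * t + 2 → (∀ j ∈ J', i ≠ 2 * j + 2) →
      ¬ NoSolution t e J' (σ ++ ρ) → ∃ ρ' : List ℕ, (∀ x ∈ ρ', x ∈ J) ∧ ρ <+: ρ' ∧
        ∃ m v, col m = i ∧ out t e (σ ++ ρ') (pos m) = some v ∧
          ((v = 0 ∧ m ∈ setA) ∨ (v ≠ 0 ∧ m ∈ setB)) := by
    intro i ρ J' pos hρ hJ' hpos h1 h2 h3 h4
    obtain ⟨m, hm, h | ⟨ρ', hρ', v, hv, hwr⟩⟩ := exists_wrong_out t e i (σ ++ ρ) J' hpos h1 h2 h3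
    · exact absurd (noSolution_of_none h) h4
    · rw [List.append_assoc] at hv
      exact ⟨ρ ++ ρ', happ hρ fun x hx => hJ' (hρ' x hx), List.prefix_append _ _, m, v, hm, hv,
        hwr⟩
  -- An error on column `0`: from here on, a correct output has to name a limit.
  obtain ⟨ρ1, hρ1, -, m1, v1, hm1, hv1, hwr1⟩ := key 0 [] J (Nat.pair 1) (by simp)
    (Finset.Subset.refl _) (Primrec₂.natPair.comp (Primrec.const 1) Primrec.id) (by omega)
    (by omega) (fun j _ => by omega) (hfull [] (by simp))
  have hno := hfull ρ1 hρ1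
  simp only [NoSolution, not_forall, not_not] at hno
  obtain ⟨w0, hw0, g0, ⟨⟨⟨hbin, hlim⟩, -⟩, ⟨-, hsel⟩, -⟩, hPhi0⟩ := hno
  obtain ⟨t', ht'⟩ : ∃ t', IsFirst g0 t' := by
    have hex : ∃ t', g0 (Nat.pair 0 t') ≠ 0 := by
      by_contra hall
      simp only [ne_eq, not_exists, not_not] at hall
      obtain rfl := out_sound hw0 hPhi0 hv1
      obtain ⟨s, hs⟩ := exists_Wrong hwr1 (hbin _)
      exact hlim (s, m1) ⟨hm1, fun t _ => hall t, hs⟩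
    classical
    refine ⟨Nat.find hex, ?_, fun t' ht' => by simpa using Nat.find_min hex ht'⟩
    have := Nat.find_spec hex
    have := hbin (Nat.pair 0 (Nat.find hex))
    omega
  -- Follow `w0` until the limit `t'` and all selections in row `t'` have been output. They bind the
  -- functional on every point continuing this string.
  obtain ⟨l, ⟨hl0, hl3⟩, hll⟩ := (((Set.finite_lt_nat (t' + 1)).eventually_all.2
    fun k _ => out_complete hPhi0 (Nat.pair 0 k)).and
    ((Set.finite_lt_nat t').eventually_all.2
      fun k _ => out_complete hPhi0 (Nat.pair 3 (Nat.pair t' k))) |>.and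
    (eventually_ge_atTop (σ ++ ρ1).length)).exists
  obtain ⟨ρ2, hρ2, he2⟩ := hw0.exists_append hll
  rw [List.append_assoc] at he2
  have hρ12 := happ hρ1 hρ2
  have hagree : ∀ {J' ρ' w g} {n : ℕ}, J' ⊆ J → (∀ x ∈ ρ', x ∈ J) → ρ1 ++ ρ2 <+: ρ' →
      Follows J' (σ ++ ρ') w → PhiEq e (fullPoint t w charA) g →
      out t e (initSeg w0 l) n = some (g0 n) → g n = g0 n := by
    rintro J' _ w g n hJ' hρ' ⟨ρ3, rfl⟩ hw hg hout
    rw [he2] at hout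
    rw [← List.append_assoc] at hw
    exact out_sound (hw.mono hJ' fun x hx => hρ' x (List.mem_append_right _ hx)) hg hout
  have hfirst : ∀ {J' ρ' w g}, J' ⊆ J → (∀ x ∈ ρ', x ∈ J) → ρ1 ++ ρ2 <+: ρ' →
      Follows J' (σ ++ ρ') w → PhiEq e (fullPoint t w charA) g → IsFirst g t' := by
    intro J' ρ' w g hJ' hρ' hpre hw hg
    have h : ∀ k < t' + 1, g (Nat.pair 0 k) = g0 (Nat.pair 0 k) :=
      fun k hk => hagree hJ' hρ' hpre hw hg (hl0 k hk)
    exact ⟨(h t' (by omega)).trans ht'.1, fun k hk => (h k (by omega)).trans (ht'.2 k hk)⟩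
  by_cases htt : t' = t
  · subst htt
    obtain ⟨j, hj, hj1⟩ : ∃ j < t', g0 (Nat.pair 3 (Nat.pair t' j)) = 1 := by
      by_contra hall
      refine hsel (t', t') ⟨⟨ht', rfl⟩, fun j hj => ?_⟩
      by_contra hne
      have := hbin (Nat.pair 3 (Nat.pair t' j))
      exact hall ⟨j, hj, by simp only at hne; omega⟩
    -- With `j` banned, column `2j + 2` is no longer supplied, so the row to which the functional
    -- has committed itself can be made wrong.
    obtain ⟨ρ3, hρ3, hpre, m, v, hm, hv, hwr⟩ := key (2 * j + 2) (ρ1 ++ ρ2) (J.erase j)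
      (fun m => Nat.pair 4 (Nat.pair t' m)) hρ12 (J.erase_subset j)
      (Primrec₂.natPair.comp (Primrec.const 4) (Primrec₂.natPair.comp (Primrec.const t')
        Primrec.id)) (by omega) (by omega)
      (fun j' hj' => by have := Finset.ne_of_mem_erase hj'; omega) (hcon' _ hρ12 j)
    have hno := hcon' ρ3 hρ3 j
    simp only [NoSolution, not_forall, not_not] at hno
    obtain ⟨w, hw, g, ⟨-, -, hbin', hval⟩, hPhi⟩ := hno
    have hsub := J.erase_subset j
    obtain rfl := out_sound hw hPhi hv
    obtain ⟨s, hs⟩ := exists_Wrong hwr (hbin' _)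
    refine hval (((t', t'), j), s, m) ⟨⟨⟨hfirst hsub hρ3 hpre hw hPhi, rfl⟩, hj, trivial⟩,
      ⟨hm, ?_⟩, hs⟩
    exact (hagree hsub hρ3 hpre hw hPhi (hl3 j hj)).trans hj1
  -- The limit named is false. The point contains no information on column `2t' + 1`, so its
  -- certificate can be made wrong, without banning any selection.
  · obtain ⟨ρ3, hρ3, hpre, m, v, hm, hv, hwr⟩ := key (2 * t' + 1) (ρ1 ++ ρ2) J
      (Nat.pair 2) hρ12 (Finset.Subset.refl _)
      (Primrec₂.natPair.comp (Primrec.const 2) Primrec.id) (by omega) (by omega)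
      (fun j' _ => by omega) (hfull _ hρ12)
    have hno := hfull ρ3 hρ3
    simp only [NoSolution, not_forall, not_not] at hno
    obtain ⟨w, hw, g, ⟨⟨-, hbin', hname⟩, -⟩, hPhi⟩ := hno
    obtain rfl := out_sound hw hPhi hv
    obtain ⟨s, hs⟩ := exists_Wrong hwr (hbin' _)
    exact hname (t', s, m) ⟨hfirst (Finset.Subset.refl _) hρ3 hpre hw hPhi, hm, hs⟩


/-! ### Finite selection sequences against teams of learners -/

theorem exists_limit {c : ℕ → List ℕ} (h : ∀ n, c n <+: c (n + 1)) (hl : ∀ n, n ≤ (c n).length) :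
    ∃ w : ℕ → ℕ, ∀ n, initSeg w (c n).length = c n := by
  have hmono : ∀ {m n}, m ≤ n → c m <+: c n := by
    intro m n hmn
    induction hmn with
    | refl => exact List.prefix_refl _
    | step _ ih => exact ih.trans (h _)
  have hget : ∀ {m n s : ℕ}, s < (c m).length → s < (c n).length → (c m)[s]? = (c n)[s]? := by
    have : ∀ {m n s : ℕ}, m ≤ n → s < (c m).length → (c m)[s]? = (c n)[s]? := by
      intro m n s hmn hs
      obtain ⟨ρ, hρ⟩ := hmono hmn
      rw [← hρ, List.getElem?_append_left hs]
    intro m n s hm hn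
    rcases le_total m n with hmn | hmn
    · exact this hmn hm
    · exact (this hmn hn).symm
  refine ⟨fun s => (c (s + 1)).getD s 0, fun n => List.ext_getElem? fun s => ?_⟩
  by_cases hs : s < (c n).length
  · have h1 : s < (c (s + 1)).length := hl (s + 1)
    rw [initSeg_getElem? _ hs, List.getD_eq_getElem?_getD, hget hs h1,
      List.getElem?_eq_getElem h1]
    rfl
  · rw [List.getElem?_eq_none (by rw [initSeg_length]; omega),
      List.getElem?_eq_none (by omega)]

/-- The learner `Ψ` does not identify any solution. -/
def Fails (t : ℕ) (Ψ : List ℕ → ℕ) (w : ℕ → ℕ) : Prop :=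
  ∀ g ∈ teamTarget, ¬ IdentifiedOn Ψ (fullPoint t w charA) g

/-- If all learners in `I` can always be made to change their guesses, then some sequence of
selections makes them do so infinitely often. -/
theorem exists_generic {ι : Type} (t : ℕ) (Ψ : ι → List ℕ → ℕ) (I : Finset ι) (J : Finset ℕ)
    (hJ : J.Nonempty) (σ : List ℕ)
    (hchange : ∀ i ∈ I, ∀ ρ : List ℕ, (∀ x ∈ ρ, x ∈ J) → ∃ ρ' : List ℕ, (∀ x ∈ ρ', x ∈ J) ∧
      Ψ i (fullStr t (σ ++ ρ ++ ρ')) ≠ Ψ i (fullStr t (σ ++ ρ))) :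
    ∃ w, Follows J σ w ∧ ∀ i ∈ I, Fails t (Ψ i) w := by
  classical
  -- The learners are made to change one after another. Each change is recorded by two lengths
  -- within a single string, so that it survives later extensions.
  have step : ∀ I' ⊆ I, ∀ ρ : List ℕ, (∀ x ∈ ρ, x ∈ J) → ∃ ρ' : List ℕ, (∀ x ∈ ρ', x ∈ J) ∧
      ∀ i ∈ I', ∃ l1 l2, (σ ++ ρ).length ≤ l1 ∧ l1 ≤ l2 ∧ l2 ≤ (σ ++ ρ ++ ρ').length ∧
        Ψ i (fullStr t ((σ ++ ρ ++ ρ').take l1)) ≠ Ψ i (fullStr t ((σ ++ ρ ++ ρ').take l2)) := by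
    intro I'
    induction I' using Finset.induction_on with
    | empty => exact fun _ ρ _ => ⟨[], by simp, by simp⟩
    | insert i I' _ ih =>
      intro hI ρ hρ
      obtain ⟨ρ', hρ', h⟩ := ih (fun k hk => hI (Finset.mem_insert_of_mem hk)) ρ hρ
      obtain ⟨ρ'', hρ'', hne⟩ := hchange i (hI (Finset.mem_insert_self i I')) (ρ ++ ρ')
        fun x hx => (List.mem_append.1 hx).elim (hρ x) (hρ' x)
      rw [← List.append_assoc] at hne
      refine ⟨ρ' ++ ρ'', fun x hx => (List.mem_append.1 hx).elim (hρ' x) (hρ'' x), ?_⟩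
      rw [← List.append_assoc]
      intro k hk
      rcases Finset.mem_insert.1 hk with rfl | hk
      · refine ⟨(σ ++ ρ ++ ρ').length, (σ ++ ρ ++ ρ' ++ ρ'').length, by simp, by simp, le_rfl, ?_⟩
        rw [List.take_left, List.take_length]
        exact hne.symm
      · obtain ⟨l1, l2, h1, h2, h3, h4⟩ := h k hk
        refine ⟨l1, l2, h1, h2, h3.trans (by simp), ?_⟩
        rwa [List.take_append_of_le_length (h2.trans h3), List.take_append_of_le_length h3]
  obtain ⟨j0, hj0⟩ := hJ
  choose! f hf hf' using step I (Finset.Subset.refl I)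
  -- The additional `j0` makes the strings grow even if no learner forces them to.
  obtain ⟨r, hr0, hr⟩ : ∃ r : ℕ → List ℕ, r 0 = [] ∧ ∀ n, r (n + 1) = r n ++ (f (r n) ++ [j0]) :=
    ⟨fun n => Nat.rec [] (fun _ ρ => ρ ++ (f ρ ++ [j0])) n, rfl, fun _ => rfl⟩
  have hrJ : ∀ n, ∀ x ∈ r n, x ∈ J := by
    intro n
    induction n with
    | zero => simp [hr0]
    | succ n ih =>
      rw [hr]
      intro x hx
      rcases List.mem_append.1 hx with hx | hx
      · exact ih x hx
      rcases List.mem_append.1 hx with hx | hx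
      · exact hf _ ih x hx
      · rw [List.mem_singleton.1 hx]; exact hj0
  have hlen : ∀ n, n ≤ (r n).length := by
    intro n
    induction n with
    | zero => exact Nat.zero_le _
    | succ n ih => rw [hr]; simp; omega
  obtain ⟨w, hw⟩ := exists_limit (c := fun n => σ ++ r n)
    (fun n => by simp only [hr, ← List.append_assoc]; exact ⟨f (r n) ++ [j0], by simp⟩)
    (fun n => (hlen n).trans (by simp))
  have hfol : Follows J σ w := by
    refine ⟨by simpa [hr0] using hw 0, fun s hs => ?_⟩
    have hls : s < (σ ++ r (s + 1)).length := (hlen (s + 1)).trans (by simp)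
    have h1 : (σ ++ r (s + 1))[s]? = some (w s) := by rw [← hw, initSeg_getElem? w hls]
    rw [List.getElem?_append_right hs] at h1
    exact hrJ _ _ (List.mem_of_getElem? h1)
  refine ⟨w, hfol, fun i hi g _ ⟨e, he, _⟩ => ?_⟩
  obtain ⟨N, hN⟩ := eventually_atTop.1 he
  obtain ⟨l1, l2, h1, h2, h3, h4⟩ := hf' (r N) (hrJ N) i hi
  have hpre : initSeg w (σ ++ r N ++ f (r N)).length = σ ++ r N ++ f (r N) := by
    have := hw (N + 1)
    simp only [hr, ← List.append_assoc] at this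
    rw [← initSeg_take w (show (σ ++ r N ++ f (r N)).length ≤
      (σ ++ r N ++ f (r N) ++ [j0]).length by simp), this, List.take_left]
  rw [← hpre, initSeg_take w (h2.trans h3), initSeg_take w h3, fullStr_initSeg,
    fullStr_initSeg] at h4
  have hNl : N ≤ l1 := ((hlen N).trans (by simp)).trans h1
  exact h4 ((hN l1 hNl).trans (hN l2 (hNl.trans h2)).symm)

/-- Fewer learners than selections are defeated by some sequence of selections. -/
theorem exists_fails {ι : Type} (t : ℕ) (Ψ : ι → List ℕ → ℕ) (I : Finset ι) :
    ∀ J : Finset ℕ, (∀ j ∈ J, j < t) → I.card < J.card → ∀ σ : List ℕ,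
      ∃ w, Follows J σ w ∧ ∀ i ∈ I, Fails t (Ψ i) w := by
  classical
  induction I using Finset.strongInduction with
  | H I ih =>
  intro J hJ hcard σ
  -- If some learner is locked on a guess by `ρ`, the functional it guesses is defeated by giving up
  -- at most one selection. This removes one learner and at most one element of `J`, so the
  -- inequality of cardinalities persists. If no learner can be locked, all of them can be made to
  -- change forever.
  by_cases hlock : ∃ i ∈ I, ∃ ρ : List ℕ, (∀ x ∈ ρ, x ∈ J) ∧ ∀ ρ' : List ℕ, (∀ x ∈ ρ', x ∈ J) →
      Ψ i (fullStr t (σ ++ ρ ++ ρ')) = Ψ i (fullStr t (σ ++ ρ))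
  · obtain ⟨i, hi, ρ, hρ, hlock⟩ := hlock
    obtain ⟨ρ', hρ', j, hno⟩ := exists_noSolution t (Ψ i (fullStr t (σ ++ ρ))) (σ ++ ρ) J hJ
    obtain ⟨w, hw, hfail⟩ := ih (I.erase i) (Finset.erase_ssubset hi) (J.erase j)
      (fun k hk => hJ k (Finset.mem_of_mem_erase hk)) (by
        have h1 := Finset.card_erase_lt_of_mem hi
        have h2 := Finset.pred_card_le_card_erase (s := J) (a := j)
        omega) (σ ++ ρ ++ ρ')
    have hw1 : Follows J (σ ++ ρ) w := hw.mono (J.erase_subset j) hρ'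
    refine ⟨w, hw1.mono (Finset.Subset.refl J) hρ, fun k hk => ?_⟩
    by_cases hki : k = i
    · subst hki
      rintro g hg ⟨e, he, hPhi⟩
      obtain ⟨l, hl, hl'⟩ := (he.and (eventually_ge_atTop (σ ++ ρ).length)).exists
      obtain ⟨ρ'', hρ'', heq⟩ := hw1.exists_append hl'
      rw [← fullStr_initSeg, heq, hlock ρ'' hρ''] at hl
      rw [← hl] at hPhi
      exact hno w hw g hg hPhi
    · exact hfail k (Finset.mem_erase.2 ⟨hki, hk⟩)
  · refine exists_generic t Ψ I J (Finset.card_pos.1 (by omega)) σ fun i hi ρ hρ => ?_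
    by_contra hcon
    refine hlock ⟨i, hi, ρ, hρ, fun ρ' hρ' => ?_⟩
    by_contra hne
    exact hcon ⟨ρ', hρ', hne⟩

/-! ### The points belong to the classes -/

theorem charA_lt_two (m : ℕ) : charA m < 2 := by unfold charA; split_ifs <;> omega

theorem not_wrong_charA (s m : ℕ) : ¬ Wrong s m (charA m) := by
  rintro (⟨h, hA⟩ | ⟨h, hB⟩)
  · have : m ∈ setA := ⟨s, hA⟩
    simp [charA, this] at h
  · refine disjoint_AB (m := m) ?_ ⟨s, hB⟩
    by_contra hA
    simp [charA, hA] at h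

theorem helperPoint_mem (t : ℕ) : helperPoint t charA ∈ helper t := by
  refine ⟨fun n => ?_, fun x ⟨h1, h2⟩ => ?_⟩
  · unfold helperPoint
    split_ifs
    exacts [charA_lt_two n, by omega]
  · rw [helperPoint, if_pos h1] at h2
    exact not_wrong_charA _ _ h2

theorem sourcePoint_pair (t : ℕ) (w Z : ℕ → ℕ) (r : ℕ) :
    sourcePoint t w Z (Nat.pair 0 r) = (if r = t then 1 else 0) ∧
    sourcePoint t w Z (Nat.pair 1 r) = (if InFst (hist t) r then 1 else 0) ∧
    sourcePoint t w Z (Nat.pair 2 r) = (if col r = 2 * t + 1 then Z r else 0) := by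
  simp [sourcePoint]

theorem sourcePoint_select (t : ℕ) (w Z : ℕ → ℕ) (r j : ℕ) :
    sourcePoint t w Z (Nat.pair 3 (Nat.pair r j)) = if w r = j then 1 else 0 := by
  simp [sourcePoint]

theorem sourcePoint_value (t : ℕ) (w Z : ℕ → ℕ) (r m : ℕ) :
    sourcePoint t w Z (Nat.pair 4 (Nat.pair r m)) =
      if m < r ∧ col m = 2 * w r + 2 then Z m else 0 := by
  simp [sourcePoint]

theorem isFirst_sourcePoint {t t' : ℕ} {w Z : ℕ → ℕ} (h : IsFirst (sourcePoint t w Z) t') :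
    t' = t := by
  have := h.1
  rw [(sourcePoint_pair t w Z t').1] at this
  by_contra hne
  simp [hne] at this

/-- Section 1 is correct up to stage `t` only. This suffices, since from `t` on section 0 is no
longer zero and the constraint on column `0` lapses. The other separations copy `charA`, which is
never wrong. -/
theorem sourcePoint_mem {t : ℕ} {w : ℕ → ℕ} (hw : ∀ s, w s < t) :
    sourcePoint t w charA ∈ teamSource := by
  have hbin : ∀ n, sourcePoint t w charA n < 2 := by
    intro n
    have h1 := charA_lt_two n.unpair.2
    have h2 := charA_lt_two n.unpair.2.unpair.2
    unfold sourcePoint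
    split_ifs <;> omega
  refine ⟨⟨⟨hbin, ?_⟩, hbin, ?_⟩, ⟨hbin, ?_⟩, hbin, ?_⟩
  · rintro ⟨s, m⟩ ⟨-, h1, h2⟩
    have hst : s < t := by
      by_contra hcon
      have := h1 t (by simp only; omega)
      simp [(sourcePoint_pair t w charA t).1] at this
    have hmono := hist_mono hst.le
    simp only [(sourcePoint_pair t w charA m).2.1] at h2
    rcases h2 with ⟨h2, ev, hev, h3⟩ | ⟨h2, hB⟩
    · have : InFst (hist t) m := ⟨ev, hmono hev, h3⟩
      simp [this] at h2
    · have : InFst (hist t) m := by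
        by_contra hcon
        simp [hcon] at h2
      exact disjoint_AB ⟨t, this⟩ ⟨s, hB⟩
  · rintro ⟨t', s, m⟩ ⟨h1, h2, h3⟩
    obtain rfl : t' = t := isFirst_sourcePoint h1
    simp only at h2 h3
    rw [(sourcePoint_pair t' w charA m).2.2, if_pos h2] at h3
    exact not_wrong_charA _ _ h3
  · rintro ⟨t', r⟩ ⟨⟨h1, -⟩, h2⟩
    obtain rfl : t' = t := isFirst_sourcePoint h1
    have := h2 (w r) (hw r)
    simp [sourcePoint_select] at this
  · rintro ⟨⟨⟨t', r⟩, j⟩, s, m⟩ ⟨⟨-, -, h1⟩, ⟨h2, h3⟩, h4⟩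
    simp only [sourcePoint_select, sourcePoint_value] at h1 h2 h3 h4
    have h5 : w r = j := by
      by_contra hne
      simp [hne] at h3
    rw [if_pos ⟨h1, by rw [h5, h2]⟩] at h4
    exact not_wrong_charA _ _ h4

/-- With the `t`-th helper, fewer than `t` learners cannot solve `teamTarget` from `teamSource`. -/
theorem exists_unidentified {b t : ℕ} (hbt : b < t) (Ψ : Fin b → List ℕ → ℕ) :
    ∃ f ∈ teamSource, ∀ g ∈ teamTarget, ∀ i,
      ¬ IdentifiedOn (Ψ i) (join f (helperPoint t charA)) g := by
  obtain ⟨w, hw, h⟩ := exists_fails t Ψ Finset.univ (Finset.range t)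
    (fun j hj => Finset.mem_range.1 hj) (by simpa using hbt) []
  exact ⟨sourcePoint t w charA, sourcePoint_mem fun s =>
    Finset.mem_range.1 (hw.2 s (Nat.zero_le s)), fun g hg i => h i (Finset.mem_univ i) g hg⟩

theorem nonempty_teamSource : teamSource.Nonempty :=
  ⟨_, sourcePoint_mem (t := 1) (w := fun _ => 0) fun _ => Nat.one_pos⟩

theorem nonempty_helper (t : ℕ) : (helper t).Nonempty := ⟨_, helperPoint_mem t⟩

theorem nonempty_teamTarget : teamTarget.Nonempty := by
  let f : ℕ → ℕ := fun n =>
    if n.unpair.1 = 0 then if n.unpair.2 = 1 then 1 else 0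
    else if n.unpair.1 = 3 then 1
    else if n.unpair.1 = 4 then charA n.unpair.2.unpair.2 else charA n.unpair.2
  have hbin : ∀ n, f n < 2 := by
    intro n
    have h1 := charA_lt_two n.unpair.2
    have h2 := charA_lt_two n.unpair.2.unpair.2
    simp only [f]
    split_ifs <;> omega
  have h0 : ∀ {t}, IsFirst f t → t = 1 := by
    intro t ht
    by_contra hne
    simpa [f, hne] using ht.1
  refine ⟨f, ⟨⟨hbin, ?_⟩, hbin, ?_⟩, ⟨hbin, ?_⟩, hbin, ?_⟩
  · rintro x ⟨-, -, h⟩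
    exact not_wrong_charA _ _ (by simpa [f] using h)
  · rintro x ⟨-, -, h⟩
    exact not_wrong_charA _ _ (by simpa [f] using h)
  · rintro ⟨t, r⟩ ⟨⟨h1, -⟩, h⟩
    obtain rfl := h0 h1
    simpa [f] using h 0 Nat.one_pos
  · rintro x ⟨-, -, h⟩
    exact not_wrong_charA _ _ (by simpa [f] using h)


/-! ## Iterations of `Σ⁰₂-LEM` are team-learnable -/

/-- A finite team of computable learners solves the multi-valued function `G`. -/
def TeamSolves (G : Multi) : Prop :=
  ∃ (b : ℕ) (Ψ : Fin b → List ℕ → ℕ), (∀ i, Computable (Ψ i)) ∧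
    ∀ x, (G x).Nonempty → ∃ w ∈ G x, ∃ i, IdentifiedOn (Ψ i) x w

/-- Indices of joins can be computed. -/
theorem exists_index_join : ∃ c : ℕ → ℕ → ℕ, Computable₂ c ∧ ∀ (d e : ℕ) (f g h : ℕ → ℕ),
    PhiEq d f g → PhiEq e f h → PhiEq (c d e) f (join g h) := by
  obtain ⟨c, hc, hspec⟩ := exists_index (H := fun a σ n =>
    if n % 2 = 0 then phiStr a.unpair.1 σ (n / 2) σ.length
    else phiStr a.unpair.2 σ (n / 2) σ.length) (by
      have hn : Primrec fun p : ℕ × List ℕ × ℕ => p.2.2 := Primrec.snd.comp Primrec.snd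
      have hσ : Primrec fun p : ℕ × List ℕ × ℕ => p.2.1 := Primrec.fst.comp Primrec.snd
      have hh : Primrec fun p : ℕ × List ℕ × ℕ => p.2.2 / 2 :=
        Primrec.nat_div.comp hn (Primrec.const 2)
      exact (Primrec.ite (Primrec.eq.comp (Primrec.nat_mod.comp hn (Primrec.const 2))
        (Primrec.const 0))
        (phiStr_primrec.comp (((primrec_unpair_fst.comp Primrec.fst).pair hσ).pair hh))
        (phiStr_primrec.comp (((primrec_unpair_snd.comp Primrec.fst).pair hσ).pair hh))).to_comp)
  refine ⟨fun d e => c (Nat.pair d e), hc.comp Primrec₂.natPair.to_comp, ?_⟩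
  refine fun d e f g h hd he => hspec _ f _ (fun n => ?_) (fun n l v hv => ?_)
  · by_cases hn : n % 2 = 0
    · obtain ⟨N, hN⟩ := phiStr_complete (hd (n / 2))
      exact ⟨N, by simpa [hn, join, initSeg_length] using hN N le_rfl⟩
    · obtain ⟨N, hN⟩ := phiStr_complete (he (n / 2))
      exact ⟨N, by simpa [hn, join, initSeg_length] using hN N le_rfl⟩
  · by_cases hn : n % 2 = 0
    · simp only [hn, if_true, initSeg_length, Nat.unpair_pair] at hv
      simpa [join, hn] using Part.mem_unique (phiStr_sound hv) (hd (n / 2))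
    · simp only [hn, if_false, initSeg_length, Nat.unpair_pair] at hv
      simpa [join, hn] using Part.mem_unique (phiStr_sound hv) (he (n / 2))

/-- The two functionals of the reduction are fixed, so they are built into every guess and no
learner is added. The learner reads the part of the inner instance computed so far. -/
theorem TeamSolves.of_weihrauchLE {F G : Multi} (h : WeihrauchLE F G) (hG : TeamSolves G) :
    TeamSolves F := by
  obtain ⟨d, k, hd⟩ := h
  obtain ⟨b, Ψ, hΨ, hG⟩ := hG
  obtain ⟨c, hc, hcomp⟩ := exists_index_comp
  obtain ⟨p, hp, hpair⟩ := exists_index_join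
  obtain ⟨u, hu⟩ := exists_index_id
  refine ⟨b, fun i σ => c (p u (c d (Ψ i (outStr d σ)))) k, fun i => ?_, fun x hx => ?_⟩
  · have h1 : Computable fun σ => Ψ i (outStr d σ) :=
      (hΨ i).comp (outStr_primrec.to_comp.comp ((Computable.const d).pair Computable.id))
    exact hc.comp (hp.comp (Computable.const u) (hc.comp (Computable.const d) h1))
      (Computable.const k)
  · obtain ⟨y, hxy, hy, hback⟩ := hd x hx
    obtain ⟨z, hz, i, e, he, hyz⟩ := hG y hy
    obtain ⟨w, hw, hxw⟩ := hback z hz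
    refine ⟨w, hw, i, c (p u (c d e)) k, ?_, hcomp _ _ _ _ _
      (hpair _ _ _ _ _ (hu x) (hcomp _ _ _ _ _ hxy hyz)) hxw⟩
    obtain ⟨t, ht, hout⟩ := outStr_spec hxy
    filter_upwards [ht.eventually he] with l hl
    simp [hout, hl]

/-- One learner for each pair: the second member guesses how to compute an intermediate point, and
the first works on what this guess has output so far. Once the former is settled, the latter sees
longer and longer true initial segments. -/
theorem TeamSolves.comp {A B : Multi} (hA : TeamSolves A) (hB : TeamSolves B) :
    TeamSolves (A.comp B) := by
  obtain ⟨b, Ψ, hΨ, hA⟩ := hA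
  obtain ⟨b', Θ, hΘ, hB⟩ := hB
  obtain ⟨c, hc, hcomp⟩ := exists_index_comp
  refine ⟨b * b', fun p σ => c (Θ (finProdFinEquiv.symm p).2 σ)
    (Ψ (finProdFinEquiv.symm p).1 (outStr (Θ (finProdFinEquiv.symm p).2 σ) σ)), fun p => ?_, ?_⟩
  · exact hc.comp (hΘ _) ((hΨ _).comp (outStr_primrec.to_comp.comp ((hΘ _).pair Computable.id)))
  · rintro x ⟨-, hdom, y, hy, -⟩
    obtain ⟨y, hy, j, d, hd, hxy⟩ := hB x ⟨y, hy⟩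
    obtain ⟨w, hw, i, e, he, hyw⟩ := hA y (hdom y hy)
    refine ⟨w, ⟨hdom, y, hy, hw⟩, finProdFinEquiv (i, j), c d e, ?_, hcomp _ _ _ _ _ hxy hyw⟩
    obtain ⟨t, ht, hout⟩ := outStr_spec hxy
    filter_upwards [hd, ht.eventually he] with l hl hl'
    simp [hl, hout, hl']

theorem teamSolves_singleton : TeamSolves fun x => {x} := by
  obtain ⟨u, hu⟩ := exists_index_id
  exact ⟨1, fun _ _ => u, fun _ => Computable.const u,
    fun x _ => ⟨x, rfl, 0, u, Eventually.of_forall fun _ => rfl, hu x⟩⟩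

/-- The least `s` for which the string `σ` contains no `t` with `σ(s, t) ≠ 0`. -/
def leastUnrefuted (σ : List ℕ) : ℕ :=
  (List.range σ.length).findIdx fun s =>
    ∀ n < σ.length, ¬ (n.unpair.1 = s ∧ σ.getD n 0 ≠ 0)

theorem primrec_leastUnrefuted : Primrec leastUnrefuted := by
  have h1 : PrimrecRel fun (n : ℕ) (p : List ℕ × ℕ) =>
      ¬ (n.unpair.1 = p.2 ∧ p.1.getD n 0 ≠ 0) :=
    PrimrecPred.not ((Primrec.eq.comp (primrec_unpair_fst.comp Primrec.fst)
      (Primrec.snd.comp Primrec.snd)).and (PrimrecPred.not (Primrec.eq.comp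
        ((Primrec.list_getD 0).comp (Primrec.fst.comp Primrec.snd) Primrec.fst)
        (Primrec.const 0))))
  have h2 := (primrecRel_forall_lt h1).comp
    (Primrec.list_length.comp (Primrec.fst (α := List ℕ) (β := ℕ))) Primrec.id
  have h3 := Primrec.list_findIdx (Primrec.list_range.comp Primrec.list_length) h2.decide.to₂
  exact h3

theorem leastUnrefuted_eventually {x : ℕ → ℕ} {s : ℕ} (hs : ∀ t, x (Nat.pair s t) = 0)
    (hmin : ∀ s' < s, ∃ t, x (Nat.pair s' t) ≠ 0) :
    ∀ᶠ l in atTop, leastUnrefuted (initSeg x l) = s := by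
  choose! t ht using hmin
  filter_upwards [eventually_gt_atTop s, (Set.finite_lt_nat s).eventually_all.2
    fun s' _ => eventually_gt_atTop (Nat.pair s' (t s'))] with l hl hl'
  have hget : ∀ n < l, (initSeg x l).getD n 0 = x n := fun n hn => by
    rw [List.getD_eq_getElem?_getD, initSeg_getElem? x hn]; rfl
  rw [leastUnrefuted, initSeg_length, List.findIdx_eq (by simpa using hl)]
  simp only [List.getElem_range, decide_eq_true_eq, decide_eq_false_iff_not]
  refine ⟨?_, fun s' hs' h => ?_⟩
  · rintro n hn ⟨rfl, hne⟩
    rw [hget n hn] at hne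
    exact hne (by simpa using hs n.unpair.2)
  · refine h _ (hl' s' hs') ⟨by simp, ?_⟩
    rw [hget _ (hl' s' hs')]
    exact ht s' hs'

/-- One learner for each alternative, neither knowing which one holds. If a witness `s` exists, the
least unrefuted candidate converges to the least witness; otherwise one fixed program finds all
`t_s` by search. -/
theorem teamSolves_sigma2LEM : TeamSolves sigma2LEM := by
  obtain ⟨c, hc, hconst⟩ := exists_index (H := fun a _ n => some (if n = 1 then a else 0))
    (Primrec.option_some.comp (Primrec.ite (Primrec.eq.comp (Primrec.snd.comp Primrec.snd)
      (Primrec.const 1)) Primrec.fst (Primrec.const 0))).to_comp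
  let S : List ℕ → ℕ → ℕ := fun σ n =>
    (List.range σ.length).findIdx fun t => σ.getD (Nat.pair (n - 1) t) 0 ≠ 0
  have hS : Primrec fun p : List ℕ × ℕ => S p.1 p.2 := by
    have h1 : PrimrecPred fun q : (List ℕ × ℕ) × ℕ =>
        q.1.1.getD (Nat.pair (q.1.2 - 1) q.2) 0 ≠ 0 :=
      PrimrecPred.not (Primrec.eq.comp ((Primrec.list_getD 0).comp
        (Primrec.fst.comp Primrec.fst) (Primrec₂.natPair.comp (Primrec.nat_sub.comp
          (Primrec.snd.comp Primrec.fst) (Primrec.const 1)) Primrec.snd)) (Primrec.const 0))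
    have h2 := Primrec.list_findIdx (Primrec.list_range.comp
      (Primrec.list_length.comp (Primrec.fst (α := List ℕ) (β := ℕ)))) h1.decide.to₂
    exact h2
  obtain ⟨e, -, he⟩ := exists_index (H := fun _ σ n =>
    if n = 0 then some 1 else if S σ n < σ.length then some (S σ n) else none) (by
      have hn : Primrec fun p : ℕ × List ℕ × ℕ => p.2.2 := Primrec.snd.comp Primrec.snd
      have hS' : Primrec fun p : ℕ × List ℕ × ℕ => S p.2.1 p.2.2 := hS.comp Primrec.snd
      exact (Primrec.ite (Primrec.eq.comp hn (Primrec.const 0)) (Primrec.const (some 1))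
        (Primrec.ite (Primrec.nat_lt.comp hS' (Primrec.list_length.comp
          (Primrec.fst.comp Primrec.snd))) (Primrec.option_some.comp hS')
          (Primrec.const none))).to_comp)
  refine ⟨2, ![fun σ => c (leastUnrefuted σ), fun _ => e 0], ?_, fun x _ => ?_⟩
  · intro i
    fin_cases i
    · exact hc.comp primrec_leastUnrefuted.to_comp
    · exact Computable.const _
  classical
  by_cases hex : ∃ s, ∀ t, x (Nat.pair s t) = 0
  · refine ⟨fun n => if n = 1 then Nat.find hex else 0, Or.inl ⟨rfl, Nat.find_spec hex⟩, 0,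
      c (Nat.find hex), ?_, hconst _ x _ (fun n => ⟨0, rfl⟩) fun n l v hv => by
        simpa using hv.symm⟩
    filter_upwards [leastUnrefuted_eventually (Nat.find_spec hex) fun s hs => by
      simpa using Nat.find_min hex hs] with l hl
    simp [hl]
  · simp only [not_exists, not_forall] at hex
    have hSx : ∀ {l n}, S (initSeg x l) n < l → S (initSeg x l) n = Nat.find (hex (n - 1)) := by
      intro l n hlt
      have hget : ∀ {k}, k < l → (initSeg x l).getD k 0 = x k := fun hk => by
        rw [List.getD_eq_getElem?_getD, initSeg_getElem? x hk]; rfl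
      have h := (List.findIdx_eq (xs := List.range (initSeg x l).length)
        (p := fun t => decide ((initSeg x l).getD (Nat.pair (n - 1) t) 0 ≠ 0))
        (i := S (initSeg x l) n) (by simpa [initSeg_length] using hlt)).1 rfl
      simp only [List.getElem_range, decide_eq_true_eq, decide_eq_false_iff_not, not_not] at h
      -- Unseen entries read as `0`, so a nonzero entry that was found is really visible, and by
      -- monotonicity of pairing so are the earlier candidates.
      have hvis : Nat.pair (n - 1) (S (initSeg x l) n) < l := by
        by_contra hcon
        exact h.1 (List.getD_eq_default _ _ (by rw [initSeg_length]; omega))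
      refine ((Nat.find_eq_iff _).2 ⟨?_, fun k hk => ?_⟩).symm
      · rw [← hget hvis]; exact h.1
      · have := h.2 k hk
        rw [hget ((Nat.pair_lt_pair_right _ hk).trans hvis)] at this
        simpa using this
    refine ⟨fun n => if n = 0 then 1 else Nat.find (hex (n - 1)), Or.inr ⟨rfl, fun s => ?_⟩, 1,
      e 0, Eventually.of_forall fun _ => rfl, he 0 x _ (fun n => ?_) fun n l v hv => ?_⟩
    · simpa using Nat.find_spec (hex s)
    · by_cases hn : n = 0
      · exact ⟨0, by simp [hn]⟩
      · refine ⟨Nat.pair (n - 1) (Nat.find (hex (n - 1))) + 1, ?_⟩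
        set l := Nat.pair (n - 1) (Nat.find (hex (n - 1))) + 1 with hl
        have hlt : S (initSeg x l) n < l := by
          have h1 : Nat.find (hex (n - 1)) < l :=
            Nat.lt_succ_of_le (Nat.right_le_pair _ _)
          have h2 : S (initSeg x l) n < (List.range (initSeg x l).length).length := by
            refine List.findIdx_lt_length_of_exists ⟨Nat.find (hex (n - 1)), ?_, ?_⟩
            · simpa [initSeg_length] using h1
            · rw [List.getD_eq_getElem?_getD, initSeg_getElem? x (by omega)]
              simpa using Nat.find_spec (hex (n - 1))
          simpa [initSeg_length] using h2
        simp only [hn, if_false, initSeg_length]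
        rw [if_pos hlt, hSx hlt]
    · simp only [initSeg_length] at hv
      split_ifs at hv with hn hlt
      · simpa [hn] using hv.symm
      · rw [hSx hlt] at hv
        simpa [hn] using hv.symm

theorem IterLE.teamSolves {k : ℕ} {G : Multi} (h : IterLE sigma2LEM k G) : TeamSolves G := by
  induction k generalizing G with
  | zero => exact TeamSolves.of_weihrauchLE h teamSolves_singleton
  | succ k ih =>
    obtain ⟨A, B, hA, hB, h⟩ := h
    exact ((teamSolves_sigma2LEM.of_weihrauchLE hA).comp (ih hB)).of_weihrauchLE h

/-- All values of `G` on `Q` lie in `P`, so choosing at each point a value that the team identifies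
gives a single-valued function as required. -/
theorem LemLE.teamLE {P Q : Set (ℕ → ℕ)} (h : LemLE P Q) : TeamLE P Q := by
  classical
  obtain ⟨k, G, hG, hPQ⟩ := h
  obtain ⟨b, Ψ, hΨ, hs⟩ := hG.teamSolves
  choose! w hw hid using hs
  refine ⟨fun g => ⟨g ∈ Q, fun _ => w g⟩, ⟨b, Ψ, hΨ, ?_⟩, fun g hg => ?_⟩
  · rintro g h ⟨hg, rfl⟩
    exact hid g (hPQ g hg).1
  · exact ⟨w g, ⟨hg, rfl⟩, (hPQ g hg).2 (hw g (hPQ g hg).1)⟩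

/-! ## Joins of mass problems -/

theorem LemLE.of_index {P Q : Set (ℕ → ℕ)} {e : ℕ} (h : ∀ x ∈ Q, ∃ y ∈ P, PhiEq e x y) :
    LemLE P Q := by
  obtain ⟨u, hu⟩ := exists_index_id
  obtain ⟨r, hr⟩ := exists_index_right
  obtain ⟨c, hc⟩ := exists_index_trans r e
  refine ⟨0, fun x => {y | y ∈ P ∧ PhiEq e x y}, ⟨u, c, ?_⟩, fun x hx => ⟨h x hx, fun y hy => hy.1⟩⟩
  rintro x ⟨y, hy, hxy⟩
  refine ⟨x, hu x, ⟨x, rfl⟩, ?_⟩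
  rintro z rfl
  exact ⟨y, ⟨hy, hxy⟩, hc _ _ _ (hr z z) hxy⟩

theorem lemLE_joinSet_left (P Q : Set (ℕ → ℕ)) : LemLE P (joinSet P Q) := by
  obtain ⟨e, he⟩ := exists_index_left
  refine LemLE.of_index (e := e) ?_
  rintro _ ⟨f, hf, g, -, rfl⟩
  exact ⟨f, hf, he f g⟩

theorem lemLE_joinSet_right (P Q : Set (ℕ → ℕ)) : LemLE Q (joinSet P Q) := by
  obtain ⟨e, he⟩ := exists_index_right
  refine LemLE.of_index (e := e) ?_
  rintro _ ⟨f, -, g, hg, rfl⟩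
  exact ⟨g, hg, he f g⟩

theorem lemLE_joinSet_swap (P Q : Set (ℕ → ℕ)) : LemLE (joinSet P Q) (joinSet Q P) := by
  obtain ⟨l, hl⟩ := exists_index_left
  obtain ⟨r, hr⟩ := exists_index_right
  obtain ⟨e, he⟩ := exists_index_pair r l
  refine LemLE.of_index (e := e) ?_
  rintro _ ⟨f, hf, g, hg, rfl⟩
  exact ⟨join g f, ⟨g, hg, f, hf, rfl⟩, he _ _ _ (hr f g) (hl f g)⟩

theorem LemLE.joinSet_keep {P Q : Set (ℕ → ℕ)} (R : Set (ℕ → ℕ)) (h : LemLE P Q) :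
    LemLE (joinSet R P) (joinSet R Q) := by
  obtain ⟨k, G, hG, hPQ⟩ := h
  refine ⟨k, G.keep, IterLE.mono (WeihrauchLE.refl G).keep hG, ?_⟩
  rintro _ ⟨z, hz, u, hu, rfl⟩
  refine ⟨Multi.keep_nonempty.2 (hPQ u hu).1, fun q hq => ?_⟩
  obtain ⟨v, hv, rfl⟩ := Multi.mem_keep.1 hq
  exact ⟨z, hz, v, (hPQ u hu).2 hv, rfl⟩

theorem LemLE.joinSet_self {P Q : Set (ℕ → ℕ)} (h : LemLE P Q) : LemLE (joinSet Q P) Q := by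
  obtain ⟨u, hu⟩ := exists_index_id
  obtain ⟨k, G, hG, hPQ⟩ := h
  refine ⟨k, fun x => {q | ∃ z ∈ G x, q = join x z}, IterLE.mono ⟨u, u, ?_⟩ hG, fun x hx => ?_⟩
  · rintro x ⟨_, z, hz, rfl⟩
    exact ⟨x, hu x, ⟨z, hz⟩, fun z' hz' => ⟨join x z', ⟨z', hz', rfl⟩, hu _⟩⟩
  · obtain ⟨z, hz⟩ := (hPQ x hx).1
    refine ⟨⟨join x z, z, hz, rfl⟩, ?_⟩
    rintro _ ⟨z', hz', rfl⟩
    exact ⟨x, hx, z', (hPQ x hx).2 hz', rfl⟩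

/-- The reductions are applied in succession: a point of `P` is found with the input kept, and then
the input is turned into a point of `Q`. -/
theorem LemLE.joinSet {P Q R : Set (ℕ → ℕ)} (hP : LemLE P R) (hQ : LemLE Q R) :
    LemLE (joinSet P Q) R :=
  (hQ.joinSet_keep P).trans ((lemLE_joinSet_swap P R).trans hP.joinSet_self)

theorem TeamLE.joinSet {P Q R : Set (ℕ → ℕ)} (hP : TeamLE P R) (hQ : TeamLE Q R) :
    TeamLE (joinSet P Q) R := by
  obtain ⟨Γ, ⟨b, Ψ, hΨ, hΓ⟩, hPR⟩ := hP
  obtain ⟨Δ, ⟨b', Θ, hΘ, hΔ⟩, hQR⟩ := hQ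
  obtain ⟨c, hc, hjoin⟩ := exists_index_join
  refine ⟨fun f => (Γ f).bind fun g => (Δ f).map (join g), ⟨b * b', fun p σ =>
    c (Ψ (finProdFinEquiv.symm p).1 σ) (Θ (finProdFinEquiv.symm p).2 σ),
    fun p => hc.comp (hΨ _) (hΘ _), ?_⟩, fun f hf => ?_⟩
  · intro f k hk
    obtain ⟨g, hg, hk⟩ := Part.mem_bind_iff.1 hk
    obtain ⟨h, hh, rfl⟩ := (Part.mem_map_iff _).1 hk
    obtain ⟨i, d, hd, hdg⟩ := hΓ f g hg
    obtain ⟨j, e, he, heh⟩ := hΔ f h hh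
    refine ⟨finProdFinEquiv (i, j), c d e, ?_, hjoin _ _ _ _ _ hdg heh⟩
    filter_upwards [hd, he] with l hl hl'
    simp [hl, hl']
  · obtain ⟨g, hg, hgP⟩ := hPR f hf
    obtain ⟨h, hh, hhQ⟩ := hQR f hf
    exact ⟨join g h, Part.mem_bind_iff.2 ⟨g, hg, (Part.mem_map_iff _).2 ⟨h, hh, rfl⟩⟩,
      g, hgP, h, hhQ, rfl⟩

theorem sigma2LEM_nonempty (x : ℕ → ℕ) : (sigma2LEM x).Nonempty := by
  by_cases hex : ∃ s, ∀ t, x (Nat.pair s t) = 0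
  · obtain ⟨s, hs⟩ := hex
    exact ⟨fun n => if n = 1 then s else 0, Or.inl ⟨rfl, hs⟩⟩
  · simp only [not_exists, not_forall] at hex
    choose t ht using hex
    exact ⟨fun n => if n = 0 then 1 else t (n - 1), Or.inr ⟨rfl, by simpa using ht⟩⟩

/-- One application of `Σ⁰₂-LEM` to an instance computed by the `d`-th functional. -/
theorem lemLE_sigma2LEM {Q : Set (ℕ → ℕ)} {F : (ℕ → ℕ) → ℕ → ℕ} {d : ℕ}
    (hd : ∀ y, PhiEq d y (F y)) :
    LemLE {q | ∃ y ∈ Q, ∃ z ∈ sigma2LEM (F y), q = join y z} Q := by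
  obtain ⟨u, hu⟩ := exists_index_id
  obtain ⟨r, hr⟩ := exists_index_right
  let G : Multi := fun y => {q | ∃ z ∈ sigma2LEM (F y), q = join y z}
  have hne : ∀ y, (G y).Nonempty := fun y =>
    let ⟨z, hz⟩ := sigma2LEM_nonempty (F y)
    ⟨_, z, hz, rfl⟩
  refine ⟨1, G, ⟨G, fun x => {x}, ⟨d, u, fun y _ => ⟨F y, hd y, sigma2LEM_nonempty _,
    fun z hz => ⟨join y z, ⟨z, hz, rfl⟩, hu _⟩⟩⟩, WeihrauchLE.refl _, ⟨u, r, fun y _ =>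
    ⟨y, hu y, ?_, ?_⟩⟩⟩, fun y hy => ⟨hne y, ?_⟩⟩
  · obtain ⟨q, hq⟩ := hne y
    exact ⟨q, fun y' _ => hne y', y, rfl, hq⟩
  · rintro z ⟨-, y', rfl, hz⟩
    exact ⟨z, hz, hr _ z⟩
  · rintro _ ⟨z, hz, rfl⟩
    exact ⟨y, hy, z, hz, rfl⟩


/-! ## The upper bound -/

/-- The flag `v` says correctly whether `j` is selected in infinitely many rows of `f`. -/
def CorrectFlag (f : ℕ → ℕ) (j v : ℕ) : Prop :=
  (v = 0 ∧ ∃ s, ∀ r, f (Nat.pair 3 (Nat.pair (s + r) j)) = 0) ∨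
    (v = 1 ∧ ∀ s, ∃ r, f (Nat.pair 3 (Nat.pair (s + r) j)) ≠ 0)

/-- Points of `teamSource` and `helper t`, together with `k` correct flags. -/
def flagged (t k : ℕ) : Set (ℕ → ℕ) :=
  {y | ∃ f ∈ teamSource, ∃ h ∈ helper t, ∃ g, (∀ j < k, CorrectFlag f j (g j)) ∧
    y = join (join f h) g}

theorem lemLE_flagged_zero (t : ℕ) : LemLE (flagged t 0) (joinSet teamSource (helper t)) := by
  obtain ⟨e, he⟩ := exists_index_id
  obtain ⟨p, hp⟩ := exists_index_pair e e
  refine LemLE.of_index (e := p) ?_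
  rintro _ ⟨f, hf, h, hh, rfl⟩
  exact ⟨_, ⟨f, hf, h, hh, join f h, by simp, rfl⟩, hp _ _ _ (he _) (he _)⟩

/-- Whether `k` is selected in infinitely many rows is a single instance of `sigma2LEM`: its entry
at `(s, r)` is the selection bit in row `s + r`. The first entry of the answer is the new flag. -/
theorem lemLE_flagged_succ (t k : ℕ) : LemLE (flagged t (k + 1)) (flagged t k) := by
  -- The factor `4` appears because `f` occupies the multiples of four in the double join.
  obtain ⟨d, hd⟩ := exists_index_query
    (q := fun n => 4 * Nat.pair 3 (Nat.pair (n.unpair.1 + n.unpair.2) k))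
    (Primrec.nat_mul.comp (Primrec.const 4) (Primrec₂.natPair.comp (Primrec.const 3)
      (Primrec₂.natPair.comp (Primrec.nat_add.comp primrec_unpair_fst primrec_unpair_snd)
        (Primrec.const k))))
  -- Flag `k` sits at place `2k + 1` and is overwritten by `z 0`, found at place `1`; every other
  -- entry is copied from the left half.
  obtain ⟨e, he⟩ := exists_index_query (q := fun n => if n = 2 * k + 1 then 1 else 2 * n)
    (Primrec.ite (Primrec.eq.comp Primrec.id (Primrec.const (2 * k + 1))) (Primrec.const 1)
      Primrec.nat_double)
  refine LemLE.trans (LemLE.of_index (e := e) ?_) (lemLE_sigma2LEM (Q := flagged t k) hd)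
  rintro _ ⟨_, ⟨f, hf, h, hh, g, hg, rfl⟩, z, hz, rfl⟩
  refine ⟨_, ⟨f, hf, h, hh, Function.update g k (z 0), ?_, rfl⟩, ?_⟩
  · intro j hj
    rcases Nat.lt_succ_iff_lt_or_eq.1 hj with hlt | rfl
    · rw [Function.update_of_ne hlt.ne]
      exact hg j hlt
    · rw [Function.update_self]
      have hval : ∀ n, join (join f h) g (4 * n) = f n := fun n => by
        rw [show 4 * n = 2 * (2 * n) by omega, join_even, join_even]
      rcases hz with ⟨h0, hz⟩ | ⟨h0, hz⟩
      · refine Or.inl ⟨h0, z 1, fun r => ?_⟩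
        have := hz r
        simpa only [Nat.unpair_pair, hval] using this
      · refine Or.inr ⟨h0, fun s => ⟨z (s + 1), ?_⟩⟩
        have := hz s
        simpa only [Nat.unpair_pair, hval] using this
  · have hfun : join (join f h) (Function.update g k (z 0)) =
        fun n => join (join (join f h) g) z (if n = 2 * k + 1 then 1 else 2 * n) := by
      funext n
      split_ifs with hn
      · subst hn
        rw [join_odd, Function.update_self]
        exact (join_odd _ z 0).symm
      · obtain ⟨m, rfl | rfl⟩ := n.even_or_odd'
        · simp only [join_even]
        · simp only [join_even, join_odd]
          rw [Function.update_of_ne (by omega)]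
    rw [hfun]
    exact he _

theorem lemLE_flagged (t k : ℕ) : LemLE (flagged t k) (joinSet teamSource (helper t)) := by
  induction k with
  | zero => exact lemLE_flagged_zero t
  | succ k ih => exact (lemLE_flagged_succ t k).trans ih

/-- The column of `m` belongs to a selection `j < t` with flag `1`. -/
def UsesFlag (t : ℕ) (g : ℕ → ℕ) (m : ℕ) : Prop :=
  (col m = 2 * ((col m - 2) / 2) + 2 ∧ (col m - 2) / 2 < t) ∧ g ((col m - 2) / 2) = 1

instance (t : ℕ) (g : ℕ → ℕ) (m : ℕ) : Decidable (UsesFlag t g m) :=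
  inferInstanceAs (Decidable ((_ ∧ _) ∧ _))

/-- The first row longer than `m` of `f` in which the selection that `m` belongs to occurs. -/
noncomputable def firstRow (f : ℕ → ℕ) (m : ℕ) : ℕ :=
  sInf {r | m < r ∧ f (Nat.pair 3 (Nat.pair r ((col m - 2) / 2))) = 1}

/-- The solution of `teamTarget` given by correct flags. -/
noncomputable def solution (t : ℕ) (f h g : ℕ → ℕ) (n : ℕ) : ℕ :=
  if n.unpair.1 ≤ 2 then f n
  else if n.unpair.1 = 3 then
    if n.unpair.2.unpair.1 ≤ t then
      if n.unpair.2.unpair.2 < t ∧ g n.unpair.2.unpair.2 = 1 then 1 else 0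
    else if n.unpair.2.unpair.2 = t then 1 else 0
  else if n.unpair.1 = 4 then
    if n.unpair.2.unpair.1 ≤ t then
      if UsesFlag t g n.unpair.2.unpair.2 then
        f (Nat.pair 4 (Nat.pair (firstRow f n.unpair.2.unpair.2) n.unpair.2.unpair.2)) else 0
    else h n.unpair.2.unpair.2
  else 0

theorem firstRow_spec {t : ℕ} {f g : ℕ → ℕ} (hbin : ∀ n, f n < 2)
    (hg : ∀ j < t, CorrectFlag f j (g j)) {m : ℕ} (hm : UsesFlag t g m) :
    m < firstRow f m ∧ f (Nat.pair 3 (Nat.pair (firstRow f m) ((col m - 2) / 2))) = 1 := by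
  refine Nat.sInf_mem (s := {r | m < r ∧ f (Nat.pair 3 (Nat.pair r ((col m - 2) / 2))) = 1}) ?_
  rcases hg _ hm.1.2 with ⟨h, -⟩ | ⟨-, h⟩
  · rw [hm.2] at h; omega
  · obtain ⟨r, hr⟩ := h (m + 1)
    have := hbin (Nat.pair 3 (Nat.pair (m + 1 + r) ((col m - 2) / 2)))
    exact ⟨m + 1 + r, by omega, by omega⟩

/-- The limit `T` of `f` need not be known: rows up to `t` are filled by means of the flags and
later rows by means of the helper, so whichever row counts is right. If `T ≤ t`, some `j < T` is
selected infinitely often by the pigeonhole principle, and each bit of its column is copied from a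
row long enough to contain it. If `T > t`, the selection `t < T` is legal and `h` separates its
column. -/
theorem solution_mem {t : ℕ} {f h g : ℕ → ℕ} (hf : f ∈ teamSource) (hh : h ∈ helper t)
    (hg : ∀ j < t, CorrectFlag f j (g j)) : solution t f h g ∈ teamTarget := by
  obtain ⟨⟨⟨hbin, hlim⟩, -, hname⟩, ⟨-, hsel⟩, -, hval⟩ := hf
  have hbin' : ∀ n, solution t f h g n < 2 := by
    intro n
    unfold solution
    split_ifs <;> first | exact hbin _ | exact hh.1 _ | omega
  have hcopy : ∀ {i r}, i ≤ 2 → solution t f h g (Nat.pair i r) = f (Nat.pair i r) :=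
    fun hi => by simp [solution, hi]
  have hfirst : ∀ {T}, IsFirst (solution t f h g) T → IsFirst f T := by
    rintro T ⟨h1, h2⟩
    rw [hcopy (by omega)] at h1
    exact ⟨h1, fun t' ht' => by rw [← hcopy (by omega)]; exact h2 t' ht'⟩
  have hselect : ∀ T j, solution t f h g (Nat.pair 3 (Nat.pair T j)) =
      if T ≤ t then if j < t ∧ g j = 1 then 1 else 0 else if j = t then 1 else 0 := by
    intro T j
    simp [solution]
  have hvalue : ∀ T m, solution t f h g (Nat.pair 4 (Nat.pair T m)) =
      if T ≤ t then if UsesFlag t g m then f (Nat.pair 4 (Nat.pair (firstRow f m) m)) else 0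
      else h m := by
    intro T m
    simp [solution]
  refine ⟨⟨⟨hbin', ?_⟩, hbin', ?_⟩, ⟨hbin', ?_⟩, hbin', ?_⟩
  · rintro x ⟨h1, h2, h3⟩
    rw [hcopy (by omega)] at h3
    exact hlim x ⟨h1, fun t' ht' => by rw [← hcopy (by omega)]; exact h2 t' ht', h3⟩
  · rintro x ⟨h1, h2, h3⟩
    rw [hcopy (by omega)] at h3
    exact hname x ⟨hfirst h1, h2, h3⟩
  · rintro ⟨T, r⟩ ⟨⟨h1, hr⟩, h2⟩
    obtain rfl : r = T := hr
    simp only [hselect] at h2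
    by_cases hT : r ≤ t
    · have hfin : ∀ j, j < r → ∃ s, ∀ r', f (Nat.pair 3 (Nat.pair (s + r') j)) = 0 := by
        intro j hj
        rcases hg j (by omega) with ⟨-, h3⟩ | ⟨h3, -⟩
        · exact h3
        · have := h2 j hj
          simp [hT, h3, show j < t by omega] at this
      -- A row beyond all these bounds would contain no selection below `r`, against the constraints
      -- of the source.
      choose! s hs using hfin
      refine hsel (r, (Finset.range r).sup s) ⟨⟨hfirst h1, trivial⟩, fun j hj => ?_⟩
      have hle : s j ≤ (Finset.range r).sup s := Finset.le_sup (Finset.mem_range.2 hj)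
      have := hs j hj ((Finset.range r).sup s - s j)
      rwa [Nat.add_sub_cancel' hle] at this
    · have := h2 t (by omega)
      simp [hT] at this
  · rintro ⟨⟨⟨T, r⟩, j⟩, s, m⟩ ⟨⟨⟨h1, hr⟩, h2, -⟩, ⟨h3, h4⟩, h5⟩
    obtain rfl : r = T := hr
    simp only [hselect, hvalue] at h2 h3 h4 h5
    by_cases hT : r ≤ t
    · rw [if_pos hT] at h4 h5
      have hgj : j < t ∧ g j = 1 := by
        by_contra hcon
        simp [hcon] at h4
      have hj : (col m - 2) / 2 = j := by omega
      have huse : UsesFlag t g m := ⟨⟨by rw [hj]; exact h3, by rw [hj]; exact hgj.1⟩, by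
        rw [hj]; exact hgj.2⟩
      rw [if_pos huse] at h5
      obtain ⟨h6, h7⟩ := firstRow_spec hbin hg huse
      rw [hj] at h7
      exact hval (((r, firstRow f m), j), s, m) ⟨⟨⟨hfirst h1, trivial⟩, h2, h6⟩, ⟨h3, h7⟩, h5⟩
    · rw [if_neg hT] at h4 h5
      have hj : j = t := by
        by_contra hcon
        simp [hcon] at h4
      subst hj
      exact hh.2 (s, m) ⟨h3, h5⟩

/-! ### Computing the solution from the flags -/

/-- The search for the first row on a finite part of the oracle. -/
def searchRow (σ : List ℕ) (m : ℕ) : ℕ :=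
  (List.range σ.length).findIdx fun r =>
    m < r ∧ σ.getD (4 * Nat.pair 3 (Nat.pair r ((col m - 2) / 2))) 0 = 1

/-- The computation of the solution on a finite part of the oracle. -/
def solveStep (t : ℕ) (σ : List ℕ) (n : ℕ) : Option ℕ :=
  if σ.length ≤ 4 * n + 2 * t + 4 then none
  else if n.unpair.1 ≤ 2 then some (σ.getD (4 * n) 0)
  else if n.unpair.1 = 3 then
    if n.unpair.2.unpair.1 ≤ t then
      if n.unpair.2.unpair.2 < t ∧ σ.getD (2 * n.unpair.2.unpair.2 + 1) 0 = 1 then some 1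
      else some 0
    else if n.unpair.2.unpair.2 = t then some 1 else some 0
  else if n.unpair.1 = 4 then
    if n.unpair.2.unpair.1 ≤ t then
      if UsesFlag t (fun j => σ.getD (2 * j + 1) 0) n.unpair.2.unpair.2 then
        σ[4 * Nat.pair 4 (Nat.pair (searchRow σ n.unpair.2.unpair.2) n.unpair.2.unpair.2)]?
      else some 0
    else some (σ.getD (4 * n.unpair.2.unpair.2 + 2) 0)
  else some 0

theorem primrec_searchRow : Primrec fun p : List ℕ × ℕ => searchRow p.1 p.2 := by
  have hm : Primrec fun q : (List ℕ × ℕ) × ℕ => q.1.2 := Primrec.snd.comp Primrec.fst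
  have hj : Primrec fun q : (List ℕ × ℕ) × ℕ => (col q.1.2 - 2) / 2 :=
    Primrec.nat_div.comp (Primrec.nat_sub.comp (primrec_col.comp hm) (Primrec.const 2))
      (Primrec.const 2)
  have hpos : Primrec fun q : (List ℕ × ℕ) × ℕ =>
      4 * Nat.pair 3 (Nat.pair q.2 ((col q.1.2 - 2) / 2)) :=
    Primrec.nat_mul.comp (Primrec.const 4) (Primrec₂.natPair.comp (Primrec.const 3)
      (Primrec₂.natPair.comp Primrec.snd hj))
  have hget : Primrec fun q : (List ℕ × ℕ) × ℕ =>
      q.1.1.getD (4 * Nat.pair 3 (Nat.pair q.2 ((col q.1.2 - 2) / 2))) 0 :=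
    (Primrec.list_getD 0).comp (Primrec.fst.comp Primrec.fst) hpos
  have h1 := (Primrec.nat_lt.comp hm Primrec.snd).and (Primrec.eq.comp hget (Primrec.const 1))
  have h2 := Primrec.list_findIdx (Primrec.list_range.comp
    (Primrec.list_length.comp (Primrec.fst (α := List ℕ) (β := ℕ)))) h1.decide.to₂
  exact h2

theorem primrec_solveStep (t : ℕ) : Primrec fun p : List ℕ × ℕ => solveStep t p.1 p.2 := by
  have hσ : Primrec fun p : List ℕ × ℕ => p.1 := Primrec.fst
  have hn : Primrec fun p : List ℕ × ℕ => p.2 := Primrec.snd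
  have h1 : Primrec fun p : List ℕ × ℕ => p.2.unpair.1 := primrec_unpair_fst.comp hn
  have h2 : Primrec fun p : List ℕ × ℕ => p.2.unpair.2 := primrec_unpair_snd.comp hn
  have hT : Primrec fun p : List ℕ × ℕ => p.2.unpair.2.unpair.1 := primrec_unpair_fst.comp h2
  have hm : Primrec fun p : List ℕ × ℕ => p.2.unpair.2.unpair.2 := primrec_unpair_snd.comp h2
  have hget : ∀ {q : List ℕ × ℕ → ℕ}, Primrec q →
      Primrec fun p : List ℕ × ℕ => p.1.getD (q p) 0 :=
    fun hq => (Primrec.list_getD 0).comp hσ hq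
  have hc : Primrec fun p : List ℕ × ℕ => col p.2.unpair.2.unpair.2 := primrec_col.comp hm
  have hj : Primrec fun p : List ℕ × ℕ => (col p.2.unpair.2.unpair.2 - 2) / 2 :=
    Primrec.nat_div.comp (Primrec.nat_sub.comp hc (Primrec.const 2)) (Primrec.const 2)
  have huse := ((Primrec.eq.comp hc (Primrec.succ.comp (Primrec.nat_double_succ.comp hj))).and
    (Primrec.nat_lt.comp hj (Primrec.const t))).and
    (Primrec.eq.comp (hget (Primrec.nat_double_succ.comp hj)) (Primrec.const 1))
  have hsearch : Primrec fun p : List ℕ × ℕ => searchRow p.1 p.2.unpair.2.unpair.2 :=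
    primrec_searchRow.comp (hσ.pair hm)
  have c41 := Primrec.list_getElem?.comp hσ (Primrec.nat_mul.comp (Primrec.const 4)
    (Primrec₂.natPair.comp (Primrec.const 4) (Primrec₂.natPair.comp hsearch hm)))
  have c42 := Primrec.option_some.comp (hget (Primrec.nat_add.comp
    (Primrec.nat_mul.comp (Primrec.const 4) hm) (Primrec.const 2)))
  have hTt := Primrec.nat_le.comp hT (Primrec.const t)
  have c0 : Primrec fun _ : List ℕ × ℕ => some 0 := Primrec.const _
  have c1 : Primrec fun _ : List ℕ × ℕ => some 1 := Primrec.const _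
  have s5 := Primrec.ite (Primrec.eq.comp h1 (Primrec.const 4))
    (Primrec.ite hTt (Primrec.ite huse c41 c0) c42) c0
  have s4 := Primrec.ite (Primrec.eq.comp h1 (Primrec.const 3)) (Primrec.ite hTt
    (Primrec.ite ((Primrec.nat_lt.comp hm (Primrec.const t)).and
      (Primrec.eq.comp (hget (Primrec.nat_double_succ.comp hm)) (Primrec.const 1))) c1 c0)
    (Primrec.ite (Primrec.eq.comp hm (Primrec.const t)) c1 c0)) s5
  have s3 := Primrec.ite (Primrec.nat_le.comp h1 (Primrec.const 2))
    (Primrec.option_some.comp (hget (Primrec.nat_mul.comp (Primrec.const 4) hn))) s4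
  have s2 := Primrec.ite (Primrec.nat_le.comp (Primrec.list_length.comp hσ)
    (Primrec.nat_add.comp (Primrec.nat_add.comp (Primrec.nat_mul.comp (Primrec.const 4) hn)
      (Primrec.const (2 * t))) (Primrec.const 4))) (Primrec.const none) s3
  refine s2.of_eq fun p => ?_
  rw [solveStep]
  congr

theorem join_four_mul (f h g : ℕ → ℕ) (n : ℕ) : join (join f h) g (4 * n) = f n := by
  rw [show 4 * n = 2 * (2 * n) by omega, join_even, join_even]

theorem searchRow_spec {f h g : ℕ → ℕ} {l m : ℕ}
    (hlt : 4 * Nat.pair 3 (Nat.pair (firstRow f m) ((col m - 2) / 2)) < l)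
    (hrow : m < firstRow f m ∧ f (Nat.pair 3 (Nat.pair (firstRow f m) ((col m - 2) / 2))) = 1) :
    searchRow (initSeg (join (join f h) g) l) m = firstRow f m := by
  have hget : ∀ n, 4 * n < l → (initSeg (join (join f h) g) l).getD (4 * n) 0 = f n := by
    intro n hn
    rw [List.getD_eq_getElem?_getD, initSeg_getElem? _ hn, Option.getD_some,
      join_four_mul]
  have hle : firstRow f m ≤ Nat.pair 3 (Nat.pair (firstRow f m) ((col m - 2) / 2)) :=
    (Nat.left_le_pair _ _).trans (Nat.right_le_pair _ _)
  rw [searchRow, initSeg_length, List.findIdx_eq (by rw [List.length_range]; omega)]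
  simp only [List.getElem_range, decide_eq_true_eq, decide_eq_false_iff_not]
  refine ⟨⟨hrow.1, by rw [hget _ hlt]; exact hrow.2⟩, fun r hr ⟨h1, h2⟩ => ?_⟩
  have hpos : Nat.pair 3 (Nat.pair r ((col m - 2) / 2)) <
      Nat.pair 3 (Nat.pair (firstRow f m) ((col m - 2) / 2)) :=
    Nat.pair_lt_pair_right _ (Nat.pair_lt_pair_left _ hr)
  rw [hget _ (by omega)] at h2
  exact Nat.notMem_of_lt_sInf hr ⟨h1, h2⟩

theorem pair_le_pair {a b c d : ℕ} (h1 : a ≤ b) (h2 : c ≤ d) : Nat.pair a c ≤ Nat.pair b d :=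
  (StrictMono.monotone (f := fun x => Nat.pair x c) (fun _ _ => Nat.pair_lt_pair_left c) h1).trans
    (StrictMono.monotone (f := Nat.pair b) (fun _ _ => Nat.pair_lt_pair_right b) h2)

/-- Pairing is monotone and the selection belonging to `m` is at most `m`, so the selection entries
of all rows up to the one found precede the value entry in the oracle. If that entry is visible, the
search has overlooked nothing. -/
theorem searchRow_eq_of_visible {f h g : ℕ → ℕ} {l m : ℕ}
    (hrow : m < firstRow f m ∧ f (Nat.pair 3 (Nat.pair (firstRow f m) ((col m - 2) / 2))) = 1)
    (hlt : 4 * Nat.pair 4 (Nat.pair (searchRow (initSeg (join (join f h) g) l) m) m) < l) :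
    searchRow (initSeg (join (join f h) g) l) m = firstRow f m := by
  set R := searchRow (initSeg (join (join f h) g) l) m with hR
  have hRl : R < l := by
    have := (Nat.left_le_pair R m).trans (Nat.right_le_pair 4 (Nat.pair R m))
    omega
  have hjm : (col m - 2) / 2 ≤ m := by
    have : col m ≤ m := (Nat.unpair_left_le _).trans (Nat.unpair_left_le _)
    omega
  have hpos : ∀ r ≤ R, 4 * Nat.pair 3 (Nat.pair r ((col m - 2) / 2)) < l := fun r hr => by
    have h1 : Nat.pair r ((col m - 2) / 2) ≤ Nat.pair R m := pair_le_pair hr hjm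
    have h2 := pair_le_pair (show 3 ≤ 4 by omega) h1
    omega
  have hfound := (List.findIdx_eq (by rwa [List.length_range, initSeg_length])).1 hR.symm
  simp only [List.getElem_range, decide_eq_true_eq] at hfound
  obtain ⟨⟨h1, h2⟩, -⟩ := hfound
  rw [List.getD_eq_getElem?_getD, initSeg_getElem? _ (hpos R le_rfl), Option.getD_some,
    join_four_mul] at h2
  exact hR ▸ searchRow_spec (hpos _ (Nat.sInf_le ⟨h1, h2⟩)) hrow

theorem lemLE_teamTarget (t : ℕ) : LemLE teamTarget (joinSet teamSource (helper t)) := by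
  obtain ⟨c, -, hc⟩ := exists_index (H := fun _ σ n => solveStep t σ n)
    ((primrec_solveStep t).comp Primrec.snd).to_comp
  refine LemLE.trans (LemLE.of_index (e := c 0) ?_) (lemLE_flagged t t)
  rintro _ ⟨f, hf, h, hh, g, hg, rfl⟩
  refine ⟨solution t f h g, solution_mem hf hh hg, ?_⟩
  have hbin := hf.1.1.1
  have huse : ∀ l n m, 4 * n + 2 * t + 4 < l →
      (UsesFlag t (fun j => (initSeg (join (join f h) g) l).getD (2 * j + 1) 0) m ↔
        UsesFlag t g m) := by
    intro l n m hl
    refine and_congr_right fun hm => ?_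
    simp only
    rw [List.getD_eq_getElem?_getD, initSeg_getElem? _ (by omega), Option.getD_some, join_odd]
  -- The bound covers the place `4n` of `f`, the flags `2j + 1` for `j < t` and the places `4m + 2`
  -- of the helper for `m ≤ n`. Only the copying from a searched row may need more of the oracle.
  have key : ∀ n l, 4 * n + 2 * t + 4 < l →
      (n.unpair.1 = 4 → n.unpair.2.unpair.1 ≤ t → UsesFlag t g n.unpair.2.unpair.2 →
        searchRow (initSeg (join (join f h) g) l) n.unpair.2.unpair.2 =
          firstRow f n.unpair.2.unpair.2 ∧
        4 * Nat.pair 4 (Nat.pair (firstRow f n.unpair.2.unpair.2) n.unpair.2.unpair.2) < l) →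
      solveStep t (initSeg (join (join f h) g) l) n = some (solution t f h g n) := by
    intro n l hl hrow
    have h2 : n.unpair.2.unpair.2 ≤ n := (Nat.unpair_right_le _).trans (Nat.unpair_right_le _)
    have hget : ∀ k < l, (initSeg (join (join f h) g) l).getD k 0 = join (join f h) g k := by
      intro k hk
      rw [List.getD_eq_getElem?_getD, initSeg_getElem? _ hk]; rfl
    unfold solveStep solution
    rw [initSeg_length, if_neg (by omega)]
    by_cases c2 : n.unpair.1 ≤ 2
    · rw [if_pos c2, if_pos c2, hget _ (by omega), join_four_mul]
    rw [if_neg c2, if_neg c2]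
    by_cases c3 : n.unpair.1 = 3
    · rw [if_pos c3, if_pos c3]
      by_cases hT : n.unpair.2.unpair.1 ≤ t
      · rw [if_pos hT, if_pos hT]
        by_cases hj : n.unpair.2.unpair.2 < t
        · rw [hget _ (by omega), join_odd]
          split_ifs <;> rfl
        · simp [hj]
      · rw [if_neg hT, if_neg hT]
        split_ifs <;> rfl
    rw [if_neg c3, if_neg c3]
    by_cases c4 : n.unpair.1 = 4
    · rw [if_pos c4, if_pos c4]
      by_cases hT : n.unpair.2.unpair.1 ≤ t
      · rw [if_pos hT, if_pos hT]
        by_cases hu : UsesFlag t g n.unpair.2.unpair.2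
        · rw [if_pos ((huse _ _ _ hl).2 hu), if_pos hu]
          obtain ⟨h3, h4⟩ := hrow c4 hT hu
          rw [h3, initSeg_getElem? _ h4, join_four_mul]
        · rw [if_neg (mt (huse _ _ _ hl).1 hu), if_neg hu]
      · rw [if_neg hT, if_neg hT, hget _ (by omega),
          show 4 * n.unpair.2.unpair.2 + 2 = 2 * (2 * n.unpair.2.unpair.2 + 1) by omega,
          join_even, join_odd]
    · rw [if_neg c4, if_neg c4]
  refine hc 0 _ _ (fun n => ?_) (fun n l v hv => ?_)
  · obtain ⟨l, hl, h1, h2⟩ := ((eventually_gt_atTop (4 * n + 2 * t + 4)).and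
      ((eventually_gt_atTop (4 * Nat.pair 3 (Nat.pair (firstRow f n.unpair.2.unpair.2)
        ((col n.unpair.2.unpair.2 - 2) / 2)))).and
      (eventually_gt_atTop (4 * Nat.pair 4 (Nat.pair (firstRow f n.unpair.2.unpair.2)
        n.unpair.2.unpair.2))))).exists
    exact ⟨l, key n l hl fun _ _ hu => ⟨searchRow_spec h1 (firstRow_spec hbin hg hu), h2⟩⟩
  · have hl : 4 * n + 2 * t + 4 < l := by
      by_contra hcon
      rw [solveStep, if_pos (by rw [initSeg_length]; omega)] at hv
      cases hv
    refine Option.some.inj (hv.symm.trans (key n l hl fun c4 hT hu => ?_))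
    rw [solveStep, if_neg (by rw [initSeg_length]; omega), if_neg (by omega), if_neg (by omega),
      if_pos c4, if_pos hT, if_pos ((huse l n _ hl).2 hu)] at hv
    obtain ⟨hlt, -⟩ := List.getElem?_eq_some_iff.1 hv
    rw [initSeg_length] at hlt
    have h1 := searchRow_eq_of_visible (firstRow_spec hbin hg hu) hlt
    exact ⟨h1, h1 ▸ hlt⟩


/-! ## The degree structures -/

theorem joinSet_nonempty {P Q : Set (ℕ → ℕ)} (hP : P.Nonempty) (hQ : Q.Nonempty) :
    (joinSet P Q).Nonempty := by
  obtain ⟨f, hf⟩ := hP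
  obtain ⟨g, hg⟩ := hQ
  exact ⟨_, f, hf, g, hg, rfl⟩

/-- Only one point of the helper matters, and there one index `d` computes a point of `R`. The
number of learners behind the reduction of `R` is therefore irrelevant: prefixing this computation
to the `b` given learners leaves `b` of them, one fewer than the `b + 1` selections available. -/
theorem not_teamLE_of_forall_helper {R : Set (ℕ → ℕ)}
    (hR : ∀ t, TeamLE R (helper t)) : ¬ TeamLE teamTarget (joinSet teamSource R) := by
  rintro ⟨Γ, ⟨b, Ψ, hΨ, hΓ⟩, hdef⟩
  obtain ⟨Δ, ⟨_, _, -, hΔ⟩, hdef'⟩ := hR (b + 1)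
  obtain ⟨h', hh', hR'⟩ := hdef' _ (helperPoint_mem (b + 1))
  obtain ⟨-, d, -, hd⟩ := hΔ _ _ hh'
  obtain ⟨l, hl⟩ := exists_index_left
  obtain ⟨r, hr⟩ := exists_index_right
  obtain ⟨p, hp⟩ := exists_index_trans r d
  obtain ⟨q, hq⟩ := exists_index_pair l p
  obtain ⟨c, -, hcomp⟩ := exists_index_comp
  obtain ⟨f, hf, hno⟩ := exists_unidentified (Nat.lt_succ_self b)
    fun i σ => c q (Ψ i (outStr q σ))
  obtain ⟨g, hg, hgT⟩ := hdef (join f h') ⟨f, hf, h', hR', rfl⟩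
  obtain ⟨i, e, he, heg⟩ := hΓ _ _ hg
  have hq' := hq _ _ _ (hl f _) (hp _ _ _ (hr f _) hd)
  obtain ⟨s, hs, hout⟩ := outStr_spec hq'
  refine hno g hgT i ⟨c q e, ?_, hcomp _ _ _ _ _ hq' heg⟩
  filter_upwards [hs.eventually he] with n hn
  simp only [hout, hn]

variable {r : Set (ℕ → ℕ) → Set (ℕ → ℕ) → Prop} [IsPreorder (Set (ℕ → ℕ)) r]

/-- A preorder of mass problems that contains `teamSource`, `teamTarget` and the helpers and is
closed under joins does not induce a Brouwerian partial order. -/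
theorem not_isBrouwerian_antisymmetrization {α : Type} [Preorder α] (S : α → Set (ℕ → ℕ))
    (hS : ∀ a b, a ≤ b ↔ r (S a) (S b)) (hteam : ∀ {P Q}, r P Q → TeamLE P Q)
    (hleft : ∀ P Q, r P (joinSet P Q)) (hright : ∀ P Q, r Q (joinSet P Q))
    (hsup : ∀ {P Q R}, r P R → r Q R → r (joinSet P Q) R)
    (hbound : ∀ t, r teamTarget (joinSet teamSource (helper t)))
    (hjoin : ∀ a b, ∃ c, S c = joinSet (S a) (S b)) {p q : α} (hp : S p = teamTarget)
    (hq : S q = teamSource) (h : ℕ → α) (hh : ∀ t, S (h t) = helper t) :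
    ¬ IsBrouwerian (Antisymmetrization α (· ≤ ·)) := by
  intro hB
  obtain ⟨x, hx, hleast⟩ := hB (toAntisymmetrization _ p) (toAntisymmetrization _ q)
  induction x using Antisymmetrization.ind with
  | _ a =>
  refine not_teamLE_of_forall_helper (R := S a) (fun t => hteam ?_) (hteam ?_)
  · rw [← hh, ← hS, ← toAntisymmetrization_le_toAntisymmetrization_iff]
    refine hleast fun u hu hu' => ?_
    induction u using Antisymmetrization.ind with
    | _ u =>
    rw [toAntisymmetrization_le_toAntisymmetrization_iff, hS] at hu hu' ⊢
    rw [hq] at hu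
    rw [hh] at hu'
    rw [hp]
    exact trans_of r (hbound t) (hsup hu hu')
  -- The join is a common upper bound realized within the structure, so the defining property of the
  -- least element applies to it.
  · obtain ⟨c, hc⟩ := hjoin q a
    have := hx (toAntisymmetrization _ c)
    simp only [toAntisymmetrization_le_toAntisymmetrization_iff, hS, hc, hp, hq] at this
    exact this (hleft _ _) (hright _ _)

theorem not_isBrouwerian_degree_and_localDegree (hteam : ∀ {P Q}, r P Q → TeamLE P Q)
    (hleft : ∀ P Q, r P (joinSet P Q)) (hright : ∀ P Q, r Q (joinSet P Q))
    (hsup : ∀ {P Q R}, r P R → r Q R → r (joinSet P Q) R)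
    (hbound : ∀ t, r teamTarget (joinSet teamSource (helper t))) :
    ¬ IsBrouwerian (Degree r) ∧ ¬ IsBrouwerian (LocalDegree r) := by
  constructor
  · exact not_isBrouwerian_antisymmetrization (α := MassProblem r) (r := r) (fun P => P)
      (fun _ _ => Iff.rfl) hteam hleft hright hsup hbound (fun P Q => ⟨joinSet P Q, rfl⟩)
      (p := teamTarget) (q := teamSource) rfl rfl helper fun _ => rfl
  · exact not_isBrouwerian_antisymmetrization (α := LocalMassProblem r) (r := r) (fun P => P.1)
      (fun _ _ => Iff.rfl) hteam hleft hright hsup hbound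
      (fun P Q => ⟨⟨joinSet P.1 Q.1, P.2.1.join Q.2.1, joinSet_nonempty P.2.2 Q.2.2⟩, rfl⟩)
      (p := ⟨teamTarget, isPi01Cantor_teamTarget, nonempty_teamTarget⟩)
      (q := ⟨teamSource, isPi01Cantor_teamSource, nonempty_teamSource⟩) rfl rfl
      (fun t => ⟨helper t, isPi01Cantor_helper t, nonempty_helper t⟩) fun _ => rfl

end MassProblems

theorem mainTheorem7 :
    (¬ MassProblems.IsBrouwerian (MassProblems.Degree MassProblems.TeamLE) ∧
      ¬ MassProblems.IsBrouwerian (MassProblems.LocalDegree MassProblems.TeamLE)) ∧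
    (¬ MassProblems.IsBrouwerian (MassProblems.Degree MassProblems.LemLE) ∧
      ¬ MassProblems.IsBrouwerian (MassProblems.LocalDegree MassProblems.LemLE)) := by
  open MassProblems in
  exact ⟨not_isBrouwerian_degree_and_localDegree (fun h => h)
      (fun P Q => (lemLE_joinSet_left P Q).teamLE) (fun P Q => (lemLE_joinSet_right P Q).teamLE)
      TeamLE.joinSet fun t => (lemLE_teamTarget t).teamLE,
    not_isBrouwerian_degree_and_localDegree LemLE.teamLE lemLE_joinSet_left lemLE_joinSet_right
      LemLE.joinSet lemLE_teamTarget⟩
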